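/- **Conventions.** Let $(\mathscr V,\otimes,\mathcal I)$ be a closed, complete and cocomplete symmetric monoidal category. Let $\Lambda$ be the category of the based finite sets $\mathbf n=\{0,1,\dots,n\}$ (base point $0$, $n\ge 0$) and based injections, and let $\Sigma\subset\Lambda$ be the subcategory of isomorphisms. For $\Xi\in\{\Sigma,\Lambda\}$ write $\Xi^{op}[\mathscr V]$ for the category of functors $\Xi^{op}\to\mathscr V$ and natural transformations. A *based operad* is a (symmetric) operad $\mathscr C$ in $\mathscr V$, with unit $\mathcal I\to\mathscr C(1)$, together with a morphism $\mathcal I\to\mathscr C(0)$ (the base point); inserting base points makes $\mathscr C$ a functor $\Lambda^{op}\to\mathscr V$. For a finite set $S$ with $n$ elements, $\mathscr C(S)$ denotes $\mathscr C(n)$, with orderings of $S$ identified by the symmetric group action. *The permutative envelope* $\overline{\mathscr C}$ is the $\mathscr V$-category with objects $\mathbf n$ and $\overline{\mathscr C}(\mathbf n,\mathbf m)=\mathscr C^{\boxtimes m}(\mathbf n)=\coprod_{\varphi}\bigotimes_{j=1}^m\mathscr C(\varphi^{-1}(j))$, where $\varphi$ runs through the based maps $\mathbf n\to\mathbf m$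 with $\varphi^{-1}(0)=\{0\}$; composition is given by the structure maps of $\mathscr C$. If $\mathscr V$ is Cartesian monoidal, *the category of operators* $\widehat{\mathscr C}$ is the $\mathscr V$-category with objects $\mathbf n$ and $\widehat{\mathscr C}(\mathbf n,\mathbf m)=\coprod_{\varphi}\bigotimes_{j=1}^m\mathscr C(\varphi^{-1}(j))$, where $\varphi$ runs through all based maps $\mathbf n\to\mathbf m$; composition is given by the structure maps of $\mathscr C$ and by projecting away the factors whose index is sent to $0$. The unit and the base point of $\mathscr C$ give a functor from $\Lambda$, and hence from $\Sigma$, to the underlying category of $\mathscr E=\overline{\mathscr C}$ or $\widehat{\mathscr C}$, which is the identity on objects. *The associated monads.* For $\mathscr E=\overline{\mathscr C}$ or $\widehat{\mathscr C}$ and $\Xi\in\{\Sigma,\Lambda\}$, let $\mathbb E^{op}_\Xi$ be the monad on $\Xi^{op}[\mathscr V]$ with $(\mathbb E^{op}_\Xi Y)(\mathbf n)=\int^{\mathbf m\in\Xi}Y(\mathbf m)\otimes\mathscr E(\mathbf n,\mathbf m)$, whose multiplication and unit are given by composition and identities in $\mathscr E$; for $\mathscr E=\overline{\mathscr C}$ and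 $\mathscr E=\widehat{\mathscr C}$ it is denoted $\overline{\mathbb C}{}^{op}_\Xi$ and $\widehat{\mathbb C}{}^{op}_\Xi$. *Right modules.* For $D\in\Xi^{op}[\mathscr V]$ the Kelly product $D\odot_\Xi\mathscr C$ is $(D\odot_\Xi\mathscr C)(\mathbf n)=\int^{\mathbf k\in\Xi}D(\mathbf k)\otimes\mathscr C^{\boxtimes k}(\mathbf n)$. $\mathrm{RMod}_{\mathscr C}[\Xi^{op}[\mathscr V]]$ is the category of objects $D$ of $\Xi^{op}[\mathscr V]$ with an associative and unital right action $D\odot_\Xi\mathscr C\to D$ of $\mathscr C$, and of morphisms in $\Xi^{op}[\mathscr V]$ compatible with the actions. **Theorem.** Let $\mathscr C$ be a based operad in $\mathscr V$. (1) The following five categories are isomorphic: the category $\mathrm{Fun}_{\mathscr V}(\overline{\mathscr C}^{op},\mathscr V)$ of $\mathscr V$-functors and $\mathscr V$-natural transformations; the category of $\overline{\mathbb C}{}^{op}_\Sigma$-algebras in $\Sigma^{op}[\mathscr V]$; the category of $\overline{\mathbb C}{}^{op}_\Lambda$-algebras in $\Lambda^{op}[\mathscr V]$; $\mathrm{RMod}_{\mathscr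 C}[\Sigma^{op}[\mathscr V]]$; and $\mathrm{RMod}_{\mathscr C}[\Lambda^{op}[\mathscr V]]$. (2) If $\mathscr V$ is Cartesian monoidal, the following three categories are isomorphic: $\mathrm{Fun}_{\mathscr V}(\widehat{\mathscr C}^{op},\mathscr V)$; the category of $\widehat{\mathbb C}{}^{op}_\Sigma$-algebras in $\Sigma^{op}[\mathscr V]$; and the category of $\widehat{\mathbb C}{}^{op}_\Lambda$-algebras in $\Lambda^{op}[\mathscr V]$. Here all isomorphisms are isomorphisms of categories (not only equivalences), and those starting at the category of $\mathscr V$-functors can be chosen such that the underlying object of $\Sigma^{op}[\mathscr V]$ or $\Lambda^{op}[\mathscr V]$ of the image of a $\mathscr V$-functor is its restriction along $\Sigma\to\mathscr E$ or $\Lambda\to\mathscr E$. -/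

import Mathlib

open CategoryTheory MonoidalCategory Limits Opposite

universe v u

namespace OperadModules

noncomputable section

/-! ### Coherence for tensor products indexed by finite sets -/

section Coherence

variable {V : Type u} [Category.{v} V] [MonoidalCategory V]

/-- The tensor product `Y k₁ ⊗ (Y k₂ ⊗ (⋯ ⊗ 𝟙))` of a family along a list of indices. -/
@[reducible] def listTensor {K : Type} (Y : K → V) : List K → V
  | [] => 𝟙_ V
  | k :: l => Y k ⊗ listTensor Y l

/-- The functoriality of `listTensor` in the family. -/
def listTensorMap {K : Type} {Y Z : K → V} (f : ∀ k, Y k ⟶ Z k) :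
    ∀ l : List K, listTensor Y l ⟶ listTensor Z l
  | [] => 𝟙 _
  | k :: l => f k ⊗ₘ listTensorMap f l

lemma listTensorMap_id {K : Type} {Y : K → V} (l : List K) :
    listTensorMap (fun k => 𝟙 (Y k)) l = 𝟙 _ := by
  induction l with
  | nil => rfl
  | cons k l ih => simp [listTensorMap, ih]

lemma listTensorMap_comp {K : Type} {Y Z W : K → V} (f : ∀ k, Y k ⟶ Z k) (g : ∀ k, Z k ⟶ W k)
    (l : List K) :
    listTensorMap f l ≫ listTensorMap g l = listTensorMap (fun k => f k ≫ g k) l := by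
  induction l with
  | nil => simp [listTensorMap]
  | cons k l ih => simp [listTensorMap, ih]

/-- Formal tensor expressions with leaves labelled by `J`. -/
inductive Ex (J : Type) : Type 1
  | leaf (j : J) : Ex J
  | one : Ex J
  | tens (a c : Ex J) : Ex J
  | big {K : Type} (l : List K) (s : K → Ex J) : Ex J

variable {J : Type}

/-- The value of a formal tensor expression. -/
@[reducible] def Ex.eval (X : J → V) : Ex J → V
  | .leaf j => X j
  | .one => 𝟙_ V
  | .tens a c => a.eval X ⊗ c.eval X
  | .big l s => listTensor (fun k => (s k).eval X) l

/-- The functoriality of the value in the leaves. -/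
def Ex.evalMap {X Y : J → V} (f : ∀ j, X j ⟶ Y j) : ∀ e : Ex J, e.eval X ⟶ e.eval Y
  | .leaf j => f j
  | .one => 𝟙 _
  | .tens a c => a.evalMap f ⊗ₘ c.evalMap f
  | .big l s => listTensorMap (fun k => (s k).evalMap f) l

/-- The leaves of an expression, in order. -/
@[reducible] def Ex.labels : Ex J → List J
  | .leaf j => [j]
  | .one => []
  | .tens a c => a.labels ++ c.labels
  | .big l s => l.flatMap fun k => (s k).labels

/-- Substitution of expressions for the leaves. -/
@[reducible] def Ex.bind {J K : Type} (s : K → Ex J) : Ex K → Ex J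
  | .leaf k => s k
  | .one => .one
  | .tens a c => .tens (a.bind s) (c.bind s)
  | .big l r => .big l fun i => (r i).bind s

/-- Formal structure morphisms between tensor expressions; discarding a factor is allowed
only if `b = true`. -/
inductive FH (b : Bool) {J : Type} : Ex J → Ex J → Type 1
  | id (e) : FH b e e
  | comp {e e' e''} (f : FH b e e') (g : FH b e' e'') : FH b e e''
  | tens {a a' c c'} (f : FH b a a') (g : FH b c c') : FH b (.tens a c) (.tens a' c')
  | assoc (a c d) : FH b (.tens (.tens a c) d) (.tens a (.tens c d))
  | assocInv (a c d) : FH b (.tens a (.tens c d)) (.tens (.tens a c) d)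
  | lu (a) : FH b (.tens .one a) a
  | luInv (a) : FH b a (.tens .one a)
  | ru (a) : FH b (.tens a .one) a
  | ruInv (a) : FH b a (.tens a .one)
  | braid (a c) : FH b (.tens a c) (.tens c a)
  | bnil {K : Type} (s : K → Ex J) : FH b (.big [] s) .one
  | bnilInv {K : Type} (s : K → Ex J) : FH b .one (.big [] s)
  | bcons {K : Type} (k : K) (l : List K) (s : K → Ex J) :
      FH b (.big (k :: l) s) (.tens (s k) (.big l s))
  | bconsInv {K : Type} (k : K) (l : List K) (s : K → Ex J) :
      FH b (.tens (s k) (.big l s)) (.big (k :: l) s)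
  | drop (h : b = true) (e) : FH b e .one

/-- Formal rearrangements of lists. -/
inductive Pth (b : Bool) {J : Type} : List J → List J → Type
  | refl (l) : Pth b l l
  | cons (a) {l l'} (p : Pth b l l') : Pth b (a :: l) (a :: l')
  | swap (a c l) : Pth b (a :: c :: l) (c :: a :: l)
  | trans {l l' l''} (p : Pth b l l') (q : Pth b l' l'') : Pth b l l''
  | drop (h : b = true) (a l) : Pth b (a :: l) l

/-- `Ins a m l`: the list `l` is `m` with `a` inserted somewhere. -/
inductive Ins {J : Type} (a : J) : List J → List J → Type
  | head (m) : Ins a m (a :: m)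
  | tail (c) {m l} (i : Ins a m l) : Ins a (c :: m) (c :: l)

lemma Ins.mem {a : J} {m l : List J} (i : Ins a m l) : a ∈ l := by
  induction i with
  | head => simp
  | tail c i ih => simp [ih]

lemma Ins.perm {a : J} {m l : List J} (i : Ins a m l) : l.Perm (a :: m) := by
  induction i with
  | head => rfl
  | tail c i ih => exact (ih.cons c).trans (List.Perm.swap _ _ _)

lemma Ins.unique {a : J} {m l : List J} (i : Ins a m l) (h : l.Nodup) :
    ∀ {m' : List J} (i' : Ins a m' l), ∃ e : m = m', e ▸ i = i' := by
  induction i with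
  | head m =>
    intro m' i'
    cases i' with
    | head => exact ⟨rfl, rfl⟩
    | tail c i' => exact absurd i'.mem (List.nodup_cons.1 h).1
  | tail c i ih =>
    intro m' i'
    cases i' with
    | head => exact absurd i.mem (List.nodup_cons.1 h).1
    | tail c i' =>
      obtain ⟨rfl, rfl⟩ := ih (List.nodup_cons.1 h).2 i'
      exact ⟨rfl, rfl⟩

variable [SymmetricCategory V]

variable {b : Bool}

/-- The value of a formal structure morphism. -/
def FH.eval (t : b = true → IsTerminal (𝟙_ V)) (X : J → V) :
    ∀ {e e' : Ex J}, FH b e e' → (e.eval X ⟶ e'.eval X)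
  | _, _, .id e => 𝟙 (e.eval X)
  | _, _, .comp f g => f.eval t X ≫ g.eval t X
  | _, _, .tens f g => f.eval t X ⊗ₘ g.eval t X
  | _, _, .assoc a c d => (α_ (a.eval X) (c.eval X) (d.eval X)).hom
  | _, _, .assocInv a c d => (α_ (a.eval X) (c.eval X) (d.eval X)).inv
  | _, _, .lu a => (λ_ (a.eval X)).hom
  | _, _, .luInv a => (λ_ (a.eval X)).inv
  | _, _, .ru a => (ρ_ (a.eval X)).hom
  | _, _, .ruInv a => (ρ_ (a.eval X)).inv
  | _, _, .braid a c => (β_ (a.eval X) (c.eval X)).hom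
  | _, _, .bnil _ => 𝟙 (𝟙_ V)
  | _, _, .bnilInv _ => 𝟙 (𝟙_ V)
  | _, _, .bcons k l s => 𝟙 ((s k).eval X ⊗ listTensor (fun k => (s k).eval X) l)
  | _, _, .bconsInv k l s => 𝟙 ((s k).eval X ⊗ listTensor (fun k => (s k).eval X) l)
  | _, _, .drop h e => (t h).from (e.eval X)

/-- The interchange of the first two factors. -/
def swap₂ (A B C : V) : A ⊗ (B ⊗ C) ⟶ B ⊗ (A ⊗ C) :=
  (α_ _ _ _).inv ≫ (β_ A B).hom ▷ C ≫ (α_ _ _ _).hom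

lemma swap₂_natural {A A' B B' C C' : V} (f : A ⟶ A') (g : B ⟶ B') (h : C ⟶ C') :
    (f ⊗ₘ (g ⊗ₘ h)) ≫ swap₂ A' B' C' = swap₂ A B C ≫ (g ⊗ₘ (f ⊗ₘ h)) := by
  have : ((f ⊗ₘ g) ⊗ₘ h) ≫ (β_ A' B').hom ▷ C' = (β_ A B).hom ▷ C ≫ ((g ⊗ₘ f) ⊗ₘ h) := by
    rw [← tensorHom_id, ← tensorHom_id, tensorHom_comp_tensorHom, tensorHom_comp_tensorHom,
      BraidedCategory.braiding_naturality, Category.comp_id, Category.id_comp]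
  simp only [swap₂, Category.assoc, associator_inv_naturality_assoc, reassoc_of% this,
    associator_naturality]

@[simp]
lemma swap₂_swap₂ (A B C : V) : swap₂ A B C ≫ swap₂ B A C = 𝟙 _ := by
  simp [swap₂, ← comp_whiskerRight_assoc]

@[simp]
lemma swap₂_swap₂_assoc (A B C : V) {Z : V} (f : A ⊗ (B ⊗ C) ⟶ Z) :
    swap₂ A B C ≫ swap₂ B A C ≫ f = f := by
  rw [← Category.assoc, swap₂_swap₂, Category.id_comp]

def Pth.eval (t : b = true → IsTerminal (𝟙_ V)) (X : J → V) :
    ∀ {l l' : List J}, Pth b l l' → (listTensor X l ⟶ listTensor X l')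
  | _, _, .refl l => 𝟙 _
  | _, _, .cons a p => X a ◁ p.eval t X
  | _, _, .swap a c l => swap₂ (X a) (X c) (listTensor X l)
  | _, _, .trans p q => p.eval t X ≫ q.eval t X
  | _, _, .drop h a l => (t h).from (X a) ▷ listTensor X l ≫ (λ_ _).hom

def Ins.eval (X : J → V) {a : J} : ∀ {m l : List J}, Ins a m l →
    (listTensor X l ⟶ X a ⊗ listTensor X m)
  | _, _, .head m => 𝟙 _
  | _, _, .tail c i => X c ◁ i.eval X ≫ swap₂ _ _ _



lemma swap₂_yb (A B C M : V) :
    swap₂ B C (A ⊗ M) ≫ C ◁ swap₂ B A M ≫ swap₂ C A (B ⊗ M) =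
      B ◁ swap₂ C A M ≫ swap₂ B A (C ⊗ M) ≫ A ◁ swap₂ B C M := by
  simp only [swap₂]
  calc _ = 𝟙 _ ⊗≫ ((α_ B C A).inv ≫ (β_ B C).hom ▷ A ≫ (α_ C B A).hom ≫ C ◁ (β_ B A).hom ≫
      (α_ C A B).inv ≫ (β_ C A).hom ▷ B ≫ (α_ A C B).hom) ▷ M ⊗≫ 𝟙 _ := by monoidal
    _ = _ := by
      rw [BraidedCategory.yang_baxter]; monoidal

lemma swap₂_drop (C A M : V) (f : C ⟶ 𝟙_ V) :
    swap₂ C A M ≫ A ◁ (f ▷ M ≫ (λ_ _).hom) = f ▷ _ ≫ (λ_ (A ⊗ M)).hom := by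
  have : (β_ C A).hom ≫ A ◁ f = f ▷ A ≫ (β_ (𝟙_ V) A).hom := by
    rw [BraidedCategory.braiding_naturality_left]
  calc _ = 𝟙 _ ⊗≫ ((β_ C A).hom ≫ A ◁ f) ▷ M ⊗≫ 𝟙 _ := by simp only [swap₂]; monoidal
    _ = _ := by rw [this, braiding_tensorUnit_left]; monoidal

lemma Pth.pull (t : b = true → IsTerminal (𝟙_ V)) (X : J → V) {l l' : List J} (p : Pth b l l') :
    ∀ {a : J} {m' : List J} (i' : Ins a m' l'), ∃ (m : List J) (i : Ins a m l) (q : Pth b m m'),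
      p.eval t X ≫ i'.eval X = i.eval X ≫ X a ◁ q.eval t X := by
  induction p with
  | refl l => intro a m' i'; exact ⟨m', i', .refl _, by simp [Pth.eval]⟩
  | cons c p ih =>
    intro a m' i'
    cases i' with
    | head => exact ⟨_, .head _, p, by dsimp only [Pth.eval, Ins.eval, listTensor]; simp⟩
    | tail c i' =>
      obtain ⟨m, i, q, h⟩ := ih i'
      refine ⟨_, .tail c i, .cons c q, ?_⟩
      have := swap₂_natural (𝟙 (X c)) (𝟙 (X a)) (q.eval t X)
      simp only [id_tensorHom] at this
      dsimp only [Pth.eval, Ins.eval, listTensor]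
      simp only [Category.assoc]
      rw [← this, ← MonoidalCategory.whiskerLeft_comp_assoc, h]
      simp
  | swap a c l =>
    intro a' m' i'
    cases i' with
    | head => exact ⟨_, .tail _ (.head _), .refl _, by dsimp only [Pth.eval, Ins.eval, listTensor]; simp⟩
    | tail _ i' =>
      cases i' with
      | head => exact ⟨_, .head _, .refl _, by dsimp only [Pth.eval, Ins.eval, listTensor]; simp⟩
      | tail _ i' =>
        refine ⟨_, .tail _ (.tail _ i'), .swap a c _, ?_⟩
        have := swap₂_natural (𝟙 (X a)) (𝟙 (X c)) (i'.eval X)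
        simp only [id_tensorHom] at this
        dsimp only [Pth.eval, Ins.eval, listTensor]
        simp only [MonoidalCategory.whiskerLeft_comp, Category.assoc]
        rw [← reassoc_of% this]
        congr 1
        exact swap₂_yb (X a') (X a) (X c) _
  | trans p q ihp ihq =>
    intro a m' i'
    obtain ⟨m, i, q', h⟩ := ihq i'
    obtain ⟨m₂, i₂, p', h'⟩ := ihp i
    exact ⟨_, i₂, p'.trans q', by simp [Pth.eval, h, reassoc_of% h']⟩
  | drop hb c l =>
    intro a m' i'
    refine ⟨_, .tail c i', .drop hb c _, ?_⟩
    dsimp only [Pth.eval, Ins.eval, listTensor]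
    simp only [Category.assoc, swap₂_drop]
    rw [whisker_exchange_assoc]; simp

lemma Pth.length {l l' : List J} (p : Pth false l l') : l.length = l'.length := by
  induction p with
  | drop h => simp at h
  | _ => simp_all

lemma Pth.eval_nil (t : false = true → IsTerminal (𝟙_ V)) (X : J → V) {l l' : List J}
    (p : Pth false l l') (h : l = []) : ∃ h' : l = l',
      p.eval t X = eqToHom (congrArg (listTensor X) h') := by
  induction p with
  | refl l => exact ⟨rfl, rfl⟩
  | trans p q ihp ihq =>
    obtain ⟨h₁, e₁⟩ := ihp h
    obtain ⟨h₂, e₂⟩ := ihq (h₁ ▸ h)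
    exact ⟨h₁.trans h₂, by simp [Pth.eval, e₁, e₂]⟩
  | cons => simp at h
  | swap => simp at h
  | drop h' => simp at h'

lemma Pth.eval_eq (t : b = true → IsTerminal (𝟙_ V)) (X : J → V) : ∀ {l' l : List J}
    (p q : Pth b l l') (_ : l.Nodup), p.eval t X = q.eval t X := by
  intro l'
  induction l' with
  | nil =>
    intro l p q _
    cases b with
    | true => exact (t rfl).hom_ext _ _
    | false =>
      have : l = [] := List.eq_nil_of_length_eq_zero p.length
      obtain ⟨_, h⟩ := p.eval_nil t X this
      obtain ⟨_, h'⟩ := q.eval_nil t X this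
      rw [h, h']
  | cons a l' ih =>
    intro l p q hl
    obtain ⟨m, i, p', h⟩ := p.pull t X (.head l')
    obtain ⟨m₂, i₂, q', h'⟩ := q.pull t X (.head l')
    obtain ⟨rfl, rfl⟩ := i.unique hl i₂
    have hm : m.Nodup := (List.nodup_cons.1 (i.perm.nodup_iff.1 hl)).2
    simp only [Ins.eval, Category.comp_id] at h h'
    rw [ih p' q' hm] at h
    exact h.trans h'.symm

/-- Concatenation. -/
def appIso (X : J → V) : ∀ l m : List J,
    listTensor X l ⊗ listTensor X m ≅ listTensor X (l ++ m)
  | [], _ => λ_ _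
  | a :: l, m => α_ (X a) (listTensor X l) (listTensor X m) ≪≫ whiskerLeftIso (X a) (appIso X l m)

/-- Concatenation of many blocks. -/
def bigIso (X : J → V) {K : Type} (s : K → V) (f : K → List J)
    (e : ∀ k, s k ≅ listTensor X (f k)) :
    ∀ l : List K, listTensor s l ≅ listTensor X (l.flatMap f)
  | [] => Iso.refl _
  | k :: l => (e k ⊗ᵢ bigIso X s f e l) ≪≫ appIso X (f k) (l.flatMap f)

/-- Every expression is isomorphic to the tensor product of its leaves. -/
def Ex.norm (X : J → V) : ∀ e : Ex J, e.eval X ≅ listTensor X e.labels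
  | .leaf j => (ρ_ (X j)).symm
  | .one => Iso.refl _
  | .tens a c => (a.norm X ⊗ᵢ c.norm X) ≪≫ appIso X _ _
  | .big l s => bigIso X _ _ (fun k => (s k).norm X) l

lemma Pth.append_right (t : b = true → IsTerminal (𝟙_ V)) (X : J → V) {l l' : List J}
    (p : Pth b l l') (m : List J) : ∃ q : Pth b (l ++ m) (l' ++ m),
      (appIso X l m).hom ≫ q.eval t X = p.eval t X ▷ _ ≫ (appIso X l' m).hom := by
  induction p with
  | refl l => exact ⟨.refl _, by simp [Pth.eval]⟩
  | cons a p ih =>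
    obtain ⟨q, h⟩ := ih
    exact ⟨.cons a q, by
      dsimp [Pth.eval, appIso, listTensor]
      simp [← MonoidalCategory.whiskerLeft_comp, h]⟩
  | swap a c l =>
    refine ⟨.swap a c _, ?_⟩
    dsimp [Pth.eval, appIso]
    have h := swap₂_natural (𝟙 (X a)) (𝟙 (X c)) (appIso X l m).hom
    simp only [id_tensorHom] at h
    simp only [Iso.trans_hom, whiskerLeftIso_hom, MonoidalCategory.whiskerLeft_comp, Category.assoc]
    rw [h]
    simp only [← Category.assoc]
    congr 1
    simp only [swap₂]
    monoidal
  | trans p q ihp ihq =>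
    obtain ⟨p', h⟩ := ihp
    obtain ⟨q', h'⟩ := ihq
    exact ⟨p'.trans q', by simp [Pth.eval, reassoc_of% h, h']⟩
  | drop hb a l =>
    refine ⟨.drop hb a _, ?_⟩
    dsimp [Pth.eval, appIso, listTensor]
    simp only [Category.assoc, whiskerLeftIso_hom]
    rw [whisker_exchange_assoc]
    simp

lemma Pth.append_left (t : b = true → IsTerminal (𝟙_ V)) (X : J → V) (l : List J) {m m' : List J}
    (p : Pth b m m') : ∃ q : Pth b (l ++ m) (l ++ m'),
      (appIso X l m).hom ≫ q.eval t X = _ ◁ p.eval t X ≫ (appIso X l m').hom := by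
  induction l with
  | nil => exact ⟨p, by simp [appIso, listTensor]⟩
  | cons a l ih =>
    obtain ⟨q, h⟩ := ih
    exact ⟨.cons a q, by
      dsimp [Pth.eval, appIso, listTensor]
      simp [← MonoidalCategory.whiskerLeft_comp, h]⟩

lemma Pth.append (t : b = true → IsTerminal (𝟙_ V)) (X : J → V) {l l' m m' : List J}
    (p : Pth b l l') (q : Pth b m m') : ∃ r : Pth b (l ++ m) (l' ++ m'),
      (appIso X l m).hom ≫ r.eval t X = (p.eval t X ⊗ₘ q.eval t X) ≫ (appIso X l' m').hom := by
  obtain ⟨r, h⟩ := p.append_right t X m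
  obtain ⟨r', h'⟩ := Pth.append_left t X l' q
  exact ⟨r.trans r', by simp [Pth.eval, reassoc_of% h, h', MonoidalCategory.tensorHom_def]⟩

lemma Pth.app_assoc (t : b = true → IsTerminal (𝟙_ V)) (X : J → V) (l m n : List J) :
    ∃ (p : Pth b ((l ++ m) ++ n) (l ++ (m ++ n))) (q : Pth b (l ++ (m ++ n)) ((l ++ m) ++ n)),
      (appIso X l m).hom ▷ _ ≫ (appIso X (l ++ m) n).hom ≫ p.eval t X =
        (α_ _ _ _).hom ≫ _ ◁ (appIso X m n).hom ≫ (appIso X l (m ++ n)).hom ∧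
      p.eval t X ≫ q.eval t X = 𝟙 _ ∧ q.eval t X ≫ p.eval t X = 𝟙 _ := by
  induction l with
  | nil => exact ⟨.refl _, .refl _, by simp [Pth.eval, appIso, listTensor], by simp [Pth.eval],
      by simp [Pth.eval]⟩
  | cons a l ih =>
    obtain ⟨p, q, h, h₁, h₂⟩ := ih
    refine ⟨.cons a p, .cons a q, ?_, ?_, ?_⟩
    · dsimp [Pth.eval, appIso, listTensor]
      have := congrArg (fun f => X a ◁ f) h
      simp only [MonoidalCategory.whiskerLeft_comp] at this
      simp [this]
    · dsimp [Pth.eval, listTensor]; simp [← MonoidalCategory.whiskerLeft_comp, h₁]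
    · dsimp [Pth.eval, listTensor]; simp [← MonoidalCategory.whiskerLeft_comp, h₂]

lemma Pth.app_nil (t : b = true → IsTerminal (𝟙_ V)) (X : J → V) (l : List J) :
    ∃ (p : Pth b (l ++ []) l) (q : Pth b l (l ++ [])),
      (appIso X l []).hom ≫ p.eval t X = (ρ_ _).hom ∧
      (ρ_ _).inv ≫ (appIso X l []).hom = q.eval t X := by
  induction l with
  | nil => exact ⟨.refl _, .refl _, by dsimp [Pth.eval, appIso, listTensor]; simp [unitors_equal],
      by dsimp [Pth.eval, appIso, listTensor]; simp [unitors_equal]⟩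
  | cons a l ih =>
    obtain ⟨p, q, h₁, h₂⟩ := ih
    refine ⟨.cons a p, .cons a q, ?_, ?_⟩
    · dsimp [Pth.eval, appIso, listTensor] at h₁ ⊢
      simp [← MonoidalCategory.whiskerLeft_comp, h₁]
    · dsimp [Pth.eval, appIso]
      rw [← h₂]
      simp

lemma Pth.move (t : b = true → IsTerminal (𝟙_ V)) (X : J → V) (a : J) (m l : List J) :
    ∃ p : Pth b (a :: (m ++ l)) (m ++ a :: l),
      X a ◁ (appIso X m l).hom ≫ p.eval t X = swap₂ _ _ _ ≫ (appIso X m (a :: l)).hom := by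
  induction m with
  | nil =>
    refine ⟨.refl _, ?_⟩
    dsimp [Pth.eval, appIso, listTensor, swap₂]
    simp
  | cons c m ih =>
    obtain ⟨p, h⟩ := ih
    refine ⟨.trans (.swap a c _) (.cons c p), ?_⟩
    dsimp [Pth.eval, appIso, listTensor] at h ⊢
    simp only [whiskerLeftIso_hom, MonoidalCategory.whiskerLeft_comp, Category.assoc]
    have h₁ := swap₂_natural (𝟙 (X a)) (𝟙 (X c)) (appIso X m l).hom
    simp only [id_tensorHom] at h₁
    rw [reassoc_of% h₁, ← MonoidalCategory.whiskerLeft_comp, h]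
    simp only [MonoidalCategory.whiskerLeft_comp, ← Category.assoc]
    congr 1
    simp only [swap₂, BraidedCategory.braiding_tensor_right_hom]
    monoidal

lemma Pth.braid (t : b = true → IsTerminal (𝟙_ V)) (X : J → V) (l m : List J) :
    ∃ p : Pth b (l ++ m) (m ++ l),
      (appIso X l m).hom ≫ p.eval t X = (β_ _ _).hom ≫ (appIso X m l).hom := by
  induction l with
  | nil =>
    obtain ⟨p, q, h₁, h₂⟩ := Pth.app_nil t X m
    refine ⟨q, ?_⟩
    rw [← h₂]
    dsimp [appIso, listTensor]
    simp
  | cons a l ih =>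
    obtain ⟨p, h⟩ := ih
    obtain ⟨q, h'⟩ := Pth.move t X a m l
    refine ⟨.trans (.cons a p) q, ?_⟩
    dsimp [Pth.eval, appIso, listTensor] at h h' ⊢
    simp only [whiskerLeftIso_hom, Category.assoc, ← MonoidalCategory.whiskerLeft_comp_assoc]
    rw [h]
    simp only [MonoidalCategory.whiskerLeft_comp, Category.assoc]
    rw [h']
    simp only [swap₂, BraidedCategory.braiding_tensor_left_hom, Category.assoc]

lemma Pth.drops (h : b = true) (l : List J) : Nonempty (Pth b l []) := by
  induction l with
  | nil => exact ⟨.refl _⟩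
  | cons a l ih => exact ih.map fun p => .trans (.drop h a l) p

lemma FH.pth (t : b = true → IsTerminal (𝟙_ V)) (X : J → V) {e e' : Ex J} (f : FH b e e') :
    ∃ p : Pth b e.labels e'.labels,
      f.eval t X ≫ (e'.norm X).hom = (e.norm X).hom ≫ p.eval t X := by
  induction f with
  | id e => exact ⟨.refl _, by simp [FH.eval, Pth.eval]⟩
  | comp f g ihf ihg =>
    obtain ⟨p, h⟩ := ihf
    obtain ⟨q, h'⟩ := ihg
    exact ⟨.trans p q, by simp [FH.eval, Pth.eval, h', reassoc_of% h]⟩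
  | tens f g ihf ihg =>
    obtain ⟨p, h⟩ := ihf
    obtain ⟨q, h'⟩ := ihg
    obtain ⟨r, h₂⟩ := Pth.append t X p q
    refine ⟨r, ?_⟩
    dsimp [FH.eval, Ex.norm]
    rw [tensorIso_hom, tensorIso_hom, Category.assoc, h₂, tensorHom_comp_tensorHom_assoc, h, h', tensorHom_comp_tensorHom_assoc]
  | assoc a c d =>
    obtain ⟨p, q, h₁, h₂, h₃⟩ := Pth.app_assoc t X a.labels c.labels d.labels
    refine ⟨p, ?_⟩
    dsimp [FH.eval, Ex.norm, Ex.eval, Ex.labels] at h₁ ⊢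
    simp only [tensorIso_hom, Iso.trans_hom, Category.assoc]
    have e₁ : ((((a.norm X).hom ⊗ₘ (c.norm X).hom) ≫ (appIso X _ _).hom) ⊗ₘ (d.norm X).hom) =
        (((a.norm X).hom ⊗ₘ (c.norm X).hom) ⊗ₘ (d.norm X).hom) ≫ (appIso X _ _).hom ▷ _ := by
      simp only [← tensorHom_id, tensorHom_comp_tensorHom, Category.comp_id]
    have e₂ : ((a.norm X).hom ⊗ₘ (((c.norm X).hom ⊗ₘ (d.norm X).hom) ≫ (appIso X _ _).hom)) =
        ((a.norm X).hom ⊗ₘ ((c.norm X).hom ⊗ₘ (d.norm X).hom)) ≫ _ ◁ (appIso X _ _).hom := by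
      simp only [← id_tensorHom, tensorHom_comp_tensorHom, Category.comp_id]
    rw [e₁, e₂, Category.assoc, Category.assoc, h₁, associator_naturality_assoc]
  | assocInv a c d =>
    obtain ⟨p, q, h₁, h₂, h₃⟩ := Pth.app_assoc t X a.labels c.labels d.labels
    refine ⟨q, ?_⟩
    dsimp [FH.eval, Ex.norm, Ex.eval, Ex.labels] at h₁ ⊢
    simp only [tensorIso_hom, Iso.trans_hom, Category.assoc]
    have e₁ : ((((a.norm X).hom ⊗ₘ (c.norm X).hom) ≫ (appIso X _ _).hom) ⊗ₘ (d.norm X).hom) =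
        (((a.norm X).hom ⊗ₘ (c.norm X).hom) ⊗ₘ (d.norm X).hom) ≫ (appIso X _ _).hom ▷ _ := by
      simp only [← tensorHom_id, tensorHom_comp_tensorHom, Category.comp_id]
    have e₂ : ((a.norm X).hom ⊗ₘ (((c.norm X).hom ⊗ₘ (d.norm X).hom) ≫ (appIso X _ _).hom)) =
        ((a.norm X).hom ⊗ₘ ((c.norm X).hom ⊗ₘ (d.norm X).hom)) ≫ _ ◁ (appIso X _ _).hom := by
      simp only [← id_tensorHom, tensorHom_comp_tensorHom, Category.comp_id]
    have h₄ := congrArg (fun f => (α_ _ _ _).inv ≫ f ≫ q.eval t X) h₁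
    simp only [Category.assoc, h₂, Category.comp_id, Iso.inv_hom_id_assoc] at h₄
    rw [e₁, e₂, Category.assoc, Category.assoc, ← h₄, associator_inv_naturality_assoc]
  | lu a => exact ⟨.refl _, by dsimp [FH.eval, Pth.eval, Ex.norm, Ex.eval, Ex.labels, appIso, listTensor]; simp⟩
  | luInv a => exact ⟨.refl _, by dsimp [FH.eval, Pth.eval, Ex.norm, Ex.eval, Ex.labels, appIso, listTensor]; simp⟩
  | ru a =>
    obtain ⟨p, q, h₁, h₂⟩ := Pth.app_nil t X a.labels
    refine ⟨p, ?_⟩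
    dsimp [FH.eval, Ex.norm, Ex.eval, Ex.labels, listTensor] at h₁ ⊢
    simp [h₁]
  | ruInv a =>
    obtain ⟨p, q, h₁, h₂⟩ := Pth.app_nil t X a.labels
    refine ⟨q, ?_⟩
    dsimp only [Ex.labels]
    rw [← h₂]
    dsimp [FH.eval, Ex.norm]
    simp
  | braid a c =>
    obtain ⟨p, h⟩ := Pth.braid t X a.labels c.labels
    refine ⟨p, ?_⟩
    dsimp [FH.eval, Ex.norm, Ex.eval, Ex.labels] at h ⊢
    rw [Category.assoc, h]
    simp
  | bnil s => exact ⟨.refl _, by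
      dsimp [FH.eval, Pth.eval, Ex.norm, bigIso]; exact rfl⟩
  | bnilInv s => exact ⟨.refl _, by
      dsimp [FH.eval, Pth.eval, Ex.norm, bigIso]⟩
  | bcons k l s => exact ⟨.refl _, by
      dsimp [FH.eval, Pth.eval, Ex.norm, Ex.eval, Ex.labels, bigIso, listTensor]; simp⟩
  | bconsInv k l s => exact ⟨.refl _, by
      dsimp [FH.eval, Pth.eval, Ex.norm, Ex.eval, Ex.labels, bigIso, listTensor]; simp⟩
  | drop h e =>
    obtain ⟨p⟩ := Pth.drops h e.labels
    exact ⟨p, (t h).hom_ext _ _⟩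

/-- The coherence theorem: structure morphisms are determined by their source and target. -/
lemma FH.eval_eq (t : b = true → IsTerminal (𝟙_ V)) (X : J → V) {e e' : Ex J} (f g : FH b e e')
    (h : e.labels.Nodup) : f.eval t X = g.eval t X := by
  obtain ⟨p, hp⟩ := f.pth t X
  obtain ⟨q, hq⟩ := g.pth t X
  rw [← cancel_mono (e'.norm X).hom, hp, hq, p.eval_eq t X q h]

lemma FH.big_append (l m : List J) :
    Nonempty (FH b (.tens (.big l .leaf) (.big m .leaf)) (.big (l ++ m) .leaf)) ∧
      Nonempty (FH b (.big (l ++ m) .leaf) (.tens (.big l .leaf) (.big m .leaf))) := by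
  induction l with
  | nil => exact ⟨⟨.comp (.tens (.bnil _) (.id _)) (.lu _)⟩,
      ⟨.comp (.luInv _) (.tens (.bnilInv _) (.id _))⟩⟩
  | cons a l ih =>
    obtain ⟨⟨f⟩, ⟨g⟩⟩ := ih
    exact ⟨⟨.comp (.tens (.bcons _ _ _) (.id _)) (.comp (.assoc _ _ _)
      (.comp (.tens (.id _) f) (.bconsInv _ _ _)))⟩,
      ⟨.comp (.bcons _ _ _) (.comp (.tens (.id _) g) (.comp (.assocInv _ _ _)
        (.tens (.bconsInv _ _ _) (.id _))))⟩⟩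

lemma FH.flat (e : Ex J) : Nonempty (FH b e (.big e.labels .leaf)) ∧
    Nonempty (FH b (.big e.labels .leaf) e) := by
  induction e with
  | leaf j => exact ⟨⟨.comp (.ruInv _) (.comp (.tens (.id _) (.bnilInv _)) (.bconsInv _ _ _))⟩,
      ⟨.comp (.bcons _ _ _) (.comp (.tens (.id _) (.bnil _)) (.ru _))⟩⟩
  | one => exact ⟨⟨.bnilInv _⟩, ⟨.bnil _⟩⟩
  | tens a c iha ihc =>
    obtain ⟨⟨f⟩, ⟨f'⟩⟩ := iha
    obtain ⟨⟨g⟩, ⟨g'⟩⟩ := ihc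
    obtain ⟨⟨r⟩, ⟨r'⟩⟩ := FH.big_append (b := b) a.labels c.labels
    exact ⟨⟨.comp (.tens f g) r⟩, ⟨.comp r' (.tens f' g')⟩⟩
  | big l s ih =>
    induction l with
    | nil => exact ⟨⟨.comp (.bnil _) (.bnilInv _)⟩, ⟨.comp (.bnil _) (.bnilInv _)⟩⟩
    | cons k l ihl =>
      obtain ⟨⟨f⟩, ⟨f'⟩⟩ := ih k
      obtain ⟨⟨g⟩, ⟨g'⟩⟩ := ihl
      obtain ⟨⟨r⟩, ⟨r'⟩⟩ := FH.big_append (b := b) (s k).labels (Ex.big l s).labels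
      exact ⟨⟨.comp (.bcons _ _ _) (.comp (.tens f g) r)⟩,
        ⟨.comp r' (.comp (.tens f' g') (.bconsInv _ _ _))⟩⟩

lemma FH.perm {l m : List J} (h : l.Perm m) : Nonempty (FH b (.big l .leaf) (.big m .leaf)) := by
  induction h with
  | nil => exact ⟨.id _⟩
  | cons a h ih =>
    exact ih.map fun f => .comp (.bcons _ _ _) (.comp (.tens (.id _) f) (.bconsInv _ _ _))
  | swap a c l =>
    exact ⟨.comp (.comp (.bcons _ _ _) (.tens (.id _) (.bcons _ _ _))) (.comp (.assocInv _ _ _)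
      (.comp (.tens (.braid _ _) (.id _)) (.comp (.assoc _ _ _)
        (.comp (.tens (.id _) (.bconsInv _ _ _)) (.bconsInv _ _ _)))))⟩
  | trans h h' ih ih' => exact ih.elim fun f => ih'.map fun g => .comp f g

lemma FH.sublist (h : b = true) {l m : List J} (h : l.Sublist m) :
    Nonempty (FH b (.big m .leaf) (.big l .leaf)) := by
  induction h with
  | slnil => exact ⟨.id _⟩
  | cons a _ ih =>
    exact ih.map fun f => .comp (.bcons _ _ _) (.comp (.tens (.drop ‹_› _) f) (.lu _))
  | cons_cons a _ ih =>
    exact ih.map fun f => .comp (.bcons _ _ _) (.comp (.tens (.id _) f) (.bconsInv _ _ _))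

/-- There is a formal structure morphism from `e` to `e'`, and the leaves of `e` are distinct. -/
def Ok (b : Bool) (e e' : Ex J) : Prop := e.labels.Nodup ∧ Nonempty (FH b e e')

lemma Ok.mk {e e' : Ex J} (h : e.labels.Nodup) (h' : e'.labels.Nodup)
    (hs : ∀ j ∈ e'.labels, j ∈ e.labels) (hb : b = false → ∀ j ∈ e.labels, j ∈ e'.labels) :
    Ok b e e' := by
  refine ⟨h, ?_⟩
  obtain ⟨⟨f⟩, -⟩ := FH.flat (b := b) e
  obtain ⟨-, ⟨g⟩⟩ := FH.flat (b := b) e'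
  suffices Nonempty (FH b (.big e.labels .leaf) (.big e'.labels .leaf)) from
    this.map fun q => .comp f (.comp q g)
  cases b with
  | true =>
    obtain ⟨l, hl, hl'⟩ := List.subperm_of_subset h' hs
    obtain ⟨p⟩ := FH.sublist (b := true) rfl hl'
    obtain ⟨q⟩ := FH.perm (b := true) hl
    exact ⟨.comp p q⟩
  | false =>
    exact FH.perm ((List.perm_ext_iff_of_nodup h h').2 fun j => ⟨hb rfl j, hs j⟩)

lemma FH.subperm {e e' : Ex J} (f : FH b e e') : e'.labels.Subperm e.labels := by
  induction f with
  | id => exact List.Subperm.refl _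
  | comp f g ihf ihg => exact ihg.trans ihf
  | tens f g ihf ihg => exact ihf.append ihg
  | braid a c => exact (List.perm_append_comm).subperm
  | drop h e => exact List.nil_subperm
  | _ => simp [Ex.labels, List.Subperm.refl]

lemma Ok.nodup' {e e' : Ex J} (h : Ok b e e') : e'.labels.Nodup := by
  obtain ⟨h, ⟨f⟩⟩ := h
  obtain ⟨l, hl, hl'⟩ := f.subperm
  exact hl.nodup_iff.1 (h.sublist hl')

lemma Ok.refl {e : Ex J} (h : e.labels.Nodup) : Ok b e e := ⟨h, ⟨.id _⟩⟩

lemma Ok.trans {e e' e'' : Ex J} (h : Ok b e e') (h' : Ok b e' e'') : Ok b e e'' :=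
  ⟨h.1, h.2.elim fun f => h'.2.map fun g => .comp f g⟩

variable (t : b = true → IsTerminal (𝟙_ V)) (X : J → V)

/-- The coherence morphism between two tensor expressions: the unique composite of
associators, unitors and symmetries (and, if `b = true`, projections). -/
def can {e e' : Ex J} (h : Ok b e e') : e.eval X ⟶ e'.eval X := h.2.some.eval t X

lemma FH.eval_eq_can {e e' : Ex J} (f : FH b e e') (h : Ok b e e') :
    f.eval t X = can t X h := f.eval_eq t X _ h.1

lemma can_refl {e : Ex J} (h : Ok b e e) : can t X h = 𝟙 _ :=
  ((FH.id e).eval_eq_can t X h).symm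

lemma can_comp {e e' e'' : Ex J} (h : Ok b e e') (h' : Ok b e' e'') :
    can t X h ≫ can t X h' = can t X (h.trans h') :=
  (FH.comp h.2.some h'.2.some).eval_eq_can t X _

lemma can_comp_assoc {e e' e'' : Ex J} (h : Ok b e e') (h' : Ok b e' e'') {Z : V}
    (f : e''.eval X ⟶ Z) :
    can t X h ≫ can t X h' ≫ f = can t X (h.trans h') ≫ f := by
  rw [← can_comp t X h h', Category.assoc]

lemma can_tens {a a' c c' : Ex J} (h : Ok b a a') (h' : Ok b c c')
    (h₂ : Ok b (.tens a c) (.tens a' c')) :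
    can t X h ⊗ₘ can t X h' = can t X h₂ :=
  (FH.tens h.2.some h'.2.some).eval_eq_can t X _

lemma FH.exists_big {K : Type} {s s' : K → Ex J} (f : ∀ k, FH b (s k) (s' k)) (l : List K) :
    ∃ g : FH b (.big l s) (.big l s'), g.eval t X = listTensorMap (fun k => (f k).eval t X) l := by
  induction l with
  | nil => exact ⟨.comp (.bnil _) (.bnilInv _), by
      dsimp only [FH.eval, listTensorMap]; exact Category.comp_id _⟩
  | cons k l ih =>
    obtain ⟨g, hg⟩ := ih
    refine ⟨.comp (.bcons _ _ _) (.comp (.tens (f k) g) (.bconsInv _ _ _)), ?_⟩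
    dsimp only [FH.eval, listTensorMap]
    rw [hg]
    exact (Category.id_comp _).trans (Category.comp_id _)

lemma Ok.big {K : Type} {s s' : K → Ex J} (l : List K) (h : ∀ k, Ok b (s k) (s' k))
    (hn : (Ex.big l s).labels.Nodup) : Ok b (.big l s) (.big l s') :=
  ⟨hn, by
    clear hn
    induction l with
    | nil => exact ⟨.comp (.bnil _) (.bnilInv _)⟩
    | cons k l ih =>
      exact ih.map fun g => .comp (.bcons _ _ _) (.comp (.tens (h k).2.some g) (.bconsInv _ _ _))⟩

lemma can_big {K : Type} {s s' : K → Ex J} (l : List K) (h : ∀ k, Ok b (s k) (s' k))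
    (h₂ : Ok b (.big l s) (.big l s')) :
    listTensorMap (fun k => can t X (h k)) l = can t X h₂ := by
  obtain ⟨g, hg⟩ := FH.exists_big t X (fun k => (h k).2.some) l
  rw [← g.eval_eq_can, hg]
  rfl

/-- The morphism between expressions induced by a substitution of expressions for leaves. -/
def Ex.bindMap {K : Type} {X : J → V} {Y : K → V} (s : K → Ex J)
    (f : ∀ k, (s k).eval X ⟶ Y k) : ∀ e : Ex K, (e.bind s).eval X ⟶ e.eval Y
  | .leaf k => f k
  | .one => 𝟙 _
  | .tens a c => a.bindMap s f ⊗ₘ c.bindMap s f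
  | .big l r => listTensorMap (fun i => (r i).bindMap s f) l

/-- Substitution in formal structure morphisms. -/
def FH.bind {K : Type} (s : K → Ex J) : ∀ {e e' : Ex K}, FH b e e' → FH b (e.bind s) (e'.bind s)
  | _, _, .id e => .id _
  | _, _, .comp f g => .comp (f.bind s) (g.bind s)
  | _, _, .tens f g => .tens (f.bind s) (g.bind s)
  | _, _, .assoc a c d => .assoc _ _ _
  | _, _, .assocInv a c d => .assocInv _ _ _
  | _, _, .lu a => .lu _
  | _, _, .luInv a => .luInv _
  | _, _, .ru a => .ru _
  | _, _, .ruInv a => .ruInv _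
  | _, _, .braid a c => .braid _ _
  | _, _, .bnil _ => .bnil _
  | _, _, .bnilInv _ => .bnilInv _
  | _, _, .bcons k l r => .bcons k l fun i => (r i).bind s
  | _, _, .bconsInv k l r => .bconsInv k l fun i => (r i).bind s
  | _, _, .drop h e => .drop h _

lemma FH.bind_eval {K : Type} {X : J → V} {Y : K → V} (s : K → Ex J)
    (f : ∀ k, (s k).eval X ⟶ Y k) {e e' : Ex K} (p : FH b e e') :
    e.bindMap s f ≫ p.eval t Y = (p.bind s).eval t X ≫ e'.bindMap s f := by
  induction p with
  | id e => simp [FH.eval, FH.bind]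
  | comp p p' h h' => simp [FH.eval, FH.bind, reassoc_of% h, h']
  | tens p p' h h' =>
    simp only [FH.eval, FH.bind, Ex.bindMap]
    erw [tensorHom_comp_tensorHom, tensorHom_comp_tensorHom]
    rw [h, h']
  | assoc a c d => exact associator_naturality _ _ _
  | assocInv a c d => exact associator_inv_naturality _ _ _
  | lu a => 
    dsimp only [FH.eval, FH.bind, Ex.bindMap]
    rw [id_tensorHom]; exact leftUnitor_naturality _
  | luInv a =>
    dsimp only [FH.eval, FH.bind, Ex.bindMap]
    rw [id_tensorHom]; exact leftUnitor_inv_naturality _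
  | ru a =>
    dsimp only [FH.eval, FH.bind, Ex.bindMap]
    rw [tensorHom_id]; exact rightUnitor_naturality _
  | ruInv a =>
    dsimp only [FH.eval, FH.bind, Ex.bindMap]
    rw [tensorHom_id]; exact rightUnitor_inv_naturality _
  | braid a c => exact BraidedCategory.braiding_naturality _ _
  | bnil r => rfl
  | bnilInv r => rfl
  | bcons k l r => exact (Category.comp_id _).trans (Category.id_comp _).symm
  | bconsInv k l r => exact (Category.comp_id _).trans (Category.id_comp _).symm
  | drop h e => exact (t h).hom_ext _ _

lemma Ok.bind {K : Type} (s : K → Ex J) {e e' : Ex K} (h : Ok b e e')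
    (hn : (e.bind s).labels.Nodup) : Ok b (e.bind s) (e'.bind s) :=
  ⟨hn, h.2.map fun p => p.bind s⟩

lemma can_bind {K : Type} {X : J → V} {Y : K → V} (s : K → Ex J)
    (f : ∀ k, (s k).eval X ⟶ Y k) {e e' : Ex K} (h : Ok b e e')
    (h' : Ok b (e.bind s) (e'.bind s)) :
    e.bindMap s f ≫ can t Y h = can t X h' ≫ e'.bindMap s f := by
  rw [← (h.2.some.bind s).eval_eq_can]
  exact FH.bind_eval t s f _


lemma Ex.eval_bind {K : Type} (s : K → Ex J) (e : Ex K) :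
    (e.bind s).eval X = e.eval fun k => (s k).eval X := by
  induction e with
  | leaf k => rfl
  | one => rfl
  | tens a c iha ihc => exact congrArg₂ _ iha ihc
  | big l r ih => exact congrArg (fun Y => listTensor Y l) (funext ih)

lemma listTensorMap_eqToHom {K : Type} {Y Z : K → V} (h : ∀ k, Y k = Z k) (l : List K) :
    listTensorMap (fun k => eqToHom (h k)) l =
      eqToHom (congrArg (fun Y => listTensor Y l) (funext h)) := by
  obtain rfl : Y = Z := funext h
  exact listTensorMap_id l

lemma tensorHom_eqToHom {A A' B B' : V} (h : A = A') (h' : B = B') :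
    eqToHom h ⊗ₘ eqToHom h' = eqToHom (congrArg₂ (fun A B => A ⊗ B) h h') := by
  subst h h'
  simp

lemma Ex.bindMap_id {K : Type} (s : K → Ex J) (e : Ex K) :
    e.bindMap s (fun k => 𝟙 ((s k).eval X)) = eqToHom (e.eval_bind X s) := by
  induction e with
  | leaf k => rfl
  | one => rfl
  | tens a c iha ihc =>
    rw [Ex.bindMap, iha, ihc]
    exact tensorHom_eqToHom _ _
  | big l r ih =>
    rw [Ex.bindMap, funext ih]
    exact listTensorMap_eqToHom _ _

variable {X} in
lemma can_heq {X' : J → V} (hX : ∀ j, X j = X' j) {e e' : Ex J} (h : Ok b e e') :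
    HEq (can t X h) (can t X' h) := by
  obtain rfl : X = X' := funext hX
  rfl

variable {X} in
/-- The morphism `f` is the value of a formal structure morphism. -/
def Str (e e' : Ex J) (f : e.eval X ⟶ e'.eval X) : Prop := ∃ p : FH b e e', p.eval t X = f

section

variable {t X} {e e' e'' c c' : Ex J}

lemma Str.eq {f g : e.eval X ⟶ e'.eval X} (h : e.labels.Nodup) (hf : Str t e e' f)
    (hg : Str t e e' g) : f = g := by
  obtain ⟨p, rfl⟩ := hf
  obtain ⟨q, rfl⟩ := hg
  exact p.eval_eq t X q h

lemma Str.id : Str t e e (𝟙 (e.eval X)) := ⟨.id e, rfl⟩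

lemma Str.comp {f : e.eval X ⟶ e'.eval X} {g : e'.eval X ⟶ e''.eval X} (hf : Str t e e' f)
    (hg : Str t e' e'' g) : Str t e e'' (f ≫ g) := by
  obtain ⟨p, rfl⟩ := hf
  obtain ⟨q, rfl⟩ := hg
  exact ⟨.comp p q, rfl⟩

lemma Str.tens {f : e.eval X ⟶ e'.eval X} {g : c.eval X ⟶ c'.eval X} (hf : Str t e e' f)
    (hg : Str t c c' g) : Str t (.tens e c) (.tens e' c') (f ⊗ₘ g) := by
  obtain ⟨p, rfl⟩ := hf
  obtain ⟨q, rfl⟩ := hg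
  exact ⟨.tens p q, rfl⟩

lemma Str.whiskerLeft {g : c.eval X ⟶ c'.eval X} (hg : Str t c c' g) :
    Str t (.tens e c) (.tens e c') (e.eval X ◁ g) := by
  rw [← id_tensorHom]
  exact Str.id.tens hg

lemma Str.whiskerRight {f : e.eval X ⟶ e'.eval X} (hf : Str t e e' f) :
    Str t (.tens e c) (.tens e' c) (f ▷ c.eval X) := by
  rw [← tensorHom_id]
  exact hf.tens Str.id

lemma Str.big {K : Type} {s s' : K → Ex J} {f : ∀ k, (s k).eval X ⟶ (s' k).eval X}
    (hf : ∀ k, Str t (s k) (s' k) (f k)) (l : List K) :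
    Str t (.big l s) (.big l s') (listTensorMap f l) := by
  choose p hp using hf
  obtain ⟨g, hg⟩ := FH.exists_big t X p l
  exact ⟨g, hg.trans (congrArg (fun f => listTensorMap f l) (funext hp))⟩

lemma Str.assoc : Str t (.tens (.tens e e') e'') (.tens e (.tens e' e''))
    (α_ (e.eval X) (e'.eval X) (e''.eval X)).hom := ⟨.assoc _ _ _, rfl⟩

lemma Str.assocInv : Str t (.tens e (.tens e' e'')) (.tens (.tens e e') e'')
    (α_ (e.eval X) (e'.eval X) (e''.eval X)).inv := ⟨.assocInv _ _ _, rfl⟩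

lemma Str.lu : Str t (.tens .one e) e (λ_ (e.eval X)).hom := ⟨.lu _, rfl⟩

lemma Str.luInv : Str t e (.tens .one e) (λ_ (e.eval X)).inv := ⟨.luInv _, rfl⟩

lemma Str.ru : Str t (.tens e .one) e (ρ_ (e.eval X)).hom := ⟨.ru _, rfl⟩

lemma Str.ruInv : Str t e (.tens e .one) (ρ_ (e.eval X)).inv := ⟨.ruInv _, rfl⟩

/-- Coherence morphisms in which the leaves are replaced by expressions. -/
lemma Str.bind {K : Type} (s : K → Ex J) {e e' : Ex K} (h : Ok b e e')
    (f : (e.bind s).eval X ⟶ (e'.bind s).eval X)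
    (hf : HEq f (can t (fun k => (s k).eval X) h)) : Str t (e.bind s) (e'.bind s) f := by
  refine ⟨h.2.some.bind s, ?_⟩
  have h₁ := FH.bind_eval t s (fun k => 𝟙 ((s k).eval X)) h.2.some
  rw [Ex.bindMap_id, Ex.bindMap_id] at h₁
  have h₂ : HEq ((h.2.some.bind s).eval t X) (can t (fun k => (s k).eval X) h) := by
    refine HEq.trans ?_ (eqToHom_comp_heq (can t (fun k => (s k).eval X) h) (e.eval_bind X s))
    exact HEq.trans (comp_eqToHom_heq _ (e'.eval_bind X s)).symm (heq_of_eq h₁.symm)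
  exact eq_of_heq (h₂.trans hf.symm)

end

end Coherence

/-! ### Finite index sets -/

section Enum

/-- An enumeration of a finite type. -/
def enum (K : Type) [Finite K] : List K := (@Finset.univ K (Fintype.ofFinite K)).toList

variable {K : Type} [Finite K]

@[simp] lemma mem_enum (k : K) : k ∈ enum K := by simp [enum]

@[simp] lemma nodup_enum : (enum K).Nodup := Finset.nodup_toList _

lemma nodup_flatMap_enum {J : Type} (f : K → List J) : ((enum K).flatMap f).Nodup ↔
    (∀ k, (f k).Nodup) ∧ ∀ k k' j, j ∈ f k → j ∈ f k' → k = k' := by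
  rw [List.nodup_flatMap]
  refine and_congr (by simp) ⟨fun h k k' j hj hj' => ?_, fun h => ?_⟩
  · by_contra hk
    have : Std.Symm (Function.onFun List.Disjoint f) := ⟨fun _ _ h => List.Disjoint.symm h⟩
    exact h.forall (mem_enum k) (mem_enum k') hk hj hj'
  · exact nodup_enum.pairwise_of_forall_ne fun k _ k' _ hk j hj hj' => hk (h k k' j hj hj')

lemma mem_flatMap_enum {J : Type} (f : K → List J) (j : J) :
    j ∈ (enum K).flatMap f ↔ ∃ k, j ∈ f k := by simp

variable {V : Type u} [Category.{v} V] [MonoidalCategory V]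

/-- The tensor product of a family indexed by a finite type. -/
abbrev tAll (Y : K → V) : V := listTensor Y (enum K)

/-- The tensor product of a family of morphisms indexed by a finite type. -/
abbrev tMap {Y Z : K → V} (f : ∀ k, Y k ⟶ Z k) : tAll Y ⟶ tAll Z := listTensorMap f (enum K)

/-- The formal tensor product of a family indexed by a finite type. -/
abbrev Ex.all {J : Type} (s : K → Ex J) : Ex J := .big (enum K) s

lemma tMap_id (Y : K → V) : tMap (fun k => 𝟙 (Y k)) = 𝟙 _ := listTensorMap_id _

lemma tMap_comp {Y Z W : K → V} (f : ∀ k, Y k ⟶ Z k) (g : ∀ k, Z k ⟶ W k) :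
    tMap f ≫ tMap g = tMap fun k => f k ≫ g k := listTensorMap_comp _ _ _

variable [SymmetricCategory V]

/-- No factor may be discarded. -/
def noDrop : false = true → IsTerminal (𝟙_ V) := fun h => Bool.noConfusion h

/-- A morphism that discards nothing may be viewed as one where discarding is allowed. -/
def FH.lift (b : Bool) {J : Type} : ∀ {e e' : Ex J}, FH false e e' → FH b e e'
  | _, _, .id e => .id _
  | _, _, .comp f g => .comp (f.lift b) (g.lift b)
  | _, _, .tens f g => .tens (f.lift b) (g.lift b)
  | _, _, .assoc a c d => .assoc _ _ _
  | _, _, .assocInv a c d => .assocInv _ _ _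
  | _, _, .lu a => .lu _
  | _, _, .luInv a => .luInv _
  | _, _, .ru a => .ru _
  | _, _, .ruInv a => .ruInv _
  | _, _, .braid a c => .braid _ _
  | _, _, .bnil _ => .bnil _
  | _, _, .bnilInv _ => .bnilInv _
  | _, _, .bcons k l r => .bcons _ _ _
  | _, _, .bconsInv k l r => .bconsInv _ _ _
  | _, _, .drop h e => Bool.noConfusion h

lemma FH.lift_eval {b : Bool} (t : b = true → IsTerminal (𝟙_ V)) {J : Type} (X : J → V)
    {e e' : Ex J} (f : FH false e e') : (f.lift b).eval t X = f.eval noDrop X := by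
  induction f with
  | comp f g ihf ihg => simp [FH.lift, FH.eval, ihf, ihg]
  | tens f g ihf ihg => simp [FH.lift, FH.eval, ihf, ihg]
  | drop h e => exact Bool.noConfusion h
  | _ => rfl

lemma Ok.lift {b : Bool} {J : Type} {e e' : Ex J} (h : Ok false e e') : Ok b e e' :=
  ⟨h.1, h.2.map fun f => f.lift b⟩

lemma can_lift {b : Bool} (t : b = true → IsTerminal (𝟙_ V)) {J : Type} (X : J → V)
    {e e' : Ex J} (h : Ok false e e') : can noDrop X h = can t X (h.lift (b := b)) := by
  rw [← FH.eval_eq_can t X (h.2.some.lift b), FH.lift_eval]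
  rfl

/-- As `Str.bind`, for coherence morphisms that discard nothing. -/
lemma Str.bind' {b : Bool} {t : b = true → IsTerminal (𝟙_ V)} {J K : Type} {X : J → V}
    (s : K → Ex J) {e e' : Ex K} (h : Ok false e e')
    (f : (e.bind s).eval X ⟶ (e'.bind s).eval X)
    (hf : HEq f (can noDrop (fun k => (s k).eval X) h)) : Str t (e.bind s) (e'.bind s) f :=
  Str.bind s (h.lift (b := b)) f (hf.trans (heq_of_eq (can_lift t _ h)))

lemma Str.map {b : Bool} {t : b = true → IsTerminal (𝟙_ V)} {J K : Type} [Finite K] {X : J → V}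
    {s s' : K → Ex J} {f : ∀ k, (s k).eval X ⟶ (s' k).eval X}
    (hf : ∀ k, Str t (s k) (s' k) (f k)) : Str t (.all s) (.all s') (tMap f) := .big hf _

end Enum

/-! ### The categories `Σ` and `Λ`, and sequences -/

section Sequences

/-- For `b = true` the category `Λ` of the based finite sets `{0, 1, …, n}` and based injections,
for `b = false` its subcategory `Σ` of isomorphisms. A based injection `{0, …, m} → {0, …, n}`
is the same as an injection of the sets of non-base points. -/
structure Inj (b : Bool) : Type where
  /-- the number of non-base points -/
  n : ℕ

variable {b : Bool}

/-- Injections, which have to be bijections if `b = false`. -/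
def IsInj (b : Bool) {S T : Type} (f : S → T) : Prop :=
  Function.Injective f ∧ (b = false → Function.Surjective f)

lemma IsInj.id (b : Bool) (S : Type) : IsInj b (id : S → S) :=
  ⟨Function.injective_id, fun _ => Function.surjective_id⟩

lemma IsInj.comp {S T U : Type} {g : T → U} {f : S → T} (hg : IsInj b g) (hf : IsInj b f) :
    IsInj b (g ∘ f) := ⟨hg.1.comp hf.1, fun h => (hg.2 h).comp (hf.2 h)⟩

lemma IsInj.equiv {S T : Type} (e : S ≃ T) : IsInj b e := ⟨e.injective, fun _ => e.surjective⟩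

instance : Category (Inj b) where
  Hom m n := {f : Fin m.n → Fin n.n // IsInj b f}
  id m := ⟨_root_.id, IsInj.id b _⟩
  comp f g := ⟨g.1 ∘ f.1, g.2.comp f.2⟩

variable (b) in
/-- The number of elements of a finite type as an object. -/
def Inj.card (S : Type) : Inj b := ⟨Nat.card S⟩

/-- The morphism given by an injection of finite types. -/
def Inj.ofMap {S T : Type} [Finite S] [Finite T] (f : S → T) (hf : IsInj b f) :
    Inj.card b S ⟶ Inj.card b T :=
  ⟨Finite.equivFin T ∘ f ∘ (Finite.equivFin S).symm,
    (IsInj.equiv _).comp (hf.comp (IsInj.equiv _))⟩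

/-- The morphism given by an enumeration of `Fin n`. -/
def Inj.ofFin (m : Inj b) : m ⟶ Inj.card b (Fin m.n) := ⟨Finite.equivFin (Fin m.n), IsInj.equiv _⟩

/-- The inverse of `Inj.ofFin`. -/
def Inj.toFin (m : Inj b) : Inj.card b (Fin m.n) ⟶ m :=
  ⟨(Finite.equivFin (Fin m.n)).symm, IsInj.equiv _⟩

variable {V : Type u} [Category.{v} V]

/-- The value of a sequence on a finite type. -/
abbrev ev (E : (Inj b)ᵒᵖ ⥤ V) (S : Type) : V := E.obj (op (Inj.card b S))

/-- Sequences are contravariant for injections (bijections) of finite types. -/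
def res (E : (Inj b)ᵒᵖ ⥤ V) {S T : Type} [Finite S] [Finite T] (f : S → T) (hf : IsInj b f) :
    ev E T ⟶ ev E S := E.map (Inj.ofMap f hf).op

lemma res_id (E : (Inj b)ᵒᵖ ⥤ V) {S : Type} [Finite S] (f : S → S) (hf : IsInj b f)
    (h : ∀ s, f s = s) : res E f hf = 𝟙 _ := by
  rw [res, show Inj.ofMap f hf = 𝟙 _ from ?_, op_id, E.map_id]
  refine Subtype.ext (funext fun x => ?_)
  change Finite.equivFin S (f ((Finite.equivFin S).symm x)) = x
  rw [h]
  exact Equiv.apply_symm_apply _ _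

lemma res_comp (E : (Inj b)ᵒᵖ ⥤ V) {S T U : Type} [Finite S] [Finite T] [Finite U]
    (f : S → T) (hf : IsInj b f) (g : T → U) (hg : IsInj b g) :
    res E g hg ≫ res E f hf = res E (g ∘ f) (hg.comp hf) := by
  rw [res, res, ← E.map_comp, ← op_comp, res]
  congr 2
  refine Subtype.ext (funext fun x => ?_)
  change Finite.equivFin U (g ((Finite.equivFin T).symm (Finite.equivFin T (f _)))) = _
  rw [Equiv.symm_apply_apply]
  rfl

/-- The action of a bijection. -/
def tr (E : (Inj b)ᵒᵖ ⥤ V) {S T : Type} [Finite S] [Finite T] (e : S ≃ T) : ev E S ⟶ ev E T :=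
  res E e.symm (IsInj.equiv _)

lemma tr_comp (E : (Inj b)ᵒᵖ ⥤ V) {S T U : Type} [Finite S] [Finite T] [Finite U]
    (e : S ≃ T) (e' : T ≃ U) : tr E e ≫ tr E e' = tr E (e.trans e') := res_comp ..

lemma tr_comp_assoc (E : (Inj b)ᵒᵖ ⥤ V) {S T U : Type} [Finite S] [Finite T] [Finite U]
    (e : S ≃ T) (e' : T ≃ U) {Z : V} (h : ev E U ⟶ Z) :
    tr E e ≫ tr E e' ≫ h = tr E (e.trans e') ≫ h := by rw [← tr_comp, Category.assoc]

lemma tr_refl (E : (Inj b)ᵒᵖ ⥤ V) {S : Type} [Finite S] (e : S ≃ S) (h : ∀ s, e s = s) :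
    tr E e = 𝟙 _ := res_id _ _ _ fun s => by rw [Equiv.symm_apply_eq, h]

end Sequences

/-! ### Operads -/

section Operads

variable {V : Type u} [Category.{v} V] [MonoidalCategory V] [SymmetricCategory V]

lemma reindex_ok {T T' : Type} [Finite T] [Finite T'] (e : T ≃ T') :
    Ok false (.all fun t => .leaf (e t)) (.all fun t => .leaf t) := by
  refine .mk ?_ ?_ ?_ ?_ <;> simp [nodup_flatMap_enum]
  exact fun j => ⟨e.symm j, by simp⟩

/-- The canonical isomorphism `⨂_t Y (e t) ≅ ⨂_{t'} Y t'` for a bijection `e`. -/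
def reindex {T T' : Type} [Finite T] [Finite T'] (e : T ≃ T') (Y : T' → V) :
    tAll (fun t => Y (e t)) ⟶ tAll Y :=
  can noDrop Y (reindex_ok e)

lemma regroup_ok {T : Type} [Finite T] (S : T → Type) [∀ t, Finite (S t)] :
    Ok false (J := Unit ⊕ T ⊕ (Σ t, S t))
      (.tens (.leaf (.inl ())) (.all fun t => .tens (.leaf (.inr (.inl t)))
        (.all fun s => .leaf (.inr (.inr ⟨t, s⟩)))))
      (.tens (.tens (.leaf (.inl ())) (.all fun t => .leaf (.inr (.inl t))))
        (.all fun p => .leaf (.inr (.inr p)))) := by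
  refine .mk ?_ ?_ ?_ ?_ <;> simp [nodup_flatMap_enum, List.nodup_append]
  all_goals aesop

/-- The canonical isomorphism
`A ⊗ ⨂_t (B t ⊗ ⨂_s D (t, s)) ≅ (A ⊗ ⨂_t B t) ⊗ ⨂_{(t, s)} D (t, s)`. -/
def regroup {T : Type} [Finite T] (S : T → Type) [∀ t, Finite (S t)] (A : V) (B : T → V)
    (D : (Σ t, S t) → V) :
    A ⊗ tAll (fun t => B t ⊗ tAll fun s => D ⟨t, s⟩) ⟶ (A ⊗ tAll B) ⊗ tAll D :=
  can noDrop (Sum.elim (fun _ => A) (Sum.elim B D)) (regroup_ok S)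

lemma unitRight_ok (T : Type) [Finite T] :
    Ok false (.tens (.leaf ()) (.all fun _ : T => .one)) (.leaf ()) := by
  refine .mk ?_ ?_ ?_ ?_ <;> simp [Ex.labels, nodup_flatMap_enum]

/-- The canonical isomorphism `A ⊗ ⨂_{t : T} 𝟙 ≅ A`. -/
def unitRight (A : V) (T : Type) [Finite T] : A ⊗ tAll (fun _ : T => 𝟙_ V) ⟶ A :=
  can noDrop (fun _ : Unit => A) (unitRight_ok T)

lemma unitLeft_ok (T : Type) [Unique T] :
    Ok false (.tens .one (.all fun t : T => .leaf t)) (.leaf default) := by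
  refine .mk ?_ ?_ ?_ ?_ <;> simp
  exact fun j => Unique.eq_default j

/-- The canonical isomorphism `𝟙 ⊗ ⨂_{t : T} Y t ≅ Y t₀` for a type `T` with only one
element `t₀`. -/
def unitLeft {T : Type} [Unique T] (Y : T → V) : 𝟙_ V ⊗ tAll Y ⟶ Y default :=
  can noDrop Y (unitLeft_ok T)

/-- A pair of families of morphisms. -/
def sumHom {J K : Type} {X X' : J → V} {Y Y' : K → V} (f : ∀ j, X j ⟶ X' j)
    (g : ∀ k, Y k ⟶ Y' k) : ∀ j, Sum.elim X Y j ⟶ Sum.elim X' Y' j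
  | .inl j => f j
  | .inr k => g k

lemma reindex_natural {T T' : Type} [Finite T] [Finite T'] (e : T ≃ T') {Y Z : T' → V}
    (f : ∀ t, Y t ⟶ Z t) : tMap (fun t => f (e t)) ≫ reindex e Z = reindex e Y ≫ tMap f :=
  can_bind noDrop .leaf f (reindex_ok e) (reindex_ok e)

lemma regroup_natural {T : Type} [Finite T] (S : T → Type) [∀ t, Finite (S t)] {A A' : V}
    {B B' : T → V} {D D' : (Σ t, S t) → V} (f : A ⟶ A') (g : ∀ t, B t ⟶ B' t)
    (h : ∀ p, D p ⟶ D' p) :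
    (f ⊗ₘ tMap fun t => g t ⊗ₘ tMap fun s => h ⟨t, s⟩) ≫ regroup S A' B' D' =
      regroup S A B D ≫ ((f ⊗ₘ tMap g) ⊗ₘ tMap h) :=
  can_bind (X := Sum.elim (fun _ => A) (Sum.elim B D)) (Y := Sum.elim (fun _ => A')
    (Sum.elim B' D')) noDrop .leaf (sumHom (fun _ => f) (sumHom g h)) (regroup_ok S) (regroup_ok S)

lemma unitRight_natural {A B : V} (f : A ⟶ B) (T : Type) [Finite T] :
    (f ⊗ₘ 𝟙 _) ≫ unitRight B T = unitRight A T ≫ f := by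
  rw [← tMap_id]
  exact can_bind noDrop .leaf (fun _ => f) (unitRight_ok T) (unitRight_ok T)

lemma unitLeft_natural {T : Type} [Unique T] {Y Z : T → V} (f : ∀ t, Y t ⟶ Z t) :
    (𝟙 _ ⊗ₘ tMap f) ≫ unitLeft Z = unitLeft Y ≫ f default :=
  can_bind noDrop .leaf f (unitLeft_ok T) (unitLeft_ok T)

lemma unitRight_natural_assoc {A B Z : V} (f : A ⟶ B) (T : Type) [Finite T] (g : B ⟶ Z) :
    (f ⊗ₘ 𝟙 _) ≫ unitRight B T ≫ g = unitRight A T ≫ f ≫ g := by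
  rw [← Category.assoc, unitRight_natural, Category.assoc]

lemma unitLeft_natural_assoc {T : Type} [Unique T] {Y Z : T → V} (f : ∀ t, Y t ⟶ Z t) {W : V}
    (g : Z default ⟶ W) :
    (𝟙 _ ⊗ₘ tMap f) ≫ unitLeft Z ≫ g = unitLeft Y ≫ f default ≫ g := by
  rw [← Category.assoc, unitLeft_natural, Category.assoc]

lemma reindex_refl {T : Type} [Finite T] (Y : T → V) : reindex (Equiv.refl T) Y = 𝟙 _ :=
  can_refl noDrop Y (reindex_ok (Equiv.refl T))

instance {T T' : Type} [Finite T] [Finite T'] (e : T ≃ T') (Y : T' → V) :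
    IsIso (reindex e Y) := by
  have h : Ok false (.all fun t => .leaf t) (.all fun t => .leaf (e t)) := by
    refine .mk (reindex_ok e).nodup' (reindex_ok e).1 ?_ ?_ <;> simp
    exact fun j => ⟨e.symm j, by simp⟩
  refine ⟨can noDrop Y h, ?_, ?_⟩
  · exact (can_comp noDrop Y (reindex_ok e) h).trans (can_refl _ _ _)
  · exact (can_comp noDrop Y h (reindex_ok e)).trans (can_refl _ _ _)

lemma unitLeft_one {T : Type} [Unique T] :
    unitLeft (fun _ : T => 𝟙_ V) = unitRight (𝟙_ V) T := by
  have hn : (Ex.tens (J := Empty) .one (.all fun _ : T => .one)).labels.Nodup := by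
    simp [Ex.labels, nodup_flatMap_enum]
  have h₁ := can_bind noDrop (X := fun _ : Empty => 𝟙_ V) (fun _ => .one)
    (fun _ => 𝟙 (𝟙_ V)) (unitLeft_ok T) ((unitLeft_ok T).bind _ hn)
  have h₂ := can_bind noDrop (X := fun _ : Empty => 𝟙_ V) (fun _ => .one)
    (fun _ => 𝟙 (𝟙_ V)) (unitRight_ok T) ((unitRight_ok T).bind _ hn)
  have h₃ : (𝟙 (𝟙_ V) ⊗ₘ tMap fun _ : T => 𝟙 (𝟙_ V)) = 𝟙 _ := by rw [tMap_id]; simp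
  exact (((Category.id_comp _).symm.trans (congrArg (· ≫ _) h₃.symm)).trans (h₁.trans h₂.symm)).trans
    ((congrArg (· ≫ _) h₃).trans (Category.id_comp _))

lemma unitLeft_reindex {T T' : Type} [Unique T] [Unique T'] (Y : T' → V) :
    (𝟙 (𝟙_ V) ⊗ₘ reindex (Equiv.ofUnique T T') Y) ≫ unitLeft Y =
      unitLeft fun t => Y (Equiv.ofUnique T T' t) := by
  have hn : (Ex.all fun t : T => .leaf (Equiv.ofUnique T T' t)).labels.Nodup :=
    (reindex_ok (Equiv.ofUnique T T')).1
  have h₁ : Ok false (.tens .one (.all fun t : T => .leaf (Equiv.ofUnique T T' t)))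
      (.tens .one (.all fun t : T' => .leaf t)) :=
    ⟨hn, (reindex_ok (Equiv.ofUnique T T')).2.map fun f => .tens (.id _) f⟩
  have h₂ := can_bind noDrop (fun t => .leaf (Equiv.ofUnique T T' t))
    (fun t => 𝟙 (Y (Equiv.ofUnique T T' t))) (unitLeft_ok T) ((unitLeft_ok T).bind _ hn)
  have h₃ : 𝟙 (𝟙_ V) ⊗ₘ reindex (Equiv.ofUnique T T') Y = can noDrop Y h₁ := by
    have := can_tens noDrop Y (Ok.refl (e := .one) (by simp [Ex.labels]))
      (reindex_ok (Equiv.ofUnique T T')) h₁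
    rw [can_refl] at this
    exact this
  rw [h₃]
  refine (can_comp noDrop Y h₁ (unitLeft_ok T')).trans ?_
  refine ((Category.comp_id _).symm.trans h₂.symm).trans ?_
  refine (congrArg (fun f => (𝟙 (𝟙_ V) ⊗ₘ f) ≫ unitLeft _) (tMap_id _)).trans ?_
  simp

variable (V) in
/-- A (symmetric) operad in `V`, written in terms of finite sets: for a finite type `S` with `n`
elements, `ev seq S` is `seq n`, and the action of the symmetric groups is used to identify
`seq n` for different enumerations of `S`. -/
structure Operad where
  /-- the underlying symmetric sequence -/
  seq : (Inj false)ᵒᵖ ⥤ V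
  /-- the unit -/
  one : 𝟙_ V ⟶ ev seq Unit
  /-- the structure maps -/
  γ {T : Type} [Finite T] (S : T → Type) [∀ t, Finite (S t)] :
    ev seq T ⊗ tAll (fun t => ev seq (S t)) ⟶ ev seq (Σ t, S t)
  equivariance {T T' : Type} [Finite T] [Finite T'] (e : T ≃ T') (S : T → Type)
    [∀ t, Finite (S t)] (S' : T' → Type) [∀ t, Finite (S' t)] (f : ∀ t, S t ≃ S' (e t)) :
    (tr seq e ⊗ₘ (tMap (fun t => tr seq (f t)) ≫ reindex e fun t => ev seq (S' t))) ≫ γ S' =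
      γ S ≫ tr seq (Equiv.sigmaCongr e f)
  one_left (S : Unit → Type) [∀ t, Finite (S t)] :
    (one ⊗ₘ 𝟙 _) ≫ γ S ≫ tr seq (Equiv.uniqueSigma S) = unitLeft fun t => ev seq (S t)
  one_right (T : Type) [Finite T] :
    (𝟙 (ev seq T) ⊗ₘ tMap fun _ => one) ≫ γ (fun _ : T => Unit) ≫
      tr seq (Equiv.sigmaUnique T fun _ => Unit) = unitRight (ev seq T) T
  assoc {T : Type} [Finite T] (S : T → Type) [∀ t, Finite (S t)] (R : ∀ t, S t → Type)
    [∀ t s, Finite (R t s)] :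
    (𝟙 _ ⊗ₘ tMap fun t => γ (R t)) ≫ γ (fun t => Σ s, R t s) =
      regroup S (ev seq T) (fun t => ev seq (S t)) (fun p => ev seq (R p.1 p.2)) ≫
        (γ S ⊗ₘ 𝟙 _) ≫ γ (fun p : Σ t, S t => R p.1 p.2) ≫ tr seq (Equiv.sigmaAssoc R)

namespace Operad

variable (C : Operad V)

lemma equivariance_right {T : Type} [Finite T] (S S' : T → Type) [∀ t, Finite (S t)]
    [∀ t, Finite (S' t)] (f : ∀ t, S t ≃ S' t) :
    (𝟙 _ ⊗ₘ tMap fun t => tr C.seq (f t)) ≫ C.γ S' =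
      C.γ S ≫ tr C.seq (Equiv.sigmaCongr (Equiv.refl T) f) := by
  have h₀ := C.equivariance (Equiv.refl T) S S' f
  rw [tr_refl _ _ fun _ => rfl, reindex_refl] at h₀
  exact (congrArg (fun f => (𝟙 _ ⊗ₘ f) ≫ C.γ S') (Category.comp_id _).symm).trans h₀

lemma equivariance_left {T T' : Type} [Finite T] [Finite T'] (e : T ≃ T') (S : T' → Type)
    [∀ t, Finite (S t)] :
    (tr C.seq e ⊗ₘ reindex e fun t => ev C.seq (S t)) ≫ C.γ S =
      C.γ (fun t => S (e t)) ≫ tr C.seq (Equiv.sigmaCongr e fun t => Equiv.refl (S (e t))) := by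
  have h := C.equivariance e (fun t => S (e t)) S fun t => Equiv.refl _
  have h₁ : (tMap fun t => tr C.seq (Equiv.refl (S (e t)))) = 𝟙 _ := by
    rw [← tMap_id]
    congr 1
    funext u
    exact tr_refl _ _ fun _ => rfl
  rwa [h₁, Category.id_comp] at h

lemma assoc_tr {T T' U : Type} [Finite T] [Finite T'] [Finite U] (S S' : T → Type)
    [∀ t, Finite (S t)] [∀ t, Finite (S' t)] (R : T' → Type) [∀ t, Finite (R t)]
    (e : (Σ t, S t) ≃ T') (f : ∀ t, (Σ s, R (e ⟨t, s⟩)) ≃ S' t) (g : (Σ t, S' t) ≃ U)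
    (g' : (Σ t, R t) ≃ U) (h : ∀ t s r, g ⟨t, f t ⟨s, r⟩⟩ = g' ⟨e ⟨t, s⟩, r⟩) :
    (𝟙 _ ⊗ₘ tMap fun t => C.γ (fun s => R (e ⟨t, s⟩)) ≫ tr C.seq (f t)) ≫
        C.γ S' ≫ tr C.seq g =
      regroup S _ (fun t => ev C.seq (S t)) (fun p => ev C.seq (R (e p))) ≫
        (𝟙 _ ⊗ₘ reindex e fun t => ev C.seq (R t)) ≫
          ((C.γ S ≫ tr C.seq e) ⊗ₘ 𝟙 _) ≫ C.γ R ≫ tr C.seq g' := by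
  have h₁ := C.equivariance_right _ S' f
  have h₂ := C.equivariance_left e R
  have h₃ := C.assoc S (fun t s => R (e ⟨t, s⟩))
  have h₄ : (𝟙 (ev C.seq T) ⊗ₘ tMap fun t => C.γ (fun s => R (e ⟨t, s⟩)) ≫ tr C.seq (f t)) =
      (𝟙 _ ⊗ₘ tMap fun t => C.γ fun s => R (e ⟨t, s⟩)) ≫
        (𝟙 _ ⊗ₘ tMap fun t => tr C.seq (f t)) := by
    rw [tensorHom_comp_tensorHom, tMap_comp, Category.comp_id]
  have h₅ : (𝟙 _ ⊗ₘ reindex e fun i => ev C.seq (R i)) ≫ ((C.γ S ≫ tr C.seq e) ⊗ₘ 𝟙 _) =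
      (C.γ S ⊗ₘ 𝟙 _) ≫ (tr C.seq e ⊗ₘ reindex e fun i => ev C.seq (R i)) := by
    rw [tensorHom_comp_tensorHom, tensorHom_comp_tensorHom, Category.comp_id, Category.id_comp,
      Category.id_comp]
  rw [h₄, Category.assoc, reassoc_of% h₁, reassoc_of% h₃, reassoc_of% h₅,
    reassoc_of% h₂, tr_comp, tr_comp, tr_comp]
  congr 4
  ext ⟨⟨t, s⟩, r⟩
  exact h t s r

end Operad

variable (V) in
/-- A based operad: an operad together with a base point `𝟙 ⟶ C(0)`. -/
structure BasedOperad extends Operad V where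
  /-- the base point -/
  base : 𝟙_ V ⟶ ev seq Empty

namespace BasedOperad

variable (C : BasedOperad V)

open Classical in
/-- The unit or the base point, in `C(S)` for a set `S` with at most one element. -/
def pt (S : Type) [Subsingleton S] : 𝟙_ V ⟶ ev C.seq S :=
  if h : Nonempty S then
    have : Unique S := uniqueOfSubsingleton h.some
    C.one ≫ tr C.seq (Equiv.ofUnique Unit S)
  else
    have : IsEmpty S := not_nonempty_iff.1 h
    C.base ≫ tr C.seq (Equiv.equivOfIsEmpty Empty S)

lemma pt_tr {S S' : Type} [Subsingleton S] [Subsingleton S'] (e : S ≃ S') :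
    C.pt S ≫ tr C.seq e = C.pt S' := by
  by_cases h : Nonempty S
  · have h' : Nonempty S' := e.nonempty_congr.1 h
    rw [pt, pt, dif_pos h, dif_pos h', Category.assoc, tr_comp]
    congr 2
    ext
    exact Subsingleton.elim _ _
  · have h' : ¬ Nonempty S' := fun h' => h (e.nonempty_congr.2 h')
    rw [pt, pt, dif_neg h, dif_neg h', Category.assoc, tr_comp]
    congr 2
    ext x
    exact x.elim

lemma pt_unit : C.pt Unit = C.one := by
  rw [pt, dif_pos ⟨()⟩]
  exact (congrArg _ (tr_refl _ _ fun _ => rfl)).trans (Category.comp_id _)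

lemma γ_pt_right {T : Type} [Finite T] (S : T → Type) [∀ t, Unique (S t)] :
    (𝟙 (ev C.seq T) ⊗ₘ tMap fun t => C.pt (S t)) ≫ C.γ S ≫ tr C.seq (Equiv.sigmaUnique T S) =
      unitRight (ev C.seq T) T := by
  have h := C.equivariance_right (fun _ => Unit) S fun t => Equiv.ofUnique Unit (S t)
  have h' : (tMap fun t => C.pt (S t)) =
      (tMap fun _ => C.one) ≫ tMap fun t => tr C.seq (Equiv.ofUnique Unit (S t)) := by
    rw [tMap_comp]
    congr 1
    funext t
    rw [← C.pt_unit, C.pt_tr]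
  rw [← C.one_right, h', ← Category.comp_id (𝟙 (ev C.seq T)), ← tensorHom_comp_tensorHom,
    Category.comp_id, Category.assoc, reassoc_of% h, tr_comp]
  rfl

lemma γ_pt_left {T : Type} [Unique T] (S : T → Type) [∀ t, Finite (S t)] :
    (C.pt T ⊗ₘ 𝟙 _) ≫ C.γ S ≫ tr C.seq (Equiv.uniqueSigma S) =
      unitLeft fun t => ev C.seq (S t) := by
  let e := Equiv.ofUnique Unit T
  have h := C.equivariance_left e S
  rw [← cancel_epi (𝟙 (𝟙_ V) ⊗ₘ reindex e fun t => ev C.seq (S t)), unitLeft_reindex]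
  refine Eq.trans ?_ (C.one_left fun u => S (e u))
  rw [← C.pt_tr e, C.pt_unit, tensorHom_comp_tensorHom_assoc, Category.id_comp, Category.comp_id]
  have h₂ : C.one ≫ tr C.seq e ⊗ₘ (reindex e fun t => ev C.seq (S t)) =
      (C.one ⊗ₘ 𝟙 _) ≫ (tr C.seq e ⊗ₘ reindex e fun t => ev C.seq (S t)) := by
    rw [tensorHom_comp_tensorHom, Category.id_comp]
  rw [h₂, Category.assoc, reassoc_of% h, tr_comp]
  rfl

lemma γ_pt {T : Type} [Finite T] [Subsingleton T] (S : T → Type) [∀ t, Finite (S t)]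
    [∀ t, Subsingleton (S t)] [Subsingleton (Σ t, S t)] :
    (C.pt T ⊗ₘ tMap fun t => C.pt (S t)) ≫ C.γ S = unitRight (𝟙_ V) T ≫ C.pt _ := by
  by_cases h : Nonempty T
  · have : Unique T := uniqueOfSubsingleton h.some
    have h₁ : C.pt T ⊗ₘ (tMap fun t => C.pt (S t)) =
        (𝟙 _ ⊗ₘ tMap fun t => C.pt (S t)) ≫ (C.pt T ⊗ₘ 𝟙 _) := by
      rw [tensorHom_comp_tensorHom, Category.id_comp, Category.comp_id]
    have h₂ := C.γ_pt_left S
    have h₃ : C.γ S = (C.γ S ≫ tr C.seq (Equiv.uniqueSigma S)) ≫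
        tr C.seq (Equiv.uniqueSigma S).symm := by
      rw [Category.assoc, tr_comp, tr_refl, Category.comp_id]
      simp
    rw [h₁, h₃, Category.assoc, Category.assoc, reassoc_of% h₂, unitLeft_natural_assoc, C.pt_tr, unitLeft_one]
  · have : IsEmpty T := not_nonempty_iff.1 h
    have : ∀ t, Unique (S t) := fun t => this.elim t
    have h₁ : C.pt T ⊗ₘ (tMap fun t => C.pt (S t)) =
        (C.pt T ⊗ₘ 𝟙 _) ≫ (𝟙 _ ⊗ₘ tMap fun t => C.pt (S t)) := by
      rw [tensorHom_comp_tensorHom, Category.id_comp, Category.comp_id]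
    have h₂ := C.γ_pt_right S
    have h₃ : C.γ S = (C.γ S ≫ tr C.seq (Equiv.sigmaUnique T S)) ≫
        tr C.seq (Equiv.sigmaUnique T S).symm := by
      rw [Category.assoc, tr_comp, tr_refl, Category.comp_id]
      simp
    rw [h₁, h₃, Category.assoc, Category.assoc, reassoc_of% h₂, unitRight_natural_assoc, C.pt_tr]

end BasedOperad

end Operads

/-! ### Enriched categories graded by an ordinary category -/

section Graded

variable {V : Type u} [Category.{v} V] [MonoidalCategory V] [SymmetricCategory V]
  [MonoidalClosed V] [HasColimitsOfSize.{0, 0} V]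

lemma ext_left {I : Type} {A : V} {Y : I → V} {Z : V} {f g : A ⊗ (∐ Y) ⟶ Z}
    (h : ∀ i, A ◁ Sigma.ι Y i ≫ f = A ◁ Sigma.ι Y i ≫ g) : f = g := by
  apply MonoidalClosed.curry_injective
  refine Sigma.hom_ext _ _ fun i => ?_
  rw [← MonoidalClosed.curry_natural_left, ← MonoidalClosed.curry_natural_left, h]

lemma ext_right {I : Type} {A : V} {X : I → V} {Z : V} {f g : (∐ X) ⊗ A ⟶ Z}
    (h : ∀ i, Sigma.ι X i ▷ A ≫ f = Sigma.ι X i ▷ A ≫ g) : f = g := by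
  rw [← cancel_epi (β_ A (∐ X)).hom]
  refine ext_left fun i => ?_
  rw [BraidedCategory.braiding_naturality_right_assoc, h,
    BraidedCategory.braiding_naturality_right_assoc]

lemma ext₂ {I K : Type} {X : I → V} {Y : K → V} {Z : V} {f g : (∐ X) ⊗ (∐ Y) ⟶ Z}
    (h : ∀ i k, (Sigma.ι X i ⊗ₘ Sigma.ι Y k) ≫ f = (Sigma.ι X i ⊗ₘ Sigma.ι Y k) ≫ g) :
    f = g := by
  refine ext_right fun i => ext_left fun k => ?_
  rw [← MonoidalCategory.tensorHom_def'_assoc, ← MonoidalCategory.tensorHom_def'_assoc, h]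

lemma ext₃ {I K L : Type} {X : I → V} {Y : K → V} {Z : L → V} {W : V}
    {f g : (∐ X) ⊗ (∐ Y) ⊗ (∐ Z) ⟶ W}
    (h : ∀ i k l, (Sigma.ι X i ⊗ₘ (Sigma.ι Y k ⊗ₘ Sigma.ι Z l)) ≫ f =
      (Sigma.ι X i ⊗ₘ (Sigma.ι Y k ⊗ₘ Sigma.ι Z l)) ≫ g) : f = g := by
  refine ext_right fun i => MonoidalClosed.curry_injective (ext₂ fun k l => ?_)
  rw [← MonoidalClosed.curry_natural_left, ← MonoidalClosed.curry_natural_left,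
    ← MonoidalCategory.tensorHom_def'_assoc, ← MonoidalCategory.tensorHom_def'_assoc, h]

/-- The morphism out of a tensor product of coproducts given by its components. -/
def desc₂ {I K : Type} {X : I → V} {Y : K → V} {Z : V} (f : ∀ i k, X i ⊗ Y k ⟶ Z) :
    (∐ X) ⊗ (∐ Y) ⟶ Z :=
  MonoidalClosed.uncurry (Sigma.desc fun k => MonoidalClosed.curry ((β_ _ _).hom ≫
    MonoidalClosed.uncurry (Sigma.desc fun i => MonoidalClosed.curry ((β_ _ _).hom ≫ f i k))))

lemma ι_desc₂ {I K : Type} {X : I → V} {Y : K → V} {Z : V} (f : ∀ i k, X i ⊗ Y k ⟶ Z)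
    (i : I) (k : K) : (Sigma.ι X i ⊗ₘ Sigma.ι Y k) ≫ desc₂ f = f i k := by
  rw [desc₂, MonoidalCategory.tensorHom_def, Category.assoc,
    ← MonoidalClosed.uncurry_natural_left, Sigma.ι_desc, MonoidalClosed.uncurry_curry,
    BraidedCategory.braiding_naturality_left_assoc, ← MonoidalClosed.uncurry_natural_left,
    Sigma.ι_desc, MonoidalClosed.uncurry_curry, SymmetricCategory.symmetry_assoc]

lemma ι_desc₂_assoc {I K : Type} {X : I → V} {Y : K → V} {Z W : V} (f : ∀ i k, X i ⊗ Y k ⟶ Z)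
    (i : I) (k : K) (g : Z ⟶ W) :
    (Sigma.ι X i ⊗ₘ Sigma.ι Y k) ≫ desc₂ f ≫ g = f i k ≫ g := by
  rw [← Category.assoc, ι_desc₂]

variable (V) in
/-- Objects of `V` indexed by the morphisms of a category `B`, with units and composition. -/
structure Graded (B : Type) [Category.{0} B] where
  /-- the components -/
  W {n m : B} (φ : n ⟶ m) : V
  /-- the units -/
  u (n : B) : 𝟙_ V ⟶ W (𝟙 n)
  /-- the compositions -/
  c {n m k : B} (φ : n ⟶ m) (ψ : m ⟶ k) : W φ ⊗ W ψ ⟶ W (φ ≫ ψ)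
  id_comp {n m : B} (φ : n ⟶ m) :
    (λ_ _).inv ≫ u n ▷ W φ ≫ c (𝟙 n) φ = eqToHom (by rw [Category.id_comp])
  comp_id {n m : B} (φ : n ⟶ m) :
    (ρ_ _).inv ≫ W φ ◁ u m ≫ c φ (𝟙 m) = eqToHom (by rw [Category.comp_id])
  assoc {n m k l : B} (φ : n ⟶ m) (ψ : m ⟶ k) (χ : k ⟶ l) :
    (α_ _ _ _).inv ≫ c φ ψ ▷ W χ ≫ c (φ ≫ ψ) χ =
      W φ ◁ c ψ χ ≫ c φ (ψ ≫ χ) ≫ eqToHom (by rw [Category.assoc])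

/-- The objects of `B`, regarded as the objects of the enriched category given by `G`. -/
def Graded.Obj {B : Type} [Category.{0} B] (_ : Graded V B) : Type := B

/-- The coproduct of the components. -/
def Graded.Hom {B : Type} [Category.{0} B] (G : Graded V B) (n m : B) : V :=
  ∐ fun φ : n ⟶ m => G.W φ

/-- The inclusions of the components. -/
def Graded.ι {B : Type} [Category.{0} B] (G : Graded V B) {n m : B} (φ : n ⟶ m) :
    G.W φ ⟶ G.Hom n m := Sigma.ι (fun φ : n ⟶ m => G.W φ) φ

/-- The composition of the morphism objects. -/
def Graded.comp {B : Type} [Category.{0} B] (G : Graded V B) (n m k : B) :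
    G.Hom n m ⊗ G.Hom m k ⟶ G.Hom n k :=
  desc₂ fun φ ψ => G.c φ ψ ≫ G.ι (φ ≫ ψ)

lemma Graded.ι_comp {B : Type} [Category.{0} B] (G : Graded V B) {n m k : B} (φ : n ⟶ m)
    (ψ : m ⟶ k) : (G.ι φ ⊗ₘ G.ι ψ) ≫ G.comp n m k = G.c φ ψ ≫ G.ι (φ ≫ ψ) := ι_desc₂ _ _ _

lemma Graded.ι_comp_assoc {B : Type} [Category.{0} B] (G : Graded V B) {n m k : B} (φ : n ⟶ m)
    (ψ : m ⟶ k) {Z : V} (f : G.Hom n k ⟶ Z) :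
    (G.ι φ ⊗ₘ G.ι ψ) ≫ G.comp n m k ≫ f = G.c φ ψ ≫ G.ι (φ ≫ ψ) ≫ f := by
  rw [← Category.assoc, ι_comp, Category.assoc]

lemma Graded.ι_congr {B : Type} [Category.{0} B] (G : Graded V B) {n m : B} {φ ψ : n ⟶ m}
    (h : φ = ψ) : eqToHom (congrArg G.W h) ≫ G.ι ψ = G.ι φ := by
  subst h; simp

/-- The identities. -/
def Graded.one {B : Type} [Category.{0} B] (G : Graded V B) (n : B) : 𝟙_ V ⟶ G.Hom n n :=
  G.u n ≫ G.ι (𝟙 n)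

lemma Graded.one_comp {B : Type} [Category.{0} B] (G : Graded V B) (n m : B) :
    (λ_ _).inv ≫ G.one n ▷ G.Hom n m ≫ G.comp n n m = 𝟙 _ := by
  refine Sigma.hom_ext _ _ fun φ => ?_
  change G.ι φ ≫ _ = G.ι φ ≫ _
  rw [leftUnitor_inv_naturality_assoc, whisker_exchange_assoc, Graded.one,
    comp_whiskerRight_assoc, ← MonoidalCategory.tensorHom_def_assoc,
    G.ι_comp, reassoc_of% G.id_comp φ, G.ι_congr (Category.id_comp φ).symm, Category.comp_id]

lemma Graded.comp_one {B : Type} [Category.{0} B] (G : Graded V B) (n m : B) :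
    (ρ_ _).inv ≫ G.Hom n m ◁ G.one m ≫ G.comp n m m = 𝟙 _ := by
  refine Sigma.hom_ext _ _ fun φ => ?_
  change G.ι φ ≫ _ = G.ι φ ≫ _
  rw [rightUnitor_inv_naturality_assoc, ← whisker_exchange_assoc, Graded.one,
    MonoidalCategory.whiskerLeft_comp_assoc, ← MonoidalCategory.tensorHom_def'_assoc,
    G.ι_comp, reassoc_of% G.comp_id φ, G.ι_congr (Category.comp_id φ).symm, Category.comp_id]

lemma Graded.comp_assoc {B : Type} [Category.{0} B] (G : Graded V B) (n m k l : B) :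
    (α_ _ _ _).inv ≫ G.comp n m k ▷ G.Hom k l ≫ G.comp n k l =
      G.Hom n m ◁ G.comp m k l ≫ G.comp n m l := by
  refine ext₃ fun φ ψ χ => ?_
  change (G.ι φ ⊗ₘ (G.ι ψ ⊗ₘ G.ι χ)) ≫ _ = (G.ι φ ⊗ₘ (G.ι ψ ⊗ₘ G.ι χ)) ≫ _
  have h₂ : G.c φ ψ ≫ G.ι (φ ≫ ψ) ⊗ₘ G.ι χ = G.c φ ψ ▷ _ ≫ (G.ι (φ ≫ ψ) ⊗ₘ G.ι χ) := by
    rw [← tensorHom_id, tensorHom_comp_tensorHom, Category.id_comp]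
  have h₃ : G.ι φ ⊗ₘ G.c ψ χ ≫ G.ι (ψ ≫ χ) = _ ◁ G.c ψ χ ≫ (G.ι φ ⊗ₘ G.ι (ψ ≫ χ)) := by
    rw [← id_tensorHom, tensorHom_comp_tensorHom, Category.id_comp]
  rw [associator_inv_naturality_assoc, tensorHom_comp_whiskerRight_assoc, G.ι_comp,
    tensorHom_comp_whiskerLeft_assoc, G.ι_comp, h₂, h₃, Category.assoc, Category.assoc,
    G.ι_comp, G.ι_comp, reassoc_of% G.assoc φ ψ χ, G.ι_congr (Category.assoc φ ψ χ).symm]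

/-- The enriched category with morphism objects `∐_φ W φ`. -/
instance Graded.enriched {B : Type} [Category.{0} B] (G : Graded V B) :
    EnrichedCategory V G.Obj where
  Hom n m := G.Hom n m
  id n := G.one n
  comp n m k := G.comp n m k
  id_comp n m := G.one_comp n m
  comp_id n m := G.comp_one n m
  assoc n m k l := G.comp_assoc n m k l

end Graded

/-! ### The permutative envelope and the category of operators -/

section Envelope

/-- The based finite sets `{0, 1, …, n}`. For `b = true` the morphisms are the based maps, for
`b = false` only those based maps for which the preimage of the base point is the base point.
We write a based finite set as `Option (Fin n)`, with base point `none`. -/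
structure FinBased (b : Bool) : Type where
  /-- the number of non-base points -/
  n : ℕ

variable {b : Bool}

instance : Category.{0} (FinBased b) where
  Hom n m := {φ : Option (Fin n.n) → Option (Fin m.n) //
    φ none = none ∧ (b = false → ∀ x, φ x = none → x = none)}
  id n := ⟨id, rfl, fun _ _ h => h⟩
  comp φ ψ := ⟨ψ.1 ∘ φ.1, by simp [φ.2.1, ψ.2.1], fun h x hx => φ.2.2 h x (ψ.2.2 h _ hx)⟩

/-- The preimage of a non-base point. -/
@[ext]
structure Fiber {n m : FinBased b} (φ : n ⟶ m) (j : Fin m.n) : Type where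
  /-- the element -/
  val : Fin n.n
  prop : φ.1 (some val) = some j

instance {n m : FinBased b} (φ : n ⟶ m) (j : Fin m.n) : Finite (Fiber φ j) :=
  Finite.of_injective Fiber.val fun _ _ h => Fiber.ext h

instance {n : FinBased b} (j : Fin n.n) : Unique (Fiber (𝟙 n) j) where
  default := ⟨j, rfl⟩
  uniq i := Fiber.ext (Option.some.inj i.2)

/-- The preimages of a composite. -/
def fiberComp {n m k : FinBased b} (φ : n ⟶ m) (ψ : m ⟶ k) (j : Fin k.n) :
    (Σ i : Fiber ψ j, Fiber φ i.1) ≃ Fiber (φ ≫ ψ) j :=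
  Equiv.ofBijective (fun p => ⟨p.2.1, (congrArg ψ.1 p.2.2).trans p.1.2⟩) <| by
    constructor
    · rintro ⟨⟨i, hi⟩, x, hx⟩ ⟨⟨i', hi'⟩, x', hx'⟩ h
      obtain rfl : x = x' := congrArg Fiber.val h
      obtain rfl : i = i' := Option.some.inj (hx.symm.trans hx')
      rfl
    · rintro ⟨x, hx⟩
      cases h : φ.1 (some x) with
      | none => exact absurd ((congrArg ψ.1 h.symm).trans hx) (by simp [ψ.2.1])
      | some i => exact ⟨⟨⟨i, (congrArg ψ.1 h.symm).trans hx⟩, ⟨x, h⟩⟩, rfl⟩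

lemma fiberComp_apply {n m k : FinBased b} (φ : n ⟶ m) (ψ : m ⟶ k) (j : Fin k.n)
    (p : Σ i : Fiber ψ j, Fiber φ i.1) : (fiberComp φ ψ j p).1 = p.2.1 := rfl

variable {V : Type u} [Category.{v} V] [MonoidalCategory V] [SymmetricCategory V]

lemma shuffle_ok {m k : FinBased b} (ψ : m ⟶ k) : Ok b (J := Fin m.n ⊕ Fin k.n)
    (.tens (.all fun i => .leaf (.inl i)) (.all fun j => .leaf (.inr j)))
    (.all fun j => .tens (.leaf (.inr j)) (.all fun i : Fiber ψ j => .leaf (.inl i.1))) := by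
  refine .mk ?_ ?_ ?_ ?_ <;> simp [nodup_flatMap_enum, List.nodup_append]
  · refine ⟨fun _ _ _ => Fiber.ext, fun j j' i i' h => Option.some.inj ?_⟩
    rw [← i.2, ← i'.2, h]
  · intro h j
    cases h' : ψ.1 (some j) with
    | none => simpa using ψ.2.2 h _ h'
    | some i => exact ⟨i, ⟨j, h'⟩, rfl⟩

/-- The canonical morphism `⨂_i A i ⊗ ⨂_j B j ⟶ ⨂_j (B j ⊗ ⨂_{ψ i = j} A i)`. -/
def shuffle (t : b = true → IsTerminal (𝟙_ V)) {m k : FinBased b} (ψ : m ⟶ k) (A : Fin m.n → V)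
    (B : Fin k.n → V) :
    tAll A ⊗ tAll B ⟶ tAll fun j => B j ⊗ tAll fun i : Fiber ψ j => A i.1 :=
  can t (Sum.elim A B) (shuffle_ok ψ)

lemma shuffle_natural (t : b = true → IsTerminal (𝟙_ V)) {m k : FinBased b} (ψ : m ⟶ k)
    {A A' : Fin m.n → V} {B B' : Fin k.n → V} (f : ∀ i, A i ⟶ A' i) (g : ∀ j, B j ⟶ B' j) :
    (tMap f ⊗ₘ tMap g) ≫ shuffle t ψ A' B' =
      shuffle t ψ A B ≫ tMap fun j => g j ⊗ₘ tMap fun i : Fiber ψ j => f i.1 :=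
  can_bind (X := Sum.elim A B) (Y := Sum.elim A' B') t .leaf (sumHom f g) (shuffle_ok ψ)
    (shuffle_ok ψ)

lemma oneAll_ok (K : Type) [Finite K] : Ok false (J := Empty) .one (.all fun _ : K => .one) := by
  refine .mk ?_ ?_ ?_ ?_ <;> simp [Ex.labels, nodup_flatMap_enum]

variable (V) in
/-- The canonical isomorphism `𝟙 ≅ ⨂_k 𝟙`. -/
def oneAll (K : Type) [Finite K] : 𝟙_ V ⟶ tAll fun _ : K => 𝟙_ V :=
  can noDrop (J := Empty) (fun _ => 𝟙_ V) (oneAll_ok K)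

namespace BasedOperad

variable (C : BasedOperad V) (t : b = true → IsTerminal (𝟙_ V))

/-- The summand `⨂_j C(φ⁻¹ j)` of the morphism object. -/
abbrev comp {n m : FinBased b} (φ : n ⟶ m) : V := tAll fun j => ev C.seq (Fiber φ j)

/-- The operad structure maps for a pair of composable maps. -/
def γFiber {n m k : FinBased b} (φ : n ⟶ m) (ψ : m ⟶ k) (j : Fin k.n) :
    ev C.seq (Fiber ψ j) ⊗ tAll (fun i : Fiber ψ j => ev C.seq (Fiber φ i.1)) ⟶
      ev C.seq (Fiber (φ ≫ ψ) j) :=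
  C.γ (fun i : Fiber ψ j => Fiber φ i.1) ≫ tr C.seq (fiberComp φ ψ j)

/-- The composition on summands. -/
def compMap {n m k : FinBased b} (φ : n ⟶ m) (ψ : m ⟶ k) :
    C.comp φ ⊗ C.comp ψ ⟶ C.comp (φ ≫ ψ) :=
  shuffle t ψ _ _ ≫ tMap fun j => C.γFiber φ ψ j

/-- The element given by units and base points, of the summand of a map whose preimages of
non-base points have at most one element. -/
def ptAll {n m : FinBased b} (φ : n ⟶ m) [∀ j, Subsingleton (Fiber φ j)] : 𝟙_ V ⟶ C.comp φ :=
  oneAll V _ ≫ tMap fun j => C.pt (Fiber φ j)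

lemma γFiber_id_left {n m : FinBased b} (φ : n ⟶ m) (j : Fin m.n) :
    (𝟙 _ ⊗ₘ tMap fun i : Fiber φ j => C.pt (Fiber (𝟙 n) i.1)) ≫ C.γFiber (𝟙 n) φ j =
      unitRight (ev C.seq (Fiber φ j)) (Fiber φ j) := by
  rw [← C.γ_pt_right fun i : Fiber φ j => Fiber (𝟙 n) i.1, γFiber]
  congr 3
  ext p
  exact congrArg Fin.val (Option.some.inj p.2.2)

lemma γFiber_id_right {n m : FinBased b} (φ : n ⟶ m) (j : Fin m.n) :
    (C.pt (Fiber (𝟙 m) j) ⊗ₘ 𝟙 _) ≫ C.γFiber φ (𝟙 m) j =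
      unitLeft fun i : Fiber (𝟙 m) j => ev C.seq (Fiber φ i.1) := by
  rw [← C.γ_pt_left, γFiber]
  congr 3
  ext p
  refine congrArg Fin.val ((fiberComp_apply φ (𝟙 m) j p).trans ?_)
  obtain ⟨i, x⟩ := p
  obtain rfl : i = default := Subsingleton.elim _ _
  rfl

lemma ptAll_comp {n m : FinBased b} (φ : n ⟶ m) :
    (λ_ _).inv ≫ C.ptAll (𝟙 n) ▷ C.comp φ ≫ C.compMap t (𝟙 n) φ = 𝟙 _ := by
  have h₁ : C.ptAll (𝟙 n) ▷ C.comp φ = oneAll V _ ▷ C.comp φ ≫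
      ((tMap fun j => C.pt (Fiber (𝟙 n) j)) ⊗ₘ tMap fun j => 𝟙 (ev C.seq (Fiber φ j))) := by
    rw [tMap_id, ← tensorHom_id, ← tensorHom_id, tensorHom_comp_tensorHom, Category.comp_id]
    rfl
  rw [h₁, compMap, Category.assoc, reassoc_of% shuffle_natural t φ, tMap_comp]
  simp only [γFiber_id_left]
  have hn : (Ex.all fun j : Fin m.n => .leaf j).labels.Nodup := by simp
  refine Str.eq (t := t) (X := fun j => ev C.seq (Fiber φ j)) (e := .all fun j => .leaf j)
    (e' := .all fun j => .leaf j) hn ?_ .id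
  refine .comp (e' := .tens .one (.all fun j => .leaf j)) .luInv (.comp
    (e' := .tens (.all fun _ : Fin n.n => .one) (.all fun j => .leaf j)) (.whiskerRight ?_)
    (.comp (e' := .all fun j => .tens (.leaf j) (.all fun _ : Fiber φ j => .one)) ?_
      (.map fun j => ?_)))
  · exact Str.bind' (J := Fin m.n) (K := Empty) (fun _ => .one) (oneAll_ok (Fin n.n)) _ HEq.rfl
  · exact Str.bind (Sum.elim (fun _ => .one) .leaf) (shuffle_ok φ) _
      (can_heq t (by rintro (_ | _) <;> rfl) _)
  · exact Str.bind' (fun _ => .leaf j) (unitRight_ok (Fiber φ j)) _ HEq.rfl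

lemma comp_ptAll {n m : FinBased b} (φ : n ⟶ m) :
    (ρ_ _).inv ≫ C.comp φ ◁ C.ptAll (𝟙 m) ≫ C.compMap t φ (𝟙 m) = 𝟙 _ := by
  have h₁ : C.comp φ ◁ C.ptAll (𝟙 m) = C.comp φ ◁ oneAll V _ ≫
      ((tMap fun j => 𝟙 (ev C.seq (Fiber φ j))) ⊗ₘ tMap fun j => C.pt (Fiber (𝟙 m) j)) := by
    rw [tMap_id, ← id_tensorHom, ← id_tensorHom, tensorHom_comp_tensorHom, Category.comp_id]
    rfl
  rw [h₁, compMap, Category.assoc, reassoc_of% shuffle_natural t (𝟙 m), tMap_comp]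
  simp only [tMap_id, γFiber_id_right]
  have hn : (Ex.all fun j : Fin m.n => .leaf j).labels.Nodup := by simp
  refine Str.eq (t := t) (X := fun j => ev C.seq (Fiber φ j)) (e := .all fun j => .leaf j)
    (e' := .all fun j => .leaf j) hn ?_ .id
  refine .comp (e' := .tens (.all fun j => .leaf j) .one) .ruInv (.comp
    (e' := .tens (.all fun j => .leaf j) (.all fun _ : Fin m.n => .one)) (.whiskerLeft ?_)
    (.comp (e' := .all fun j => .tens .one (.all fun i : Fiber (𝟙 m) j => .leaf i.1)) ?_
      (.map fun j => ?_)))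
  · exact Str.bind' (J := Fin m.n) (K := Empty) (fun _ => .one) (oneAll_ok (Fin m.n)) _ HEq.rfl
  · exact Str.bind (Sum.elim .leaf (fun _ => .one)) (shuffle_ok (𝟙 m)) _
      (can_heq t (by rintro (_ | _) <;> rfl) _)
  · exact Str.bind' (fun i : Fiber (𝟙 m) j => .leaf i.1) (unitLeft_ok (Fiber (𝟙 m) j)) _ HEq.rfl

lemma γFiber_assoc {n m k l : FinBased b} (φ : n ⟶ m) (ψ : m ⟶ k) (χ : k ⟶ l) (j : Fin l.n) :
    (𝟙 _ ⊗ₘ tMap fun i : Fiber χ j => C.γFiber φ ψ i.1) ≫ C.γFiber (φ ≫ ψ) χ j =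
      regroup (fun i : Fiber χ j => Fiber ψ i.1) _ (fun i => ev C.seq (Fiber ψ i.1))
          (fun p => ev C.seq (Fiber φ p.2.1)) ≫
        (𝟙 _ ⊗ₘ reindex (fiberComp ψ χ j) fun i => ev C.seq (Fiber φ i.1)) ≫
          (C.γFiber ψ χ j ⊗ₘ 𝟙 _) ≫ C.γFiber φ (ψ ≫ χ) j :=
  C.assoc_tr (fun i : Fiber χ j => Fiber ψ i.1) (fun i => Fiber (φ ≫ ψ) i.1)
    (fun i : Fiber (ψ ≫ χ) j => Fiber φ i.1) (fiberComp ψ χ j) (fun i => fiberComp φ ψ i.1)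
    (fiberComp (φ ≫ ψ) χ j) (fiberComp φ (ψ ≫ χ) j) fun _ _ _ => rfl

lemma compMap_assoc {n m k l : FinBased b} (φ : n ⟶ m) (ψ : m ⟶ k) (χ : k ⟶ l) :
    (α_ _ _ _).inv ≫ C.compMap t φ ψ ▷ C.comp χ ≫ C.compMap t (φ ≫ ψ) χ =
      C.comp φ ◁ C.compMap t ψ χ ≫ C.compMap t φ (ψ ≫ χ) := by
  have h₁ : C.compMap t φ ψ ▷ C.comp χ = shuffle t ψ _ _ ▷ C.comp χ ≫
      ((tMap fun j => C.γFiber φ ψ j) ⊗ₘ tMap fun j => 𝟙 (ev C.seq (Fiber χ j))) := by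
    rw [tMap_id, ← tensorHom_id, ← tensorHom_id, tensorHom_comp_tensorHom, Category.comp_id]
    rfl
  have h₂ : C.comp φ ◁ C.compMap t ψ χ = C.comp φ ◁ shuffle t χ _ _ ≫
      ((tMap fun j => 𝟙 (ev C.seq (Fiber φ j))) ⊗ₘ tMap fun j => C.γFiber ψ χ j) := by
    rw [tMap_id, ← id_tensorHom, ← id_tensorHom, tensorHom_comp_tensorHom, Category.comp_id]
    rfl
  rw [h₁, h₂, compMap, compMap, Category.assoc (shuffle _ _ _ _ ▷ _),
    Category.assoc (C.comp φ ◁ _), reassoc_of% shuffle_natural t χ, tMap_comp, reassoc_of% shuffle_natural t (ψ ≫ χ), tMap_comp]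
  simp only [γFiber_assoc, tMap_id]
  simp only [← tMap_comp, ← Category.assoc]
  congr 2
  let L : Fin m.n → Ex (Fin m.n ⊕ Fin k.n ⊕ Fin l.n) := fun i => .leaf (.inl i)
  let M : Fin k.n → Ex (Fin m.n ⊕ Fin k.n ⊕ Fin l.n) := fun i => .leaf (.inr (.inl i))
  let N : Fin l.n → Ex (Fin m.n ⊕ Fin k.n ⊕ Fin l.n) := fun i => .leaf (.inr (.inr i))
  have hn : (Ex.tens (.all L) (.tens (.all M) (.all N))).labels.Nodup := by
    simp [L, M, N, nodup_flatMap_enum, List.nodup_append]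
  refine Str.eq (t := t) (X := Sum.elim (fun i => ev C.seq (Fiber φ i))
    (Sum.elim (fun i => ev C.seq (Fiber ψ i)) fun i => ev C.seq (Fiber χ i)))
    (e := .tens (.all L) (.tens (.all M) (.all N)))
    (e' := .all fun i => .tens (.tens (N i) (.all fun j : Fiber χ i => M j.1))
      (.all fun j : Fiber (ψ ≫ χ) i => L j.1)) hn ?_ ?_
  · refine .comp (e' := .all fun i => .tens (.tens (N i) (.all fun j : Fiber χ i => M j.1))
      (.all fun p : (Σ j : Fiber χ i, Fiber ψ j.1) => L p.2.1)) (.comp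
        (e' := .all fun i => .tens (N i) (.all fun j : Fiber χ i => .tens (M j.1)
          (.all fun p : Fiber ψ j.1 => L p.1))) (.comp
          (e' := .tens (.all fun j => .tens (M j) (.all fun p : Fiber ψ j => L p.1)) (.all N))
            (.comp (e' := .tens (.tens (.all L) (.all M)) (.all N)) .assocInv
              (.whiskerRight ?_)) ?_) (.map fun i => ?_)) (.map fun i => .tens .id ?_)
    · exact Str.bind (Sum.elim L M) (shuffle_ok ψ) _ (can_heq t (by rintro (_ | _) <;> rfl) _)
    · exact Str.bind (Sum.elim (fun j => .tens (M j) (.all fun p : Fiber ψ j => L p.1)) N)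
        (shuffle_ok χ) _ (can_heq t (by rintro (_ | _) <;> rfl) _)
    · refine Str.bind' (V := V) (t := t) (X := Sum.elim (fun i => ev C.seq (Fiber φ i))
        (Sum.elim (fun i => ev C.seq (Fiber ψ i)) fun i => ev C.seq (Fiber χ i)))
        (Sum.elim (fun _ => N i) (Sum.elim (fun j => M j.1) fun p => L p.2.1))
        (regroup_ok fun j : Fiber χ i => Fiber ψ j.1) _ ?_
      refine can_heq noDrop ?_ _
      rintro (_ | _ | _) <;> rfl
    · exact Str.bind' (fun j : Fiber (ψ ≫ χ) i => L j.1) (reindex_ok (fiberComp ψ χ i)) _ HEq.rfl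
  · refine .comp (e' := .tens (.all L) (.all fun i => .tens (N i)
      (.all fun j : Fiber χ i => M j.1))) (.whiskerLeft ?_) ?_
    · exact Str.bind (Sum.elim M N) (shuffle_ok χ) _ (can_heq t (by rintro (_ | _) <;> rfl) _)
    · exact Str.bind (Sum.elim L fun i => .tens (N i) (.all fun j : Fiber χ i => M j.1))
        (shuffle_ok (ψ ≫ χ)) _ (can_heq t (by rintro (_ | _) <;> rfl) _)

lemma ptAll_ptAll {n m k : FinBased b} (φ : n ⟶ m) (ψ : m ⟶ k) [∀ j, Subsingleton (Fiber φ j)]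
    [∀ j, Subsingleton (Fiber ψ j)] [∀ j, Subsingleton (Fiber (φ ≫ ψ) j)] :
    (λ_ _).inv ≫ (C.ptAll φ ⊗ₘ C.ptAll ψ) ≫ C.compMap t φ ψ = C.ptAll (φ ≫ ψ) := by
  have h₁ : C.ptAll φ ⊗ₘ C.ptAll ψ = (oneAll V _ ⊗ₘ oneAll V _) ≫
      ((tMap fun j => C.pt (Fiber φ j)) ⊗ₘ tMap fun j => C.pt (Fiber ψ j)) := by
    rw [tensorHom_comp_tensorHom]
    rfl
  have h₂ : ∀ j, (C.pt (Fiber ψ j) ⊗ₘ tMap fun i : Fiber ψ j => C.pt (Fiber φ i.1)) ≫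
      C.γFiber φ ψ j = unitRight (𝟙_ V) (Fiber ψ j) ≫ C.pt (Fiber (φ ≫ ψ) j) := fun j => by
    have : Subsingleton (Σ i : Fiber ψ j, Fiber φ i.1) := (fiberComp φ ψ j).subsingleton
    rw [γFiber, reassoc_of% C.γ_pt (fun i : Fiber ψ j => Fiber φ i.1), C.pt_tr]
  rw [h₁, compMap, Category.assoc, reassoc_of% shuffle_natural t ψ, tMap_comp]
  simp only [h₂]
  simp only [← tMap_comp, ptAll, ← Category.assoc]
  congr 1
  refine Str.eq (t := t) (X := fun j : Empty => 𝟙_ V) (e := .one)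
    (e' := .all fun j : Fin k.n => .one) (by simp [Ex.labels]) ?_ ?_
  · refine .comp (e' := .all fun j => .tens .one (.all fun _ : Fiber ψ j => .one)) (.comp
      (e' := .tens (.all fun _ : Fin m.n => .one) (.all fun _ : Fin k.n => .one)) (.comp
        (e' := .tens .one .one) .luInv (.tens ?_ ?_)) ?_) (.map fun j => ?_)
    · exact Str.bind' (J := Empty) (K := Empty) (fun _ => .one) (oneAll_ok (Fin m.n)) _ HEq.rfl
    · exact Str.bind' (J := Empty) (K := Empty) (fun _ => .one) (oneAll_ok (Fin k.n)) _ HEq.rfl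
    · exact Str.bind (fun _ => .one) (shuffle_ok ψ) _ (can_heq t (by rintro (_ | _) <;> rfl) _)
    · exact Str.bind' (fun _ => .one) (unitRight_ok (Fiber ψ j)) _ HEq.rfl
  · exact Str.bind' (J := Empty) (K := Empty) (fun _ => .one) (oneAll_ok (Fin k.n)) _ HEq.rfl

variable [MonoidalClosed V] [HasColimitsOfSize.{0, 0} V]

/-- The data of the enriched categories below. -/
def graded : Graded V (FinBased b) where
  W φ := C.comp φ
  u n := C.ptAll (𝟙 n)
  c φ ψ := C.compMap t φ ψ
  id_comp φ := C.ptAll_comp t φ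
  comp_id φ := C.comp_ptAll t φ
  assoc φ ψ χ := by
    refine (C.compMap_assoc t φ ψ χ).trans (congrArg _ ?_)
    exact (Category.comp_id _).symm

end BasedOperad

end Envelope

/-! ### Coends and the monad of an enriched category -/

section Monad

variable {V : Type u} [Category.{v} V] [MonoidalCategory V]

section Coend

variable {Ξ : Type} [Category.{0} Ξ]

/-- The bifunctor `(k, m) ↦ Y k ⊗ H m`. -/
def coInt (Y : Ξᵒᵖ ⥤ V) (H : Ξ ⥤ V) : Ξᵒᵖ ⥤ Ξ ⥤ V where
  obj k :=
    { obj := fun m => Y.obj k ⊗ H.obj m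
      map := fun f => Y.obj k ◁ H.map f }
  map g :=
    { app := fun m => Y.map g ▷ H.obj m
      naturality := fun _ _ f => whisker_exchange (Y.map g) (H.map f) }

variable [HasColimitsOfSize.{0, 0} V]

/-- The coend `∫^k Y k ⊗ H k`. -/
def coT (Y : Ξᵒᵖ ⥤ V) (H : Ξ ⥤ V) : V := coend (coInt Y H)

/-- The structure maps of the coend. -/
def coι (Y : Ξᵒᵖ ⥤ V) (H : Ξ ⥤ V) (k : Ξ) : Y.obj (op k) ⊗ H.obj k ⟶ coT Y H :=
  coend.ι (coInt Y H) k

lemma coι_condition (Y : Ξᵒᵖ ⥤ V) (H : Ξ ⥤ V) {k m : Ξ} (f : k ⟶ m) :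
    Y.map f.op ▷ H.obj k ≫ coι Y H k = Y.obj (op m) ◁ H.map f ≫ coι Y H m :=
  coend.condition (coInt Y H) f

lemma coT_ext {Y : Ξᵒᵖ ⥤ V} {H : Ξ ⥤ V} {Z : V} {f g : coT Y H ⟶ Z}
    (h : ∀ k, coι Y H k ≫ f = coι Y H k ≫ g) : f = g := coend.hom_ext h

/-- The universal property of the coend. -/
def coDesc {Y : Ξᵒᵖ ⥤ V} {H : Ξ ⥤ V} {Z : V} (f : ∀ k : Ξ, Y.obj (op k) ⊗ H.obj k ⟶ Z)
    (hf : ∀ ⦃k m : Ξ⦄ (g : k ⟶ m), Y.map g.op ▷ H.obj k ≫ f k = Y.obj (op m) ◁ H.map g ≫ f m) :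
    coT Y H ⟶ Z := coend.desc (F := coInt Y H) f hf

lemma coι_coDesc {Y : Ξᵒᵖ ⥤ V} {H : Ξ ⥤ V} {Z : V} (f : ∀ k : Ξ, Y.obj (op k) ⊗ H.obj k ⟶ Z)
    (hf : ∀ ⦃k m : Ξ⦄ (g : k ⟶ m), Y.map g.op ▷ H.obj k ≫ f k = Y.obj (op m) ◁ H.map g ≫ f m)
    (k : Ξ) : coι Y H k ≫ coDesc f hf = f k := coend.ι_desc (F := coInt Y H) f hf k

lemma coι_coDesc_assoc {Y : Ξᵒᵖ ⥤ V} {H : Ξ ⥤ V} {Z W : V}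
    (f : ∀ k : Ξ, Y.obj (op k) ⊗ H.obj k ⟶ Z)
    (hf : ∀ ⦃k m : Ξ⦄ (g : k ⟶ m), Y.map g.op ▷ H.obj k ≫ f k = Y.obj (op m) ◁ H.map g ≫ f m)
    (k : Ξ) (g : Z ⟶ W) : coι Y H k ≫ coDesc f hf ≫ g = f k ≫ g := by
  rw [← Category.assoc, coι_coDesc]

/-- The functoriality of the coend. -/
def coMap {Y Y' : Ξᵒᵖ ⥤ V} {H H' : Ξ ⥤ V} (f : Y ⟶ Y') (g : H ⟶ H') : coT Y H ⟶ coT Y' H' :=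
  coDesc (fun k => (f.app (op k) ⊗ₘ g.app k) ≫ coι Y' H' k) <| by
    intro k m h
    rw [← tensorHom_id, tensorHom_comp_tensorHom_assoc, f.naturality, Category.id_comp,
      ← id_tensorHom, tensorHom_comp_tensorHom_assoc, g.naturality, Category.id_comp]
    have h₁ : (f.app (op m) ≫ Y'.map h.op) ⊗ₘ g.app k =
      (f.app (op m) ⊗ₘ g.app k) ≫ Y'.map h.op ▷ H'.obj k := by
      rw [← tensorHom_id, tensorHom_comp_tensorHom, Category.comp_id]
    have h₂ : f.app (op m) ⊗ₘ (g.app k ≫ H'.map h) =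
      (f.app (op m) ⊗ₘ g.app k) ≫ Y'.obj (op m) ◁ H'.map h := by
      rw [← id_tensorHom, tensorHom_comp_tensorHom, Category.comp_id]
    rw [h₁, h₂, Category.assoc, Category.assoc, coι_condition]

lemma coι_coMap {Y Y' : Ξᵒᵖ ⥤ V} {H H' : Ξ ⥤ V} (f : Y ⟶ Y') (g : H ⟶ H') (k : Ξ) :
    coι Y H k ≫ coMap f g = (f.app (op k) ⊗ₘ g.app k) ≫ coι Y' H' k := coι_coDesc _ _ _

lemma coι_coMap_assoc {Y Y' : Ξᵒᵖ ⥤ V} {H H' : Ξ ⥤ V} (f : Y ⟶ Y') (g : H ⟶ H') (k : Ξ)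
    {Z : V} (h : coT Y' H' ⟶ Z) :
    coι Y H k ≫ coMap f g ≫ h = (f.app (op k) ⊗ₘ g.app k) ≫ coι Y' H' k ≫ h := by
  rw [← Category.assoc, coι_coMap, Category.assoc]

lemma coMap_id (Y : Ξᵒᵖ ⥤ V) (H : Ξ ⥤ V) : coMap (𝟙 Y) (𝟙 H) = 𝟙 _ :=
  coT_ext fun k => by rw [coι_coMap]; simp

lemma coMap_comp {Y Y' Y'' : Ξᵒᵖ ⥤ V} {H H' H'' : Ξ ⥤ V} (f : Y ⟶ Y') (f' : Y' ⟶ Y'')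
    (g : H ⟶ H') (g' : H' ⟶ H'') : coMap f g ≫ coMap f' g' = coMap (f ≫ f') (g ≫ g') :=
  coT_ext fun k => by
    rw [coι_coMap_assoc, coι_coMap, coι_coMap, tensorHom_comp_tensorHom_assoc]
    rfl

variable [SymmetricCategory V] [MonoidalClosed V]

lemma coT_ext_tensor {Y : Ξᵒᵖ ⥤ V} {H : Ξ ⥤ V} {A Z : V} {f g : coT Y H ⊗ A ⟶ Z}
    (h : ∀ k, coι Y H k ▷ A ≫ f = coι Y H k ▷ A ≫ g) : f = g := by
  rw [← cancel_epi (β_ A (coT Y H)).hom]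
  apply MonoidalClosed.curry_injective
  refine coT_ext fun k => ?_
  rw [← MonoidalClosed.curry_natural_left, ← MonoidalClosed.curry_natural_left,
    BraidedCategory.braiding_naturality_right_assoc, h,
    BraidedCategory.braiding_naturality_right_assoc]

/-- Tensor products preserve coends. -/
def coDescTensor {Y : Ξᵒᵖ ⥤ V} {H : Ξ ⥤ V} {A Z : V}
    (f : ∀ k : Ξ, (Y.obj (op k) ⊗ H.obj k) ⊗ A ⟶ Z)
    (hf : ∀ ⦃k m : Ξ⦄ (g : k ⟶ m), (Y.map g.op ▷ H.obj k) ▷ A ≫ f k =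
      (Y.obj (op m) ◁ H.map g) ▷ A ≫ f m) :
    coT Y H ⊗ A ⟶ Z :=
  (β_ _ _).hom ≫ MonoidalClosed.uncurry (coDesc (fun k => MonoidalClosed.curry
    ((β_ _ _).hom ≫ f k)) <| by
      intro k m g
      rw [← MonoidalClosed.curry_natural_left, ← MonoidalClosed.curry_natural_left,
        BraidedCategory.braiding_naturality_right_assoc, hf,
        BraidedCategory.braiding_naturality_right_assoc])

lemma coι_coDescTensor {Y : Ξᵒᵖ ⥤ V} {H : Ξ ⥤ V} {A Z : V}
    (f : ∀ k : Ξ, (Y.obj (op k) ⊗ H.obj k) ⊗ A ⟶ Z)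
    (hf : ∀ ⦃k m : Ξ⦄ (g : k ⟶ m), (Y.map g.op ▷ H.obj k) ▷ A ≫ f k =
      (Y.obj (op m) ◁ H.map g) ▷ A ≫ f m) (k : Ξ) :
    coι Y H k ▷ A ≫ coDescTensor f hf = f k := by
  rw [coDescTensor, BraidedCategory.braiding_naturality_left_assoc,
    ← MonoidalClosed.uncurry_natural_left, coι_coDesc, MonoidalClosed.uncurry_curry,
    SymmetricCategory.symmetry_assoc]

lemma coι_coDescTensor_assoc {Y : Ξᵒᵖ ⥤ V} {H : Ξ ⥤ V} {A Z W : V}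
    (f : ∀ k : Ξ, (Y.obj (op k) ⊗ H.obj k) ⊗ A ⟶ Z)
    (hf : ∀ ⦃k m : Ξ⦄ (g : k ⟶ m), (Y.map g.op ▷ H.obj k) ▷ A ≫ f k =
      (Y.obj (op m) ◁ H.map g) ▷ A ≫ f m) (k : Ξ) (g : Z ⟶ W) :
    coι Y H k ▷ A ≫ coDescTensor f hf ≫ g = f k ≫ g := by
  rw [← Category.assoc, coι_coDescTensor]

end Coend

variable {A : Type} [Category.{v} A] [EnrichedOrdinaryCategory V A]

lemma eHom_whisker_middle {X Y Y' Z : A} (g : Y ⟶ Y') :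
    eHomWhiskerLeft V X g ▷ (Y' ⟶[V] Z) ≫ eComp V X Y' Z =
      _ ◁ eHomWhiskerRight V g Z ≫ eComp V X Y Z := by
  dsimp [eHomWhiskerLeft, eHomWhiskerRight]
  simp only [MonoidalCategory.whiskerLeft_comp_assoc, whisker_assoc_symm,
    triangle_assoc_comp_left_inv_assoc, e_assoc', Category.assoc, comp_whiskerRight]

variable {Ξ : Type} [Category.{0} Ξ] (J : Ξᵒᵖ ⥤ A)

/-- The functor `m ↦ A(J m, x)`. -/
@[reducible]
def homR (x : A) : Ξ ⥤ V where
  obj m := J.obj (op m) ⟶[V] x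
  map f := eHomWhiskerRight V (J.map f.op) x
  map_id m := by simp
  map_comp f g := by simp

/-- The functoriality of `homR`. -/
@[reducible]
def homRMap {x y : A} (g : x ⟶ y) : homR (V := V) J x ⟶ homR J y where
  app m := eHomWhiskerLeft V (J.obj (op m)) g
  naturality _ _ f := (eHom_whisker_exchange V (J.map f.op) g).symm

variable [HasColimitsOfSize.{0, 0} V] [SymmetricCategory V] [MonoidalClosed V]

variable (V) in
/-- The functor `n ↦ ∫^m Y m ⊗ A(J m, J n)`. -/
def monT : (Ξᵒᵖ ⥤ V) ⥤ (Ξᵒᵖ ⥤ V) where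
  obj Y :=
    { obj := fun n => coT Y (homR J (J.obj n))
      map := fun g => coMap (𝟙 Y) (homRMap J (J.map g))
      map_id := fun n => by
        rw [← coMap_id]
        congr 1
        ext m
        simp [homR]
      map_comp := fun f g => by
        rw [coMap_comp, Category.comp_id]
        congr 1
        ext m
        simp [homRMap] }
  map f :=
    { app := fun n => coMap f (𝟙 _)
      naturality := fun m n g => by
        dsimp only
        rw [coMap_comp, coMap_comp, Category.comp_id, Category.id_comp, Category.comp_id,
          Category.id_comp] }
  map_id Y := by
    ext n
    exact coMap_id _ _
  map_comp f g := by
    ext n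
    dsimp only [NatTrans.comp_app]
    rw [coMap_comp, Category.comp_id]

lemma coι_homR (Y : Ξᵒᵖ ⥤ V) (x : A) {k m : Ξ} (g : k ⟶ m) :
    Y.map g.op ▷ (J.obj (op k) ⟶[V] x) ≫ coι Y (homR J x) k =
      Y.obj (op m) ◁ eHomWhiskerRight V (J.map g.op) x ≫ coι Y (homR J x) m :=
  coι_condition Y (homR J x) g

/-- The composition `(∫^m Y m ⊗ A(J m, y)) ⊗ A(y, x) ⟶ ∫^m Y m ⊗ A(J m, x)`. -/
def coAct (Y : Ξᵒᵖ ⥤ V) (y x : A) : coT Y (homR J y) ⊗ (y ⟶[V] x) ⟶ coT Y (homR J x) :=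
  coDescTensor (fun m => (α_ _ _ _).hom ≫ Y.obj (op m) ◁ eComp V (J.obj (op m)) y x ≫
    coι Y (homR J x) m) <| by
    intro k m g
    rw [associator_naturality_left_assoc, associator_naturality_middle_assoc,
      ← whisker_exchange_assoc, coι_homR]
    have h := eComp_eHomWhiskerRight V (J.map g.op) y x
    rw [← MonoidalCategory.whiskerLeft_comp_assoc, ← MonoidalCategory.whiskerLeft_comp_assoc]
    exact congrArg (fun f => _ ≫ _ ◁ f ≫ _) h

lemma coι_coAct (Y : Ξᵒᵖ ⥤ V) (y x : A) (m : Ξ) :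
    coι Y (homR J y) m ▷ (y ⟶[V] x) ≫ coAct J Y y x =
      (α_ _ _ _).hom ≫ Y.obj (op m) ◁ eComp V (J.obj (op m)) y x ≫ coι Y (homR J x) m :=
  coι_coDescTensor _ _ _

lemma coι_coAct_assoc (Y : Ξᵒᵖ ⥤ V) (y x : A) (m : Ξ) {Z : V} (f : coT Y (homR J x) ⟶ Z) :
    coι Y (homR J y) m ▷ (y ⟶[V] x) ≫ coAct J Y y x ≫ f =
      (α_ _ _ _).hom ≫ Y.obj (op m) ◁ eComp V (J.obj (op m)) y x ≫ coι Y (homR J x) m ≫ f := by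
  rw [← Category.assoc, coι_coAct, Category.assoc, Category.assoc]

/-- The multiplication. -/
def monMul (Y : Ξᵒᵖ ⥤ V) (x : A) :
    coT ((monT V J).obj Y) (homR J x) ⟶ coT Y (homR J x) :=
  coDesc (fun p => coAct J Y (J.obj (op p)) x) <| by
    intro p p' g
    refine coT_ext_tensor fun m => ?_
    have h₁ : coι Y (homR J (J.obj (op p'))) m ▷ (J.obj (op p) ⟶[V] x) ≫
        coT Y (homR J (J.obj (op p'))) ◁ eHomWhiskerRight V (J.map g.op) x =
          _ ◁ eHomWhiskerRight V (J.map g.op) x ≫ coι Y (homR J (J.obj (op p'))) m ▷ _ :=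
      (whisker_exchange _ _).symm
    have h₂ : coι Y (homR J (J.obj (op p'))) m ≫ coMap (𝟙 Y) (homRMap J (J.map g.op)) =
        Y.obj (op m) ◁ eHomWhiskerLeft V (J.obj (op m)) (J.map g.op) ≫ coι Y (homR J _) m :=
      (coι_coMap _ _ _).trans (by rw [NatTrans.id_app, id_tensorHom])
    have h₃ := eHom_whisker_middle (V := V) (X := J.obj (op m)) (J.map g.op) (Z := x)
    have h₄ : coι Y (homR J (J.obj (op p'))) m ▷ (J.obj (op p) ⟶[V] x) ≫
        coMap (𝟙 Y) (homRMap J (J.map g.op)) ▷ _ ≫ coAct J Y (J.obj (op p)) x =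
      coι Y (homR J (J.obj (op p'))) m ▷ (J.obj (op p) ⟶[V] x) ≫
        coT Y (homR J (J.obj (op p'))) ◁ eHomWhiskerRight V (J.map g.op) x ≫
          coAct J Y (J.obj (op p')) x := by
      rw [← comp_whiskerRight_assoc, h₂, comp_whiskerRight_assoc, coι_coAct, reassoc_of% h₁,
        coι_coAct, associator_naturality_middle_assoc, associator_naturality_right_assoc,
        ← MonoidalCategory.whiskerLeft_comp_assoc, ← MonoidalCategory.whiskerLeft_comp_assoc]
      exact congrArg (fun f => _ ≫ _ ◁ f ≫ _) h₃
    exact h₄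

lemma coι_monMul (Y : Ξᵒᵖ ⥤ V) (x : A) (p : Ξ) :
    coι ((monT V J).obj Y) (homR J x) p ≫ monMul J Y x = coAct J Y (J.obj (op p)) x :=
  coι_coDesc _ _ _

lemma coMap_coAct {Y Y' : Ξᵒᵖ ⥤ V} (f : Y ⟶ Y') (y x : A) :
    coMap f (𝟙 _) ▷ (y ⟶[V] x) ≫ coAct J Y' y x = coAct J Y y x ≫ coMap f (𝟙 _) := by
  refine coT_ext_tensor fun m => ?_
  rw [← comp_whiskerRight_assoc, coι_coMap, comp_whiskerRight_assoc, coι_coAct, coι_coAct_assoc,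
    coι_coMap, NatTrans.id_app, NatTrans.id_app, tensorHom_id, tensorHom_id,
    associator_naturality_left_assoc, whisker_exchange_assoc]

lemma coAct_coMap (Y : Ξᵒᵖ ⥤ V) (y : A) {x x' : A} (g : x ⟶ x') :
    coAct J Y y x ≫ coMap (𝟙 Y) (homRMap J g) =
      coT Y (homR J y) ◁ eHomWhiskerLeft V y g ≫ coAct J Y y x' := by
  refine coT_ext_tensor fun m => ?_
  have h₁ : coι Y (homR J y) m ▷ (y ⟶[V] x) ≫ coT Y (homR J y) ◁ eHomWhiskerLeft V y g =
      _ ◁ eHomWhiskerLeft V y g ≫ coι Y (homR J y) m ▷ _ := (whisker_exchange _ _).symm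
  have h₂ : coι Y (homR J x) m ≫ coMap (𝟙 Y) (homRMap J g) =
        Y.obj (op m) ◁ eHomWhiskerLeft V (J.obj (op m)) g ≫ coι Y (homR J _) m :=
      (coι_coMap _ _ _).trans (by rw [NatTrans.id_app, id_tensorHom])
  rw [coι_coAct_assoc, h₂, reassoc_of% h₁, coι_coAct, associator_naturality_right_assoc,
    ← MonoidalCategory.whiskerLeft_comp_assoc, ← MonoidalCategory.whiskerLeft_comp_assoc,
    eComp_eHomWhiskerLeft]

lemma coAct_coAct (Y : Ξᵒᵖ ⥤ V) (z y x : A) :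
    coAct J Y z y ▷ (y ⟶[V] x) ≫ coAct J Y y x =
      (α_ _ _ _).hom ≫ coT Y (homR J z) ◁ eComp V z y x ≫ coAct J Y z x := by
  rw [← cancel_epi (α_ _ _ _).inv, Iso.inv_hom_id_assoc]
  refine coT_ext_tensor fun m => ?_
  have h : coι Y (homR J z) m ▷ ((z ⟶[V] y) ⊗ (y ⟶[V] x)) ≫ coT Y (homR J z) ◁ eComp V z y x =
      _ ◁ eComp V z y x ≫ coι Y (homR J z) m ▷ _ := (whisker_exchange _ _).symm
  rw [associator_inv_naturality_left_assoc, ← comp_whiskerRight_assoc, coι_coAct, reassoc_of% h,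
    coι_coAct, comp_whiskerRight_assoc, comp_whiskerRight_assoc, coι_coAct,
    associator_naturality_middle_assoc, associator_naturality_right_assoc,
    ← MonoidalCategory.whiskerLeft_comp_assoc, ← MonoidalCategory.whiskerLeft_comp_assoc,
    ← e_assoc', MonoidalCategory.whiskerLeft_comp_assoc]
  simp only [← Category.assoc]
  congr 2
  rw [← cancel_mono (_ ◁ (α_ _ _ _).inv)]
  simp [homR]

/-- The unit. -/
def monUnit (Y : Ξᵒᵖ ⥤ V) (n : Ξᵒᵖ) : Y.obj n ⟶ coT Y (homR J (J.obj n)) :=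
  (ρ_ _).inv ≫ Y.obj n ◁ eId V (J.obj n) ≫ coι Y (homR J (J.obj n)) n.unop

lemma monUnit_natural (Y : Ξᵒᵖ ⥤ V) {n m : Ξᵒᵖ} (g : n ⟶ m) :
    Y.map g ≫ monUnit J Y m = monUnit J Y n ≫ coMap (𝟙 Y) (homRMap J (J.map g)) := by
  have h₁ : eId V (J.obj m) ≫ eHomWhiskerRight V (J.map g) (J.obj m) =
      eHomEquiv V (J.map g) := by
    rw [eHomWhiskerRight, leftUnitor_inv_naturality_assoc, whisker_exchange_assoc,
      unitors_inv_equal, ← rightUnitor_inv_naturality_assoc, e_comp_id, Category.comp_id]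
  have h₂ : eId V (J.obj n) ≫ eHomWhiskerLeft V (J.obj n) (J.map g) =
      eHomEquiv V (J.map g) := by
    rw [eHomWhiskerLeft, rightUnitor_inv_naturality_assoc, ← whisker_exchange_assoc,
      ← unitors_inv_equal, ← leftUnitor_inv_naturality_assoc, e_id_comp, Category.comp_id]
  have h₃ : coι Y (homR J (J.obj n)) n.unop ≫ coMap (𝟙 Y) (homRMap J (J.map g)) =
      Y.obj n ◁ eHomWhiskerLeft V (J.obj n) (J.map g) ≫ coι Y (homR J (J.obj m)) n.unop :=
    (coι_coMap _ _ _).trans (by rw [NatTrans.id_app, id_tensorHom])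
  have h₄ : Y.map g ▷ (J.obj m ⟶[V] J.obj m) ≫ coι Y (homR J (J.obj m)) m.unop =
      Y.obj n ◁ eHomWhiskerRight V (J.map g) (J.obj m) ≫ coι Y (homR J (J.obj m)) n.unop :=
    coι_homR J Y _ g.unop
  rw [monUnit, monUnit, rightUnitor_inv_naturality_assoc, ← whisker_exchange_assoc, h₄,
    Category.assoc, Category.assoc, h₃, ← MonoidalCategory.whiskerLeft_comp_assoc,
    ← MonoidalCategory.whiskerLeft_comp_assoc, h₁, h₂]

lemma monUnit_natural_left {Y Y' : Ξᵒᵖ ⥤ V} (f : Y ⟶ Y') (n : Ξᵒᵖ) :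
    f.app n ≫ monUnit J Y' n = monUnit J Y n ≫ coMap f (𝟙 _) := by
  have h : coι Y (homR J (J.obj n)) n.unop ≫ coMap f (𝟙 _) =
      f.app n ▷ (J.obj n ⟶[V] J.obj n) ≫ coι Y' (homR J (J.obj n)) n.unop :=
    (coι_coMap _ _ _).trans (by rw [NatTrans.id_app, tensorHom_id])
  rw [monUnit, monUnit, Category.assoc, Category.assoc, h, rightUnitor_inv_naturality_assoc,
    whisker_exchange_assoc]

lemma monUnit_coAct (Y : Ξᵒᵖ ⥤ V) (n : Ξᵒᵖ) (x : A) :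
    monUnit J Y n ▷ (J.obj n ⟶[V] x) ≫ coAct J Y (J.obj n) x =
      coι Y (homR J x) n.unop := by
  have h : coι Y (homR J (J.obj n)) n.unop ▷ (J.obj n ⟶[V] x) ≫ coAct J Y (J.obj n) x =
      (α_ _ _ _).hom ≫ Y.obj n ◁ eComp V (J.obj n) (J.obj n) x ≫ coι Y (homR J x) n.unop :=
    coι_coAct J Y (J.obj n) x n.unop
  rw [monUnit, comp_whiskerRight_assoc, comp_whiskerRight_assoc, h,
    associator_naturality_middle_assoc, ← triangle_assoc_comp_left_inv_assoc,
    Iso.inv_hom_id_assoc, ← MonoidalCategory.whiskerLeft_comp_assoc,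
    ← MonoidalCategory.whiskerLeft_comp_assoc, Category.assoc, e_id_comp,
    MonoidalCategory.whiskerLeft_id]
  exact Category.id_comp _

lemma coAct_eId (Y : Ξᵒᵖ ⥤ V) (x : A) :
    (ρ_ _).inv ≫ coT Y (homR J x) ◁ eId V x ≫ coAct J Y x x = 𝟙 _ := by
  refine coT_ext fun m => ?_
  have h : coι Y (homR J x) m ▷ 𝟙_ V ≫ coT Y (homR J x) ◁ eId V x =
      _ ◁ eId V x ≫ coι Y (homR J x) m ▷ _ := (whisker_exchange _ _).symm
  rw [rightUnitor_inv_naturality_assoc, reassoc_of% h, coι_coAct,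
    associator_naturality_right_assoc, rightUnitor_tensor_inv_assoc, Iso.inv_hom_id_assoc,
    ← MonoidalCategory.whiskerLeft_comp_assoc, ← MonoidalCategory.whiskerLeft_comp_assoc,
    Category.assoc]
  refine (congrArg (fun f => Y.obj (op m) ◁ f ≫ _) (e_comp_id V _ _)).trans ?_
  rw [MonoidalCategory.whiskerLeft_id, Category.comp_id]
  exact Category.id_comp _

lemma monMul_natural (Y : Ξᵒᵖ ⥤ V) {x x' : A} (g : x ⟶ x') :
    coMap (𝟙 ((monT V J).obj Y)) (homRMap J g) ≫ monMul J Y x' =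
      monMul J Y x ≫ coMap (𝟙 Y) (homRMap J g) := by
  refine coT_ext fun p => ?_
  have h : coι ((monT V J).obj Y) (homR J x) p ≫ coMap (𝟙 _) (homRMap J g) =
      coT Y (homR J (J.obj (op p))) ◁ eHomWhiskerLeft V (J.obj (op p)) g ≫
        coι ((monT V J).obj Y) (homR J x') p :=
    (coι_coMap _ _ _).trans (by rw [NatTrans.id_app, id_tensorHom]; rfl)
  have h₁ := coAct_coMap J Y (J.obj (op p)) g
  have h₂ := coι_monMul J Y x' p
  rw [reassoc_of% coι_monMul J Y x p]
  refine Eq.trans ?_ h₁.symm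
  rw [← h₂]
  exact (Category.assoc _ _ _).symm.trans ((congrArg (· ≫ _) h).trans (Category.assoc _ _ _))

lemma monMul_natural_left {Y Y' : Ξᵒᵖ ⥤ V} (f : Y ⟶ Y') (x : A) :
    coMap ((monT V J).map f) (𝟙 _) ≫ monMul J Y' x = monMul J Y x ≫ coMap f (𝟙 _) := by
  refine coT_ext fun p => ?_
  rw [coι_coMap_assoc, coι_monMul, reassoc_of% coι_monMul J Y x p, NatTrans.id_app, tensorHom_id]
  exact coMap_coAct J f _ _

lemma monMul_monMul (Y : Ξᵒᵖ ⥤ V) (f : (monT V J).obj ((monT V J).obj Y) ⟶ (monT V J).obj Y)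
    (hf : ∀ p, f.app p = monMul J Y (J.obj p)) (x : A) :
    coMap f (𝟙 (homR J x)) ≫ monMul J Y x =
      monMul J ((monT V J).obj Y) x ≫ monMul J Y x := by
  refine coT_ext fun p => ?_
  have h₁ := coι_monMul J Y x p
  have h₂ : coι ((monT V J).obj ((monT V J).obj Y)) (homR J x) p ≫
      monMul J ((monT V J).obj Y) x ≫ monMul J Y x =
        coAct J ((monT V J).obj Y) (J.obj (op p)) x ≫ monMul J Y x := by
    rw [← coι_monMul J ((monT V J).obj Y) x p]
    exact (Category.assoc _ _ _).symm
  have h₃ : coι ((monT V J).obj ((monT V J).obj Y)) (homR J x) p ≫ coMap f (𝟙 (homR J x)) =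
      monMul J Y (J.obj (op p)) ▷ (J.obj (op p) ⟶[V] x) ≫
        coι ((monT V J).obj Y) (homR J x) p := by
    refine (coι_coMap _ _ _).trans ?_
    rw [NatTrans.id_app, tensorHom_id, hf]
    rfl
  rw [reassoc_of% h₃, h₂]
  refine (Category.assoc _ _ _).trans ((congrArg (_ ≫ ·) h₁).trans ?_)
  refine (coT_ext_tensor fun q => ?_)
  have h₄ := coι_monMul J Y (J.obj (op p)) q
  have h₅ : coι ((monT V J).obj Y) (homR J x) q ≫ monMul J Y x =
      coAct J Y (J.obj (op q)) x := coι_monMul J Y x q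
  have h₆ : coι ((monT V J).obj Y) (homR J (J.obj (op p))) q ▷ (J.obj (op p) ⟶[V] x) ≫
      monMul J Y (J.obj (op p)) ▷ (J.obj (op p) ⟶[V] x) =
        coAct J Y (J.obj (op q)) (J.obj (op p)) ▷ _ := by
    rw [← comp_whiskerRight, h₄]
    rfl
  refine (Category.assoc _ _ _).symm.trans
    ((congrArg (· ≫ coAct J Y (J.obj (op p)) x) h₆).trans ?_)
  refine Eq.trans ?_ (coι_coAct_assoc J ((monT V J).obj Y) (J.obj (op p)) x q _).symm
  exact (coAct_coAct J Y (J.obj (op q)) (J.obj (op p)) x).trans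
    (congrArg (fun f => (α_ _ _ _).hom ≫ coT Y (homR J (J.obj (op q))) ◁
      eComp V (J.obj (op q)) (J.obj (op p)) x ≫ f) h₅.symm)

variable (V) in
/-- The monad `Y ↦ ∫^m Y m ⊗ A(J m, J -)`. -/
def mon : Monad (Ξᵒᵖ ⥤ V) where
  toFunctor := monT V J
  η :=
    { app := fun Y =>
        { app := fun n => monUnit J Y n
          naturality := fun _ _ g => monUnit_natural J Y g }
      naturality := fun _ _ f => by
        ext n
        exact monUnit_natural_left J f n }
  μ :=
    { app := fun Y =>
        { app := fun n => monMul J Y (J.obj n)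
          naturality := fun _ _ g => monMul_natural J Y (J.map g) }
      naturality := fun _ _ f => by
        ext n
        exact monMul_natural_left J f _ }
  assoc Y := by
    ext n
    exact monMul_monMul J Y _ (fun _ => rfl) _
  left_unit Y := by
    ext n
    change monUnit J ((monT V J).obj Y) n ≫ monMul J Y (J.obj n) = 𝟙 _
    rw [monUnit, Category.assoc, Category.assoc, coι_monMul]
    exact coAct_eId J Y _
  right_unit Y := by
    ext n
    change coMap _ (𝟙 _) ≫ monMul J Y (J.obj n) = 𝟙 _
    refine coT_ext fun p => ?_
    rw [coι_coMap_assoc, coι_monMul, NatTrans.id_app, tensorHom_id]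
    exact (monUnit_coAct J Y (op p) _).trans (Category.comp_id _).symm

end Monad

section Inclusion

variable {b b' : Bool}

/-- A based injection, as a based map. -/
def Inj.based {m n : Inj b'} (f : m ⟶ n) : (⟨m.n⟩ : FinBased b) ⟶ ⟨n.n⟩ :=
  ⟨Option.map f.1, rfl, fun _ _ h => Option.map_eq_none_iff.1 h⟩

instance {m n : Inj b'} (f : m ⟶ n) (j : Fin n.n) :
    Subsingleton (Fiber (Inj.based (b := b) f) j) where
  allEq x y := Fiber.ext <| f.2.1 <| Option.some.inj (x.2.trans y.2.symm)

lemma Inj.based_id (m : Inj b') : Inj.based (b := b) (𝟙 m) = 𝟙 _ :=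
  Subtype.ext Option.map_id

lemma Inj.based_comp {m n k : Inj b'} (f : m ⟶ n) (g : n ⟶ k) :
    Inj.based (b := b) (f ≫ g) = Inj.based f ≫ Inj.based g :=
  Subtype.ext (Option.map_comp_map f.1 g.1).symm

variable {V : Type u} [Category.{v} V] [MonoidalCategory V] [SymmetricCategory V]
  [MonoidalClosed V] [HasColimitsOfSize.{0, 0} V]

namespace BasedOperad

variable (C : BasedOperad V) (t : b = true → IsTerminal (𝟙_ V))

/-- The enriched category with objects the based finite sets and morphism objects
`∐_φ ⨂_j C(φ⁻¹ j)`, where `φ` runs through the morphisms of `FinBased b`. -/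
abbrev Env : Type := (C.graded t).Obj

lemma ptAll_congr {n m : FinBased b} {φ ψ : n ⟶ m} (h : φ = ψ) [∀ j, Subsingleton (Fiber φ j)]
    [∀ j, Subsingleton (Fiber ψ j)] :
    C.ptAll φ ≫ (C.graded t).ι φ = C.ptAll ψ ≫ (C.graded t).ι ψ := by
  subst h
  rfl

variable (b') in
/-- The functor from `Λ` (for `b' = true`) or `Σ` (for `b' = false`) that sends a based injection
to the element given by units and base points of the corresponding summand. -/
def incl : Inj b' ⥤ ForgetEnrichment V (C.Env t) where
  obj n := ForgetEnrichment.of V (C := C.Env t) (⟨n.n⟩ : FinBased b)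
  map f := ForgetEnrichment.homOf V (C := C.Env t)
    (C.ptAll (Inj.based (b := b) f) ≫ (C.graded t).ι (Inj.based (b := b) f))
  map_id n := (congrArg _ (C.ptAll_congr t (Inj.based_id n))).trans
    (ForgetEnrichment.homOf_eId V (C := C.Env t) (⟨n.n⟩ : FinBased b))
  map_comp f g := by
    refine Eq.trans ?_ (ForgetEnrichment.homOf_comp V (C := C.Env t) _ _)
    have : ∀ j, Subsingleton (Fiber (Inj.based (b := b) f ≫ Inj.based (b := b) g) j) := by
      rw [← Inj.based_comp]
      infer_instance
    refine congrArg _ ((C.ptAll_congr t (Inj.based_comp f g)).trans ?_)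
    have h := (C.graded t).ι_comp (Inj.based (b := b) f) (Inj.based (b := b) g)
    rw [← C.ptAll_ptAll t (Inj.based f) (Inj.based g)]
    refine (Category.assoc _ _ _).trans (congrArg _ ((Category.assoc _ _ _).trans ?_))
    refine (congrArg ((C.ptAll _ ⊗ₘ C.ptAll _) ≫ ·) h.symm).trans ?_
    exact (Category.assoc _ _ _).symm.trans
      (congrArg (· ≫ _) (tensorHom_comp_tensorHom _ _ _ _))

variable (b') in
/-- The monad `Y ↦ ∫^m Y m ⊗ E(-, m)` on `Σᵒᵖ[V]` or `Λᵒᵖ[V]`, where `E` is `C.Env t`. -/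
def monad : Monad ((Inj b')ᵒᵖ ⥤ V) := mon V (C.incl b' t).op

end BasedOperad

end Inclusion

section Presheaves

variable (V : Type u) [Category.{v} V] [MonoidalCategory V] [SymmetricCategory V]
  [MonoidalClosed V]

open scoped MonoidalClosed

/-- The `V`-functors `Eᵒᵖ ⥤ V`. -/
structure Presheaf (E : Type) [EnrichedCategory V E] where
  /-- the functor -/
  fct : EnrichedFunctor V Eᵒᵖ V

variable {V} {E : Type} [EnrichedCategory V E]

namespace Presheaf

/-- The `V`-natural transformations. -/
@[ext]
structure Hom (F G : Presheaf V E) where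
  /-- the components -/
  app (X : Eᵒᵖ) : F.fct.obj X ⟶ G.fct.obj X
  naturality (X Y : Eᵒᵖ) :
    F.fct.map X Y ≫ (ihom (F.fct.obj X)).map (app Y) =
      G.fct.map X Y ≫ (MonoidalClosed.pre (app X)).app (G.fct.obj Y)

instance : Category (Presheaf V E) where
  Hom := Hom
  id F := ⟨fun _ => 𝟙 _, fun X Y => by simp⟩
  comp f g := ⟨fun X => f.app X ≫ g.app X, fun X Y => by
    have h := (MonoidalClosed.pre (f.app X)).naturality (g.app Y)
    rw [MonoidalClosed.pre_map, NatTrans.comp_app, Functor.map_comp, ← Category.assoc,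
      f.naturality, Category.assoc, ← h, ← Category.assoc, g.naturality, Category.assoc]⟩
  id_comp f := Hom.ext (funext fun _ => Category.id_comp _)
  comp_id f := Hom.ext (funext fun _ => Category.comp_id _)
  assoc f g h := Hom.ext (funext fun _ => Category.assoc _ _ _)

end Presheaf

end Presheaves

/-! ### Powers of sequences and the Kelly product -/

section Fill

section

variable {b : Bool} {V : Type u} [Category.{v} V] (E : (Inj b)ᵒᵖ ⥤ V)

lemma tr_res {S T S' T' : Type} [Finite S] [Finite T] [Finite S'] [Finite T'] (g : S ≃ T)
    (f : S' → S) (hf : IsInj b f) (g' : S' ≃ T') (f' : T' → T) (hf' : IsInj b f')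
    (h : ∀ s, f' (g' s) = g (f s)) :
    tr E g ≫ res E f' hf' = res E f hf ≫ tr E g' := by
  rw [tr, tr, res_comp, res_comp]
  congr 1
  funext x
  obtain ⟨s, rfl⟩ := g'.surjective x
  simp [h]

lemma tr_empty {S T : Type} [Finite S] [Finite T] [IsEmpty S] (g g' : S ≃ T) :
    tr E g = tr E g' := by
  rw [show g = g' from Equiv.ext fun s => isEmptyElim s]

end

variable {b : Bool} {V : Type u} [Category.{v} V] [MonoidalCategory V] [SymmetricCategory V]

lemma uniqAll_ok {T : Type} [Finite T] [Subsingleton T] (t : T) :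
    Ok false (.all fun t : T => .leaf t) (.leaf t) := by
  refine .mk ?_ ?_ ?_ ?_ <;> simp
  exact fun j => Subsingleton.elim _ _

/-- The canonical isomorphism `⨂_t Y t ≅ Y t₀` for a type with only one element `t₀`. -/
def uniqAll {T : Type} [Finite T] [Subsingleton T] (t : T) (Y : T → V) : tAll Y ⟶ Y t :=
  can noDrop Y (uniqAll_ok t)

lemma emptyAll_ok (T : Type) [IsEmpty T] : Ok false (.all fun t : T => .leaf t) .one := by
  refine .mk ?_ ?_ ?_ ?_ <;> simp [Ex.labels]

/-- The canonical isomorphism `⨂_t Y t ≅ 𝟙` for an empty type. -/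
def emptyAll {T : Type} [IsEmpty T] (Y : T → V) : tAll Y ⟶ 𝟙_ V :=
  can noDrop Y (emptyAll_ok T)

lemma uniqAll_natural {T : Type} [Finite T] [Subsingleton T] (t : T) {Y Z : T → V}
    (f : ∀ t, Y t ⟶ Z t) : tMap f ≫ uniqAll t Z = uniqAll t Y ≫ f t :=
  can_bind noDrop .leaf f (uniqAll_ok t) (uniqAll_ok t)

lemma emptyAll_natural {T : Type} [IsEmpty T] {Y Z : T → V} (f : ∀ t, Y t ⟶ Z t) :
    tMap f ≫ emptyAll Z = emptyAll Y :=
  (can_bind noDrop .leaf f (emptyAll_ok T) (emptyAll_ok T)).trans (Category.comp_id _)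

lemma flatten_ok {T : Type} [Finite T] (S : T → Type) [∀ t, Finite (S t)] :
    Ok false (J := Σ t, S t) (.all fun t => .all fun s => .leaf ⟨t, s⟩)
      (.all fun p => .leaf p) := by
  refine .mk ?_ ?_ ?_ ?_ <;> simp [nodup_flatMap_enum]
  · aesop
  · exact fun j => ⟨j.1, j.2, rfl⟩

/-- The canonical isomorphism `⨂_t ⨂_s Y (t, s) ≅ ⨂_{(t, s)} Y (t, s)`. -/
def flatten {T : Type} [Finite T] (S : T → Type) [∀ t, Finite (S t)] (Y : (Σ t, S t) → V) :
    tAll (fun t => tAll fun s => Y ⟨t, s⟩) ⟶ tAll Y :=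
  can noDrop Y (flatten_ok S)

lemma flatten_natural {T : Type} [Finite T] (S : T → Type) [∀ t, Finite (S t)]
    {Y Z : (Σ t, S t) → V} (f : ∀ p, Y p ⟶ Z p) :
    (tMap fun t => tMap fun s => f ⟨t, s⟩) ≫ flatten S Z = flatten S Y ≫ tMap f :=
  can_bind noDrop .leaf f (flatten_ok S) (flatten_ok S)

lemma reindex_emptyAll {T T' : Type} [IsEmpty T] [IsEmpty T'] (g : T ≃ T') (Y : T' → V) :
    reindex g Y ≫ emptyAll Y = emptyAll fun t => Y (g t) := by
  refine Str.eq (t := noDrop) (X := Y) (e := .all fun t => .leaf (g t)) (e' := .one)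
    (reindex_ok g).1 (.comp (e' := .all fun t => .leaf t) ?_ ?_) ?_
  · exact Str.bind' (X := Y) .leaf (reindex_ok g) _ HEq.rfl
  · exact Str.bind' (X := Y) .leaf (emptyAll_ok T') _ HEq.rfl
  · exact Str.bind' (X := Y) (fun t => .leaf (g t)) (emptyAll_ok T) _ HEq.rfl

lemma reindex_uniqAll {T T' : Type} [Finite T] [Finite T'] [Subsingleton T] [Subsingleton T']
    (g : T ≃ T') (t : T) (Y : T' → V) :
    reindex g Y ≫ uniqAll (g t) Y = uniqAll t fun t => Y (g t) := by
  refine Str.eq (t := noDrop) (X := Y) (e := .all fun t => .leaf (g t)) (e' := .leaf (g t))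
    (reindex_ok g).1 (.comp (e' := .all fun t => .leaf t) ?_ ?_) ?_
  · exact Str.bind' (X := Y) .leaf (reindex_ok g) _ HEq.rfl
  · exact Str.bind' (X := Y) .leaf (uniqAll_ok (g t)) _ HEq.rfl
  · exact Str.bind' (X := Y) (fun t => .leaf (g t)) (uniqAll_ok t) _ HEq.rfl

lemma flatten_emptyAll {T : Type} [IsEmpty T] (S : T → Type) [∀ t, Finite (S t)]
    (Y : (Σ t, S t) → V) :
    flatten S Y ≫ emptyAll Y = emptyAll fun t => tAll fun s => Y ⟨t, s⟩ := by
  refine Str.eq (t := noDrop) (X := Y) (e := .all fun t => .all fun s => .leaf ⟨t, s⟩) (e' := .one)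
    (flatten_ok S).1 (.comp (e' := .all fun t => .leaf t) ?_ ?_) ?_
  · exact Str.bind' (X := Y) .leaf (flatten_ok S) _ HEq.rfl
  · exact Str.bind' (X := Y) .leaf (emptyAll_ok _) _ HEq.rfl
  · exact Str.bind' (X := Y) (fun t => .all fun s => .leaf ⟨t, s⟩) (emptyAll_ok T) _ HEq.rfl

/-- The identification of a family of sets indexed by a one-element set with its member. -/
def sigmaAt {T : Type} [Subsingleton T] (t : T) (S : T → Type) : S t ≃ Σ t, S t :=
  Equiv.ofBijective (fun s => ⟨t, s⟩) ⟨fun _ _ h => eq_of_heq (Sigma.mk.inj h).2, by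
    rintro ⟨t', s⟩
    obtain rfl := Subsingleton.elim t t'
    exact ⟨s, rfl⟩⟩

lemma uniqAll_reindex {T : Type} [Finite T] [Subsingleton T] (t : T) (S : T → Type)
    [∀ t, Finite (S t)] (Y : (Σ t, S t) → V) :
    uniqAll t (fun t => tAll fun s => Y ⟨t, s⟩) ≫ reindex (sigmaAt t S) Y = flatten S Y := by
  refine Str.eq (t := noDrop) (X := Y) (e := .all fun t => .all fun s => .leaf ⟨t, s⟩)
    (e' := .all fun p => .leaf p) (flatten_ok S).1
    (.comp (e' := .all fun s : S t => .leaf (⟨t, s⟩ : Σ t, S t)) ?_ ?_) ?_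
  · exact Str.bind' (X := Y) (fun t => .all fun s => .leaf (⟨t, s⟩ : Σ t, S t)) (uniqAll_ok t) _
      HEq.rfl
  · exact Str.bind' (X := Y) .leaf (reindex_ok (sigmaAt t S)) _ HEq.rfl
  · exact Str.bind' (X := Y) .leaf (flatten_ok S) _ HEq.rfl

variable (E : (Inj b)ᵒᵖ ⥤ V) (e : b = true → (𝟙_ V ⟶ ev E Empty))

open Classical in
/-- For a family `S t`, where `t` runs through a set `T` with at most one element, the canonical
isomorphism `⨂_t E(S t) ≅ E(Σ t, S t)` if `T` is not empty, and the base map `𝟙 ⟶ E(∅)` if `T` is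
empty. -/
def fill {T : Type} [Finite T] [Subsingleton T] (hT : b = false → Nonempty T) (S : T → Type)
    [∀ t, Finite (S t)] : tAll (fun t => ev E (S t)) ⟶ ev E (Σ t, S t) :=
  if h : Nonempty T then
    uniqAll h.some (fun t => ev E (S t)) ≫ tr E (sigmaAt h.some S)
  else
    have : IsEmpty T := not_nonempty_iff.1 h
    emptyAll (fun t => ev E (S t)) ≫ e (Bool.eq_true_of_not_eq_false fun hb => h (hT hb)) ≫
      tr E (Equiv.equivOfIsEmpty Empty (Σ t, S t))

lemma fill_of {T : Type} [Finite T] [Subsingleton T] (t : T) (hT : b = false → Nonempty T)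
    (S : T → Type) [∀ t, Finite (S t)] :
    fill E e hT S = uniqAll t (fun t => ev E (S t)) ≫ tr E (sigmaAt t S) := by
  have h : Nonempty T := ⟨t⟩
  rw [fill, dif_pos h, Subsingleton.elim t h.some]

lemma fill_empty {T : Type} [IsEmpty T] (hT : b = false → Nonempty T) (hb : b = true)
    (S : T → Type) [∀ t, Finite (S t)] :
    fill E e hT S = emptyAll (fun t => ev E (S t)) ≫ e hb ≫
      tr E (Equiv.equivOfIsEmpty Empty (Σ t, S t)) := by
  rw [fill, dif_neg (not_nonempty_iff.2 ‹_›)]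

lemma fill_natural {T : Type} [Finite T] [Subsingleton T] (hT : b = false → Nonempty T)
    (S S' : T → Type) [∀ t, Finite (S t)] [∀ t, Finite (S' t)] (f : ∀ t, S t → S' t)
    (hf : ∀ t, IsInj b (f t)) (hf' : IsInj b (Sigma.map id f : (Σ t, S t) → Σ t, S' t)) :
    (tMap fun t => res E (f t) (hf t)) ≫ fill E e hT S =
      fill E e hT S' ≫ res E (Sigma.map id f) hf' := by
  rcases isEmpty_or_nonempty T with h | ⟨⟨t⟩⟩
  · have hb : b = true := Bool.eq_true_of_not_eq_false fun hb => (hT hb).elim h.elim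
    rw [fill_empty _ _ _ hb, fill_empty _ _ _ hb, reassoc_of% emptyAll_natural]
    have h₁ : res E (id : Empty → Empty) (IsInj.id b _) = 𝟙 _ := res_id _ _ _ fun _ => rfl
    rw [Category.assoc, Category.assoc, tr_res E _ id (IsInj.id b _)
      (Equiv.equivOfIsEmpty Empty (Σ t, S t)) _ _ fun s => s.elim, h₁, Category.id_comp]
  · rw [fill_of E e t, fill_of E e t, reassoc_of% uniqAll_natural t, Category.assoc,
      tr_res E _ _ (hf t) (sigmaAt t S) _ hf' fun s => rfl]

lemma reindex_fill {T T' : Type} [Finite T] [Finite T'] [Subsingleton T] [Subsingleton T']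
    (g : T ≃ T') (hT : b = false → Nonempty T) (hT' : b = false → Nonempty T') (S : T' → Type)
    [∀ t, Finite (S t)] :
    (reindex g fun t => ev E (S t)) ≫ fill E e hT' S =
      fill E e hT (fun t => S (g t)) ≫
        tr E (Equiv.sigmaCongr g fun t => Equiv.refl (S (g t))) := by
  rcases isEmpty_or_nonempty T with h | ⟨⟨t⟩⟩
  · have hb : b = true := Bool.eq_true_of_not_eq_false fun hb => (hT hb).elim h.elim
    have : IsEmpty T' := g.symm.isEmpty
    rw [fill_empty _ _ _ hb, fill_empty _ _ _ hb, reassoc_of% reindex_emptyAll, Category.assoc,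
      Category.assoc, tr_comp, tr_empty]
  · rw [fill_of E e t, fill_of E e (g t), reassoc_of% reindex_uniqAll, Category.assoc, tr_comp]
    exact congrArg (fun h => _ ≫ tr E h) (Equiv.ext fun s => rfl)

lemma fill_fill {T : Type} [Finite T] [Subsingleton T] (S : T → Type) [∀ t, Finite (S t)]
    [∀ t, Subsingleton (S t)] [Subsingleton (Σ t, S t)] (R : ∀ t, S t → Type)
    [∀ t s, Finite (R t s)] (hT : b = false → Nonempty T) (hS : ∀ t, b = false → Nonempty (S t))
    (hS' : b = false → Nonempty (Σ t, S t)) :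
    (tMap fun t => fill E e (hS t) (R t)) ≫ fill E e hT (fun t => Σ s, R t s) =
      flatten S (fun p => ev E (R p.1 p.2)) ≫
        fill E e hS' (fun p : Σ t, S t => R p.1 p.2) ≫ tr E (Equiv.sigmaAssoc R) := by
  rcases isEmpty_or_nonempty T with h | ⟨⟨t⟩⟩
  · have hb : b = true := Bool.eq_true_of_not_eq_false fun hb => (hT hb).elim h.elim
    have h' : (flatten S fun p => ev E (R p.1 p.2)) ≫
        emptyAll (fun p : (Σ t, S t) => ev E (R p.1 p.2)) =
          emptyAll fun t => tAll fun s => ev E (R t s) :=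
      flatten_emptyAll S fun p => ev E (R p.1 p.2)
    rw [fill_empty _ _ _ hb, fill_empty _ _ _ hb, Category.assoc, reassoc_of% h',
      reassoc_of% emptyAll_natural, Category.assoc, tr_comp, tr_empty]
  · obtain ⟨r, h, h'⟩ : ∃ r : tAll (fun s => ev E (R t s)) ⟶
        tAll fun p : (Σ t, S t) => ev E (R p.1 p.2),
          (uniqAll t fun t => tAll fun s => ev E (R t s)) ≫ r =
            flatten S (fun p => ev E (R p.1 p.2)) ∧
          r ≫ fill E e hS' (fun p => R p.1 p.2) = fill E e (hS t) (R t) ≫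
            tr E (Equiv.sigmaCongr (sigmaAt t S) fun s => Equiv.refl (R t s)) :=
      ⟨reindex (sigmaAt t S) fun p => ev E (R p.1 p.2),
        uniqAll_reindex t S fun p => ev E (R p.1 p.2),
        reindex_fill E e (sigmaAt t S) (hS t) hS' fun p => R p.1 p.2⟩
    rw [fill_of E e t, reassoc_of% uniqAll_natural t, ← h, Category.assoc, reassoc_of% h', tr_comp]
    exact congrArg (fun h => _ ≫ _ ≫ tr E h) (Equiv.ext fun s => rfl)

end Fill

section Power

variable {b : Bool}

/-- The maps that come from based injections (bijections if `b = false`). -/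
structure IsLam (b : Bool) {m n : FinBased false} (ω : m ⟶ n) : Prop where
  sub (j : Fin n.n) : Subsingleton (Fiber ω j)
  ne (j : Fin n.n) : b = false → Nonempty (Fiber ω j)

lemma IsLam.id (n : FinBased false) : IsLam b (𝟙 n) :=
  ⟨fun _ => inferInstance, fun _ _ => inferInstance⟩

lemma IsLam.based {m n : Inj b} (f : m ⟶ n) : IsLam b (Inj.based f : (⟨m.n⟩ : FinBased false) ⟶ ⟨n.n⟩) :=
  ⟨fun _ => inferInstance, fun j hb => by
    obtain ⟨i, hi⟩ := f.2.2 hb j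
    exact ⟨⟨i, congrArg some hi⟩⟩⟩

lemma IsLam.comp {m n k : FinBased false} {ω : m ⟶ n} {φ : n ⟶ k} (h : IsLam b ω)
    (h' : IsLam b φ) : IsLam b (ω ≫ φ) := by
  have := h.sub
  have := h'.sub
  refine ⟨fun j => ⟨fun x y => ?_⟩, fun j hb => ?_⟩
  · obtain ⟨⟨i, x⟩, rfl⟩ := (fiberComp ω φ j).surjective x
    obtain ⟨⟨i', y⟩, rfl⟩ := (fiberComp ω φ j).surjective y
    obtain rfl := Subsingleton.elim i i'
    obtain rfl := Subsingleton.elim x y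
    rfl
  obtain ⟨i⟩ := h'.ne j hb
  obtain ⟨x⟩ := h.ne i.1 hb
  exact ⟨fiberComp ω φ j ⟨i, x⟩⟩

/-- The map between preimages induced by the first of two composable maps. -/
def fiberMap {m n k : FinBased false} (ω : m ⟶ n) (φ : n ⟶ k) (j : Fin k.n) :
    Fiber (ω ≫ φ) j → Fiber φ j := fun x => ((fiberComp ω φ j).symm x).1

lemma fiberMap_spec {m n k : FinBased false} (ω : m ⟶ n) (φ : n ⟶ k) (j : Fin k.n)
    (x : Fiber (ω ≫ φ) j) : ω.1 (some x.1) = some (fiberMap ω φ j x).1 := by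
  obtain ⟨⟨i, y⟩, rfl⟩ := (fiberComp ω φ j).surjective x
  rw [fiberMap, Equiv.symm_apply_apply]
  exact y.2

lemma isInj_fiberMap {m n k : FinBased false} {ω : m ⟶ n} (h : IsLam b ω) (φ : n ⟶ k)
    (j : Fin k.n) : IsInj b (fiberMap ω φ j) := by
  refine ⟨fun x y hxy => Fiber.ext ?_, fun hb i => ?_⟩
  · have := h.sub (fiberMap ω φ j x).1
    have := Subsingleton.elim (⟨x.1, fiberMap_spec ω φ j x⟩ : Fiber ω (fiberMap ω φ j x).1)
      ⟨y.1, (fiberMap_spec ω φ j y).trans (by rw [hxy])⟩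
    exact Fiber.mk.inj this
  · obtain ⟨x⟩ := h.ne i.1 hb
    exact ⟨fiberComp ω φ j ⟨i, x⟩, by rw [fiberMap, Equiv.symm_apply_apply]⟩

variable {V : Type u} [Category.{v} V] [MonoidalCategory V] [SymmetricCategory V]

lemma distribute_ok {k l : FinBased false} (ψ : k ⟶ l) : Ok false
    (.all fun i : Fin k.n => .leaf i) (.all fun j => .all fun i : Fiber ψ j => .leaf i.1) := by
  refine .mk ?_ ?_ ?_ ?_ <;> simp [nodup_flatMap_enum]
  · refine ⟨fun _ _ _ => Fiber.ext, fun j j' i i' h => Option.some.inj ?_⟩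
    rw [← i.2, ← i'.2, h]
  · intro j
    cases h' : ψ.1 (some j) with
    | none => simpa using ψ.2.2 rfl _ h'
    | some i => exact ⟨i, ⟨j, h'⟩, rfl⟩

/-- The canonical isomorphism `⨂_i A i ≅ ⨂_j ⨂_{ψ i = j} A i`. -/
def distribute {k l : FinBased false} (ψ : k ⟶ l) (A : Fin k.n → V) :
    tAll A ⟶ tAll fun j => tAll fun i : Fiber ψ j => A i.1 :=
  can noDrop A (distribute_ok ψ)

lemma distribute_natural {k l : FinBased false} (ψ : k ⟶ l) {A B : Fin k.n → V}
    (f : ∀ i, A i ⟶ B i) :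
    tMap f ≫ distribute ψ B = distribute ψ A ≫ tMap fun j => tMap fun i : Fiber ψ j => f i.1 :=
  can_bind noDrop .leaf f (distribute_ok ψ) (distribute_ok ψ)

variable (E : (Inj b)ᵒᵖ ⥤ V) (e : b = true → (𝟙_ V ⟶ ev E Empty))

/-- The summand `⨂_j E(φ⁻¹ j)` of `E^{⊠ k}(n)`. -/
abbrev powW {n k : FinBased false} (φ : n ⟶ k) : V := tAll fun j => ev E (Fiber φ j)

/-- The contravariant functoriality of the summands. -/
def powR {m n k : FinBased false} {ω : m ⟶ n} (h : IsLam b ω) (φ : n ⟶ k) :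
    powW E φ ⟶ powW E (ω ≫ φ) :=
  tMap fun j => res E (fiberMap ω φ j) (isInj_fiberMap h φ j)

/-- For a based injection `ψ : k ⟶ l`, the canonical isomorphism
`⨂_{ψ i = j} E(φ⁻¹ i) ≅ E((φ ≫ ψ)⁻¹ j)` if `j` is in the image of `ψ`, and otherwise the base map
`𝟙 ⟶ E(∅)`. -/
def fillMap {n k l : FinBased false} (φ : n ⟶ k) {ψ : k ⟶ l} (h : IsLam b ψ) (j : Fin l.n) :
    tAll (fun i : Fiber ψ j => ev E (Fiber φ i.1)) ⟶ ev E (Fiber (φ ≫ ψ) j) :=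
  have := h.sub j
  fill E e (h.ne j) (fun i : Fiber ψ j => Fiber φ i.1) ≫ tr E (fiberComp φ ψ j)

/-- The covariant functoriality of the summands: the factors `E(∅)` for those indices that are
not in the image of a based injection are filled by base points. -/
def powL {n k l : FinBased false} (φ : n ⟶ k) {ψ : k ⟶ l} (h : IsLam b ψ) :
    powW E φ ⟶ powW E (φ ≫ ψ) :=
  distribute ψ _ ≫ tMap fun j => fillMap E e φ h j

lemma powR_id {n k : FinBased false} (φ : n ⟶ k) : powR E (IsLam.id n) φ = 𝟙 _ := by
  refine Eq.trans ?_ (tMap_id _)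
  refine congrArg tMap (funext fun j => res_id E (S := Fiber φ j) _ _ fun x => Fiber.ext ?_)
  exact (Option.some.inj (fiberMap_spec (𝟙 n) φ j x)).symm

lemma powR_comp {l m n k : FinBased false} {ω : l ⟶ m} (h : IsLam b ω) {ω' : m ⟶ n}
    (h' : IsLam b ω') (φ : n ⟶ k) :
    powR E h' φ ≫ powR E h (ω' ≫ φ) = powR E (h.comp h') φ := by
  refine (tMap_comp _ _).trans (congrArg tMap (funext fun j => ?_))
  refine (res_comp ..).trans ?_
  have : fiberMap ω' φ j ∘ fiberMap ω (ω' ≫ φ) j = fiberMap (ω ≫ ω') φ j := by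
    funext x
    refine Fiber.ext (Option.some.inj ?_)
    rw [← fiberMap_spec (ω ≫ ω') φ j x]
    refine (fiberMap_spec ω' φ j _).symm.trans ?_
    rw [← fiberMap_spec ω (ω' ≫ φ) j x]
    rfl
  congr 1

lemma powR_powL {m n k l : FinBased false} {ω : m ⟶ n} (h : IsLam b ω) (φ : n ⟶ k) {ψ : k ⟶ l}
    (h' : IsLam b ψ) :
    powR E h φ ≫ powL E e (ω ≫ φ) h' = powL E e φ h' ≫ powR E h (φ ≫ ψ) := by
  rw [powR, powL, reassoc_of% distribute_natural ψ, powL]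
  refine Eq.trans ?_ (Category.assoc _ _ _).symm
  refine congrArg _ ((tMap_comp _ _).trans (Eq.trans ?_ (tMap_comp _ _).symm))
  refine congrArg tMap (funext fun j => ?_)
  have := h'.sub j
  have hinj : IsInj b (Sigma.map id (fun i : Fiber ψ j => fiberMap ω φ i.1) :
      (Σ i : Fiber ψ j, Fiber (ω ≫ φ) i.1) → Σ i : Fiber ψ j, Fiber φ i.1) := by
    refine ⟨Function.injective_id.sigma_map fun i => (isInj_fiberMap h φ i.1).1, fun hb => ?_⟩
    exact Function.surjective_id.sigma_map fun i => (isInj_fiberMap h φ i.1).2 hb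
  rw [fillMap, reassoc_of% fill_natural E e (h'.ne j) _ _ _ _ hinj, fillMap]
  refine Eq.trans ?_ (Category.assoc _ _ _).symm
  refine congrArg _ (tr_res _ _ _ _ _ _ _ fun p => Fiber.ext (Option.some.inj ?_)).symm
  exact (fiberMap_spec ω (φ ≫ ψ) j (fiberComp (ω ≫ φ) ψ j p)).symm.trans
    (fiberMap_spec ω φ p.1.1 p.2)

lemma fillMap_fillMap {n k l m : FinBased false} (φ : n ⟶ k) {ψ : k ⟶ l} (h : IsLam b ψ)
    {χ : l ⟶ m} (h' : IsLam b χ) (j : Fin m.n) :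
    (tMap fun i : Fiber χ j => fillMap E e φ h i.1) ≫ fillMap E e (φ ≫ ψ) h' j =
      flatten (fun i : Fiber χ j => Fiber ψ i.1) (fun p => ev E (Fiber φ p.2.1)) ≫
        reindex (fiberComp ψ χ j) (fun i => ev E (Fiber φ i.1)) ≫
          fillMap E e φ (h.comp h') j := by
  have := h'.sub j
  have := h.sub
  have := (h.comp h').sub j
  have : Subsingleton (Σ i : Fiber χ j, Fiber ψ i.1) := (fiberComp ψ χ j).subsingleton
  have hne : b = false → Nonempty (Σ i : Fiber χ j, Fiber ψ i.1) := fun hb =>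
    (fiberComp ψ χ j).nonempty_congr.2 ((h.comp h').ne j hb)
  have hinj : IsInj b (Sigma.map id (fun i : Fiber χ j => (fiberComp φ ψ i.1).symm) :
      (Σ i : Fiber χ j, Fiber (φ ≫ ψ) i.1) → Σ i : Fiber χ j, Σ x : Fiber ψ i.1, Fiber φ x.1) :=
    ⟨Function.injective_id.sigma_map fun i => (fiberComp φ ψ i.1).symm.injective,
      fun _ => Function.surjective_id.sigma_map fun i => (fiberComp φ ψ i.1).symm.surjective⟩
  have h₁ := fill_natural E e (h'.ne j) (fun i => Fiber (φ ≫ ψ) i.1)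
    (fun i => Σ x : Fiber ψ i.1, Fiber φ x.1) (fun i => (fiberComp φ ψ i.1).symm)
    (fun i => IsInj.equiv _) hinj
  have h₂ := fill_fill E e (fun i : Fiber χ j => Fiber ψ i.1) (fun i x => Fiber φ x.1) (h'.ne j)
    (fun i => h.ne i.1) hne
  have h₃ := reindex_fill E e (fiberComp ψ χ j) hne ((h.comp h').ne j) fun i => Fiber φ i.1
  have h₄ : (tMap fun i : Fiber χ j => fillMap E e φ h i.1) =
      (tMap fun i : Fiber χ j => fill E e (h.ne i.1) fun x : Fiber ψ i.1 => Fiber φ x.1) ≫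
        tMap fun i : Fiber χ j => res E (fiberComp φ ψ i.1).symm (IsInj.equiv _) :=
    (tMap_comp _ _).symm
  have h₅ : (reindex (fiberComp ψ χ j) fun i => ev E (Fiber φ i.1)) ≫
      fillMap E e φ (h.comp h') j = (fill E e hne fun p => Fiber φ p.2.1) ≫
        tr E (Equiv.sigmaCongr (fiberComp ψ χ j) fun p => Equiv.refl (Fiber φ p.2.1)) ≫
          tr E (fiberComp φ (ψ ≫ χ) j) := by
    rw [fillMap, reassoc_of% h₃]
    rfl
  have h₆ : res E (Sigma.map id (fun i : Fiber χ j => (fiberComp φ ψ i.1).symm)) hinj =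
      tr E (Equiv.sigmaCongrRight fun i : Fiber χ j => fiberComp φ ψ i.1) := rfl
  refine Eq.trans ?_ (congrArg _ h₅.symm)
  rw [h₄]
  refine (Category.assoc _ _ _).trans ?_
  rw [fillMap, reassoc_of% h₁, reassoc_of% h₂, h₆]
  refine congrArg _ (congrArg _ ?_)
  refine (congrArg _ (tr_comp _ _ _)).trans ((tr_comp _ _ _).trans (Eq.trans ?_
    (tr_comp _ _ _).symm))
  refine congrArg (tr E) (Equiv.ext ?_)
  rintro ⟨⟨i, y⟩, x⟩
  rfl

lemma powL_comp {n k l m : FinBased false} (φ : n ⟶ k) {ψ : k ⟶ l} (h : IsLam b ψ)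
    {χ : l ⟶ m} (h' : IsLam b χ) :
    powL E e φ h ≫ powL E e (φ ≫ ψ) h' = powL E e φ (h.comp h') := by
  rw [powL, powL, Category.assoc (distribute ψ _), reassoc_of% distribute_natural χ, tMap_comp]
  simp only [fillMap_fillMap]
  have key : distribute ψ (fun j => ev E (Fiber φ j)) ≫ distribute χ _ ≫
      (tMap fun j => flatten (fun i : Fiber χ j => Fiber ψ i.1)
          (fun p => ev E (Fiber φ p.2.1)) ≫
        reindex (fiberComp ψ χ j) (fun i => ev E (Fiber φ i.1))) =
      distribute (ψ ≫ χ) fun j => ev E (Fiber φ j) := by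
    refine Str.eq (t := noDrop) (X := fun j => ev E (Fiber φ j)) (e := .all fun j => .leaf j)
      (e' := .all fun j => .all fun i : Fiber (ψ ≫ χ) j => .leaf i.1) (distribute_ok (ψ ≫ χ)).1
      (.comp (e' := .all fun j => .all fun i : Fiber ψ j => .leaf i.1) ?_ (.comp
        (e' := .all fun j => .all fun i : Fiber χ j => .all fun x : Fiber ψ i.1 => .leaf x.1)
        ?_ (.map fun j => .comp (e' := .all fun p : (Σ i : Fiber χ j, Fiber ψ i.1) => .leaf p.2.1)
          ?_ ?_))) ?_
    · exact Str.bind' .leaf (distribute_ok ψ) _ HEq.rfl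
    · exact Str.bind' (fun j => .all fun i : Fiber ψ j => .leaf i.1) (distribute_ok χ) _ HEq.rfl
    · exact Str.bind' (fun p : (Σ i : Fiber χ j, Fiber ψ i.1) => .leaf p.2.1)
        (flatten_ok fun i : Fiber χ j => Fiber ψ i.1) _ HEq.rfl
    · exact Str.bind' (fun i : Fiber (ψ ≫ χ) j => .leaf i.1) (reindex_ok (fiberComp ψ χ j)) _
        HEq.rfl
    · exact Str.bind' .leaf (distribute_ok (ψ ≫ χ)) _ HEq.rfl
  rw [powL, ← key]
  refine Eq.trans ?_ (Category.assoc _ _ _).symm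
  refine congrArg _ (Eq.trans ?_ (Category.assoc _ _ _).symm)
  refine congrArg _ (Eq.trans ?_ (tMap_comp _ _).symm)
  exact congrArg tMap (funext fun j => (Category.assoc _ _ _).symm)

lemma powL_id {n k : FinBased false} (φ : n ⟶ k) : powL E e φ (IsLam.id k) = 𝟙 _ := by
  have h : ∀ j : Fin k.n, fillMap E e φ (IsLam.id k) j =
      uniqAll (default : Fiber (𝟙 k) j) fun i : Fiber (𝟙 k) j => ev E (Fiber φ i.1) := fun j => by
    rw [fillMap, fill_of E e (default : Fiber (𝟙 k) j)]
    refine (Category.assoc _ _ _).trans ((congrArg _ ?_).trans (Category.comp_id _))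
    exact (tr_comp _ _ _).trans (tr_refl (S := Fiber φ j) E _ fun x => rfl)
  rw [powL]
  simp only [h]
  refine Str.eq (t := noDrop) (X := fun j => ev E (Fiber φ j)) (e := .all fun j => .leaf j)
    (e' := .all fun j => .leaf j) (by simp)
    (.comp (e' := .all fun j => .all fun i : Fiber (𝟙 k) j => .leaf i.1) ?_ (.map fun j => ?_)) .id
  · exact Str.bind' .leaf (distribute_ok (𝟙 k)) _ HEq.rfl
  · exact Str.bind' (fun i : Fiber (𝟙 k) j => .leaf i.1)
      (uniqAll_ok (default : Fiber (𝟙 k) j)) _ HEq.rfl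

end Power

section Kelly

variable {b : Bool} {V : Type u} [Category.{v} V] [MonoidalCategory V] [SymmetricCategory V]
  [HasColimitsOfSize.{0, 0} V]

section

variable (E : (Inj b)ᵒᵖ ⥤ V) (e : b = true → (𝟙_ V ⟶ ev E Empty))

/-- The object `E^{⊠ k}(n) = ∐_φ ⨂_j E(φ⁻¹ j)`, where `φ` runs through the maps from an
`n`-element set to a `k`-element set. -/
def powObj (n k : FinBased false) : V := ∐ fun φ : n ⟶ k => powW E φ

/-- The inclusions of the summands. -/
def powι {n k : FinBased false} (φ : n ⟶ k) : powW E φ ⟶ powObj E n k :=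
  Sigma.ι (fun φ : n ⟶ k => powW E φ) φ

/-- Morphisms out of `E^{⊠ k}(n)`. -/
def powDesc {n k : FinBased false} {Z : V} (f : ∀ φ : n ⟶ k, powW E φ ⟶ Z) : powObj E n k ⟶ Z :=
  Sigma.desc f

lemma powι_powDesc {n k : FinBased false} {Z : V} (f : ∀ φ : n ⟶ k, powW E φ ⟶ Z) (φ : n ⟶ k) :
    powι E φ ≫ powDesc E f = f φ := Sigma.ι_desc f φ

lemma powι_powDesc_assoc {n k : FinBased false} {Z W : V} (f : ∀ φ : n ⟶ k, powW E φ ⟶ Z)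
    (φ : n ⟶ k) (g : Z ⟶ W) : powι E φ ≫ powDesc E f ≫ g = f φ ≫ g := by
  rw [← Category.assoc, powι_powDesc]

lemma pow_ext {n k : FinBased false} {Z : V} {f g : powObj E n k ⟶ Z}
    (h : ∀ φ, powι E φ ≫ f = powι E φ ≫ g) : f = g := Sigma.hom_ext _ _ h

/-- The contravariant functoriality of `E^{⊠ k}(n)` in `n`. -/
def powRes {m n : FinBased false} {ω : m ⟶ n} (h : IsLam b ω) (k : FinBased false) :
    powObj E n k ⟶ powObj E m k :=
  powDesc E fun φ => powR E h φ ≫ powι E (ω ≫ φ)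

/-- The covariant functoriality of `E^{⊠ k}(n)` in `k`. -/
def powPush (n : FinBased false) {k l : FinBased false} {ψ : k ⟶ l} (h : IsLam b ψ) :
    powObj E n k ⟶ powObj E n l :=
  powDesc E fun φ => powL E e φ h ≫ powι E (φ ≫ ψ)

lemma powRes_id (n k : FinBased false) : powRes E (IsLam.id n) k = 𝟙 _ :=
  pow_ext E fun φ => by
    rw [powRes, powι_powDesc, powR_id]
    exact (Category.id_comp _).trans (Category.comp_id _).symm

lemma powRes_comp {l m n : FinBased false} {ω : l ⟶ m} (h : IsLam b ω) {ω' : m ⟶ n}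
    (h' : IsLam b ω') (k : FinBased false) :
    powRes E h' k ≫ powRes E h k = powRes E (h.comp h') k :=
  pow_ext E fun φ => by
    rw [powRes, powι_powDesc_assoc, powRes, Category.assoc, powι_powDesc, powRes, powι_powDesc,
      ← powR_comp]
    exact (Category.assoc _ _ _).symm

lemma powPush_id (n k : FinBased false) : powPush E e n (IsLam.id k) = 𝟙 _ :=
  pow_ext E fun φ => by
    rw [powPush, powι_powDesc, powL_id]
    exact (Category.id_comp _).trans (Category.comp_id _).symm

lemma powPush_comp (n : FinBased false) {k l m : FinBased false} {ψ : k ⟶ l} (h : IsLam b ψ)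
    {χ : l ⟶ m} (h' : IsLam b χ) :
    powPush E e n h ≫ powPush E e n h' = powPush E e n (h.comp h') :=
  pow_ext E fun φ => by
    rw [powPush, powι_powDesc_assoc, powPush, Category.assoc, powι_powDesc, powPush, powι_powDesc,
      ← powL_comp]
    exact (Category.assoc _ _ _).symm

lemma powRes_powPush {m n : FinBased false} {ω : m ⟶ n} (h : IsLam b ω) {k l : FinBased false}
    {ψ : k ⟶ l} (h' : IsLam b ψ) :
    powRes E h k ≫ powPush E e m h' = powPush E e n h' ≫ powRes E h l :=
  pow_ext E fun φ => by
    rw [powRes, powι_powDesc_assoc, powPush, Category.assoc, powι_powDesc, powPush,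
      powι_powDesc_assoc, powRes, Category.assoc (powL E e φ h'), powι_powDesc]
    exact (Category.assoc _ _ _).symm.trans ((congrArg (· ≫ _) (powR_powL E e h φ h')).trans
      (Category.assoc _ _ _))

/-- The object with `n` non-base points. -/
abbrev Inj.fin (n : Inj b) : FinBased false := ⟨n.n⟩

/-- The functor `k ↦ E^{⊠ k}(n)`. -/
def powF (n : Inj b) : Inj b ⥤ V where
  obj k := powObj E n.fin k.fin
  map f := powPush E e n.fin (IsLam.based f)
  map_id k := by
    rw [← powPush_id E e n.fin k.fin]
    congr 1
    exact Inj.based_id k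
  map_comp f g := by
    rw [powPush_comp]
    congr 1
    exact Inj.based_comp f g

/-- The functoriality of `powF` in `n`. -/
def powFMap {m n : Inj b} (g : m ⟶ n) : powF E e n ⟶ powF E e m where
  app k := powRes E (IsLam.based g) k.fin
  naturality _ _ f := (powRes_powPush E e (IsLam.based g) (IsLam.based f)).symm

variable (D : (Inj b)ᵒᵖ ⥤ V)

/-- The Kelly product `D ⊙ E`, with `(D ⊙ E)(n) = ∫^k D(k) ⊗ E^{⊠ k}(n)`, of a sequence `D` and
a sequence `E`, where for `b = true` the sequence `E` has a base map. -/
def kelly : (Inj b)ᵒᵖ ⥤ V where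
  obj n := coT D (powF E e n.unop)
  map g := coMap (𝟙 D) (powFMap E e g.unop)
  map_id n := by
    rw [← coMap_id]
    congr 1
    ext k
    refine Eq.trans ?_ (powRes_id E n.unop.fin k.fin)
    change powRes E (IsLam.based (𝟙 n.unop)) k.fin = _
    congr 1
    exact Inj.based_id _
  map_comp f g := by
    rw [coMap_comp, Category.comp_id]
    congr 1
    ext k
    refine Eq.trans ?_ (powRes_comp E (IsLam.based g.unop) (IsLam.based f.unop) k.fin).symm
    change powRes E (IsLam.based (g.unop ≫ f.unop)) k.fin = _
    congr 1
    exact Inj.based_comp _ _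

end

end Kelly


/-! ### Based operads as monoids for the Kelly product -/

section Cut

variable {V : Type u} [Category.{v} V] [MonoidalCategory V] [SymmetricCategory V]

lemma unitRightInv_ok (T : Type) [Finite T] :
    Ok false (.leaf ()) (.tens (.leaf ()) (.all fun _ : T => .one)) := by
  refine .mk ?_ ?_ ?_ ?_ <;> simp [Ex.labels, nodup_flatMap_enum]

/-- The canonical isomorphism `A ≅ A ⊗ ⨂_{t : T} 𝟙`. -/
def unitRightInv (A : V) (T : Type) [Finite T] : A ⟶ A ⊗ tAll (fun _ : T => 𝟙_ V) :=
  can noDrop (fun _ : Unit => A) (unitRightInv_ok T)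

lemma unitRightInv_natural {A B : V} (f : A ⟶ B) (T : Type) [Finite T] :
    f ≫ unitRightInv B T = unitRightInv A T ≫ (f ⊗ₘ 𝟙 _) := by
  rw [← tMap_id]
  exact can_bind noDrop .leaf (fun _ => f) (unitRightInv_ok T) (unitRightInv_ok T)

lemma unitRightInv_unitRight (A : V) (T : Type) [Finite T] :
    unitRightInv A T ≫ unitRight A T = 𝟙 A :=
  (can_comp noDrop _ (unitRightInv_ok T) (unitRight_ok T)).trans (can_refl _ _ _)

lemma unitRightInv_natural_assoc {A B Z : V} (f : A ⟶ B) (T : Type) [Finite T]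
    (g : B ⊗ tAll (fun _ : T => 𝟙_ V) ⟶ Z) :
    f ≫ unitRightInv B T ≫ g = unitRightInv A T ≫ (f ⊗ₘ 𝟙 _) ≫ g := by
  rw [← Category.assoc, unitRightInv_natural, Category.assoc]

lemma unitRightInv_reindex {T T' : Type} [Finite T] [Finite T'] (e : T ≃ T') (A : V) :
    unitRightInv A T ≫ (𝟙 _ ⊗ₘ reindex e fun _ => 𝟙_ V) = unitRightInv A T' := by
  refine Str.eq (t := noDrop) (X := fun _ : Unit => A) (e := .leaf ())
    (e' := .tens (.leaf ()) (.all fun _ : T' => .one)) (by simp)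
    (.comp (e' := .tens (.leaf ()) (.all fun _ : T => .one)) ?_ (.tens .id ?_)) ?_
  · exact Str.bind' .leaf (unitRightInv_ok T) _ HEq.rfl
  · exact Str.bind' (fun _ => .one) (reindex_ok e) _ HEq.rfl
  · exact Str.bind' .leaf (unitRightInv_ok T') _ HEq.rfl

lemma unitRightInv_regroup {T : Type} [Finite T] (S : T → Type) [∀ t, Finite (S t)] (A : V)
    (B : T → V) :
    (𝟙 A ⊗ₘ tMap fun t => unitRightInv (B t) (S t)) ≫ regroup S A B (fun _ => 𝟙_ V) =
      unitRightInv (A ⊗ tAll B) (Σ t, S t) := by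
  let L : T → Ex (Unit ⊕ T) := fun t => .leaf (.inr t)
  have hn : (Ex.tens (.leaf (.inl ())) (.all L)).labels.Nodup := by simp [L, nodup_flatMap_enum]
  refine Str.eq (t := noDrop) (X := Sum.elim (fun _ : Unit => A) B)
    (e := .tens (.leaf (.inl ())) (.all L))
    (e' := .tens (.tens (.leaf (.inl ())) (.all L)) (.all fun _ : (Σ t, S t) => .one)) hn
    (.comp (e' := .tens (.leaf (.inl ())) (.all fun t => .tens (L t) (.all fun _ : S t => .one)))
      (.tens .id (.map fun t => ?_)) ?_) ?_
  · exact Str.bind' (V := V) (t := noDrop) (X := Sum.elim (fun _ : Unit => A) B) (fun _ => L t)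
      (unitRightInv_ok (S t)) _ HEq.rfl
  · refine Str.bind' (V := V) (t := noDrop) (X := Sum.elim (fun _ : Unit => A) B)
      (Sum.elim (fun _ => .leaf (.inl ())) (Sum.elim L fun _ => .one)) (regroup_ok S) _ ?_
    refine can_heq noDrop ?_ _
    rintro (_ | _ | _) <;> rfl
  · exact Str.bind' (V := V) (t := noDrop) (X := Sum.elim (fun _ : Unit => A) B)
      (fun _ => .tens (.leaf (.inl ())) (.all L)) (unitRightInv_ok (Σ t, S t)) _
      HEq.rfl

namespace BasedOperad

variable (C : BasedOperad V)

/-- The insertion of units and base points. -/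
def cut {T : Type} [Finite T] (P : T → Type) [∀ t, Finite (P t)] [∀ t, Subsingleton (P t)] :
    ev C.seq T ⟶ ev C.seq (Σ t, P t) :=
  unitRightInv _ T ≫ (𝟙 _ ⊗ₘ tMap fun t => C.pt (P t)) ≫ C.γ P

lemma cut_unique {T : Type} [Finite T] (P : T → Type) [∀ t, Unique (P t)] :
    C.cut P ≫ tr C.seq (Equiv.sigmaUnique T P) = 𝟙 _ := by
  rw [cut, Category.assoc, Category.assoc, γ_pt_right, unitRightInv_unitRight]

lemma cut_tr {T : Type} [Finite T] (P P' : T → Type) [∀ t, Finite (P t)] [∀ t, Subsingleton (P t)]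
    [∀ t, Finite (P' t)] [∀ t, Subsingleton (P' t)] (e : ∀ t, P t ≃ P' t) :
    C.cut P ≫ tr C.seq (Equiv.sigmaCongr (Equiv.refl T) e) = C.cut P' := by
  have h : (tMap fun t => C.pt (P' t)) = (tMap fun t => C.pt (P t)) ≫ tMap fun t => tr C.seq (e t) := by
    rw [tMap_comp]
    simp only [pt_tr]
  rw [cut, cut, Category.assoc, Category.assoc, ← C.equivariance_right, h,
    tensorHom_comp_tensorHom_assoc, Category.comp_id]

lemma tr_cut {T T' : Type} [Finite T] [Finite T'] (e : T ≃ T') (P : T' → Type) [∀ t, Finite (P t)]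
    [∀ t, Subsingleton (P t)] :
    tr C.seq e ≫ C.cut P = C.cut (fun t => P (e t)) ≫
      tr C.seq (Equiv.sigmaCongr e fun t => Equiv.refl (P (e t))) := by
  have h₁ := C.equivariance_left e P
  have h₂ := reindex_natural e fun t => C.pt (P t)
  have h₃ := unitRightInv_reindex e (ev C.seq T)
  rw [cut, cut, reassoc_of% unitRightInv_natural, Category.assoc, Category.assoc, ← h₁,
    tensorHom_comp_tensorHom_assoc, tensorHom_comp_tensorHom_assoc, h₂, ← h₃, Category.assoc,
    tensorHom_comp_tensorHom_assoc]
  simp only [Category.id_comp, Category.comp_id]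

lemma γ_cut {T : Type} [Finite T] (S : T → Type) [∀ t, Finite (S t)] (P : ∀ t, S t → Type)
    [∀ t s, Finite (P t s)] [∀ t s, Subsingleton (P t s)] :
    (𝟙 _ ⊗ₘ tMap fun t => C.cut (P t)) ≫ C.γ (fun t => Σ s, P t s) =
      C.γ S ≫ C.cut (fun p : (Σ t, S t) => P p.1 p.2) ≫ tr C.seq (Equiv.sigmaAssoc P) := by
  have h₁ : (tMap fun t => C.cut (P t)) = (tMap fun t => unitRightInv (ev C.seq (S t)) (S t)) ≫
      (tMap fun t => 𝟙 _ ⊗ₘ tMap fun s => C.pt (P t s)) ≫ tMap fun t => C.γ (P t) := by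
    rw [tMap_comp, tMap_comp]
    rfl
  have h₂ := regroup_natural S (𝟙 (ev C.seq T)) (fun t => 𝟙 (ev C.seq (S t)))
    fun p : (Σ t, S t) => C.pt (P p.1 p.2)
  have h₃ := C.assoc S P
  have h₄ : (𝟙 (ev C.seq T) ⊗ₘ tMap fun t => C.cut (P t)) =
      (𝟙 _ ⊗ₘ tMap fun t => unitRightInv (ev C.seq (S t)) (S t)) ≫
      (𝟙 _ ⊗ₘ tMap fun t => 𝟙 _ ⊗ₘ tMap fun s => C.pt (P t s)) ≫
        (𝟙 _ ⊗ₘ tMap fun t => C.γ (P t)) := by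
    rw [tensorHom_comp_tensorHom, tensorHom_comp_tensorHom, Category.comp_id, Category.comp_id, h₁]
  have h₅ := unitRightInv_regroup S (ev C.seq T) fun t => ev C.seq (S t)
  rw [h₄, Category.assoc, Category.assoc, h₃, reassoc_of% h₂, reassoc_of% h₅, cut,
    Category.assoc, Category.assoc, unitRightInv_natural_assoc, tensorHom_comp_tensorHom_assoc,
    tensorHom_comp_tensorHom_assoc, tMap_id, id_tensorHom_id]
  simp only [Category.id_comp, Category.comp_id]

lemma cut_cut {T : Type} [Finite T] (P : T → Type) [∀ t, Finite (P t)] [∀ t, Subsingleton (P t)]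
    (Q : ∀ t, P t → Type) [∀ t p, Finite (Q t p)] [∀ t p, Subsingleton (Q t p)]
    [∀ t, Subsingleton (Σ p, Q t p)] :
    C.cut P ≫ C.cut (fun p : (Σ t, P t) => Q p.1 p.2) ≫ tr C.seq (Equiv.sigmaAssoc Q) =
      C.cut fun t => Σ p, Q t p := by
  have h : ∀ t, C.pt (P t) ≫ C.cut (Q t) = C.pt (Σ p, Q t p) := fun t => by
    rw [cut, unitRightInv_natural_assoc, tensorHom_comp_tensorHom_assoc, Category.comp_id,
      Category.id_comp, γ_pt, ← Category.assoc, unitRightInv_unitRight, Category.id_comp]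
  rw [cut, Category.assoc, Category.assoc, ← C.γ_cut P Q, tensorHom_comp_tensorHom_assoc, tMap_comp,
    Category.comp_id, cut]
  simp only [h]

end BasedOperad

end Cut

section Pull

variable {V : Type u} [Category.{v} V] [MonoidalCategory V] [SymmetricCategory V]

lemma subsingleton_fiber {S T : Type} {f : S → T} (hf : Function.Injective f) (t : T) :
    Subsingleton {s // f s = t} :=
  ⟨fun x y => Subtype.ext (hf (x.2.trans y.2.symm))⟩

namespace BasedOperad

variable (C : BasedOperad V)

/-- The contravariant functoriality of a based operad for injections: base points are inserted at
the elements that are not in the image, and units at the elements in the image. -/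
def pull {S T : Type} [Finite S] [Finite T] (f : S → T) (hf : Function.Injective f) :
    ev C.seq T ⟶ ev C.seq S :=
  have := subsingleton_fiber hf
  C.cut (fun t => {s // f s = t}) ≫ tr C.seq (Equiv.sigmaFiberEquiv f)

lemma cut_tr_eq_pull {S T : Type} [Finite S] [Finite T] (f : S → T) (hf : Function.Injective f)
    (P : T → Type) [∀ t, Finite (P t)] [∀ t, Subsingleton (P t)] (g : (Σ t, P t) ≃ S)
    (h : ∀ p, f (g p) = p.1) : C.cut P ≫ tr C.seq g = C.pull f hf := by
  have := subsingleton_fiber hf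
  let e : ∀ t, P t ≃ {s // f s = t} := fun t =>
    Equiv.ofBijective (fun p => ⟨g ⟨t, p⟩, h _⟩) <| by
      refine ⟨fun _ _ _ => Subsingleton.elim _ _, fun s => ?_⟩
      have hs : (g.symm s.1).1 = t := by rw [← h, Equiv.apply_symm_apply, s.2]
      exact ⟨hs ▸ (g.symm s.1).2, Subsingleton.elim _ _⟩
  rw [pull, ← C.cut_tr P _ e, Category.assoc, tr_comp]
  refine congrArg _ (congrArg _ (Equiv.ext fun p => rfl))

lemma pull_equiv {S T : Type} [Finite S] [Finite T] (e : S ≃ T) :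
    C.pull e e.injective = tr C.seq e.symm := by
  rw [← C.cut_tr_eq_pull e e.injective (fun _ => Unit) ((Equiv.sigmaUnique T _).trans e.symm)
    fun p => e.apply_symm_apply _, ← tr_comp, ← Category.assoc, cut_unique, Category.id_comp]

lemma pull_comp {S T U : Type} [Finite S] [Finite T] [Finite U] (f : S → T)
    (hf : Function.Injective f) (g : T → U) (hg : Function.Injective g) :
    C.pull g hg ≫ C.pull f hf = C.pull (g ∘ f) (hg.comp hf) := by
  have := subsingleton_fiber hf
  have := subsingleton_fiber hg
  have : ∀ u, Subsingleton (Σ t : {t // g t = u}, {s // f s = t.1}) := fun u => by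
    constructor
    rintro ⟨t, s⟩ ⟨t', s'⟩
    obtain rfl := Subsingleton.elim t t'
    obtain rfl := Subsingleton.elim s s'
    rfl
  have h := C.cut_cut (fun u => {t // g t = u}) (fun u t => {s // f s = t.1})
  have h' := C.tr_cut (Equiv.sigmaFiberEquiv g) fun t => {s // f s = t}
  rw [pull, pull, Category.assoc, reassoc_of% h', tr_comp]
  have h₁ := C.cut_tr_eq_pull (g ∘ f) (hg.comp hf)
    (fun u => Σ t : {t // g t = u}, {s // f s = t.1})
    ((Equiv.sigmaAssoc fun u (t : {t // g t = u}) => {s // f s = t.1}).symm.trans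
      ((Equiv.sigmaCongr (Equiv.sigmaFiberEquiv g) fun t => Equiv.refl _).trans
        (Equiv.sigmaFiberEquiv f)))
    fun p => (congrArg g p.2.2.2).trans p.2.1.2
  rw [← h₁, ← h, Category.assoc, Category.assoc, tr_comp]
  exact congrArg _ (congrArg _ (congrArg _ (Equiv.ext fun p => rfl)))

variable (b : Bool) in
/-- The underlying sequence of a based operad: for `b = true` with its contravariant functoriality
for all based injections, for `b = false` only with the action of the symmetric groups. -/
def lamSeq : (Inj b)ᵒᵖ ⥤ V where
  obj n := C.seq.obj (op ⟨n.unop.n⟩)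
  map {n m} g := C.seq.map (Inj.toFin ⟨n.unop.n⟩).op ≫ C.pull g.unop.1 g.unop.2.1 ≫
    C.seq.map (Inj.ofFin ⟨m.unop.n⟩).op
  map_id n := by
    have h : C.pull (S := Fin n.unop.n) id Function.injective_id = 𝟙 _ :=
      (C.pull_equiv (Equiv.refl _)).trans (tr_refl _ _ fun _ => rfl)
    refine (congrArg (fun f => C.seq.map (Inj.toFin ⟨n.unop.n⟩).op ≫ f ≫
      C.seq.map (Inj.ofFin ⟨n.unop.n⟩).op) h).trans ?_
    rw [Category.id_comp, ← C.seq.map_comp, ← op_comp, ← C.seq.map_id, ← op_id]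
    exact congrArg (fun f => C.seq.map (Quiver.Hom.op f))
      (Subtype.ext (funext fun x => Equiv.symm_apply_apply _ _))
  map_comp {n m l} g g' := by
    have h : C.seq.map (Inj.ofFin ⟨m.unop.n⟩).op ≫ C.seq.map (Inj.toFin ⟨m.unop.n⟩).op = 𝟙 _ := by
      rw [← C.seq.map_comp, ← op_comp, ← C.seq.map_id, ← op_id]
      exact congrArg (fun f => C.seq.map (Quiver.Hom.op f))
        (Subtype.ext (funext fun x => Equiv.apply_symm_apply _ _))
    have h' := C.pull_comp g'.unop.1 g'.unop.2.1 g.unop.1 g.unop.2.1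
    rw [Category.assoc, Category.assoc, reassoc_of% h, reassoc_of% h']
    rfl

end BasedOperad

variable (b : Bool) in
/-- The inclusion of `Σ` in `Λ` (for `b = true`). -/
def Inj.incl : Inj false ⥤ Inj b where
  obj n := ⟨n.n⟩
  map f := ⟨f.1, f.2.1, fun _ => f.2.2 rfl⟩

lemma BasedOperad.incl_lamSeq (C : BasedOperad V) (b : Bool) :
    (Inj.incl b).op ⋙ C.lamSeq b = C.seq := by
  refine CategoryTheory.Functor.ext (fun n => rfl) fun n m g => ?_
  refine Eq.trans ?_ ((Category.id_comp _).trans (Category.comp_id _)).symm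
  let e := Equiv.ofBijective g.unop.1 ⟨g.unop.2.1, g.unop.2.2 rfl⟩
  change C.seq.map (Inj.toFin n.unop).op ≫ C.pull e e.injective ≫
    C.seq.map (Inj.ofFin m.unop).op = C.seq.map g
  rw [C.pull_equiv, tr, res, ← C.seq.map_comp, ← C.seq.map_comp, ← op_comp, ← op_comp]
  refine congrArg C.seq.map (Quiver.Hom.unop_inj (Subtype.ext (funext fun x => ?_)))
  change (Finite.equivFin (Fin n.unop.n)).symm (Finite.equivFin (Fin n.unop.n) (e
    ((Finite.equivFin (Fin m.unop.n)).symm (Finite.equivFin (Fin m.unop.n) x)))) = g.unop.1 x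
  rw [Equiv.symm_apply_apply, Equiv.symm_apply_apply]
  rfl

end Pull

section Modules

variable {V : Type u} [Category.{v} V] [MonoidalCategory V] [SymmetricCategory V]
  [HasColimitsOfSize.{0, 0} V] {b : Bool}

namespace BasedOperad

variable (C : BasedOperad V)

/-- The Kelly product `D ⊙ C` of a sequence and a based operad, formed over `Λ` for `b = true`
and over `Σ` for `b = false`. -/
abbrev kellyRight (D : (Inj b)ᵒᵖ ⥤ V) : (Inj b)ᵒᵖ ⥤ V := kelly (C.lamSeq b) (fun _ => C.base) D

/-- The canonical morphism `D(k) ⊗ ⨂_j C(φ⁻¹ j) ⟶ (D ⊙ C)(n)` for a map `φ` from an `n`-element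
set to a `k`-element set. -/
def kellyι (D : (Inj b)ᵒᵖ ⥤ V) {n k : Inj b} (φ : n.fin ⟶ k.fin) :
    D.obj (op k) ⊗ C.comp φ ⟶ (C.kellyRight D).obj (op n) :=
  D.obj (op k) ◁ powι (C.lamSeq b) φ ≫ coι D (powF (C.lamSeq b) (fun _ => C.base) n) k

/-- The functoriality of the Kelly product in the left factor. -/
def kellyMap {D D' : (Inj b)ᵒᵖ ⥤ V} (f : D ⟶ D') : C.kellyRight D ⟶ C.kellyRight D' where
  app _ := coMap f (𝟙 _)
  naturality m n g := by
    change coMap (𝟙 D) (powFMap _ _ g.unop) ≫ coMap f (𝟙 _) =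
      coMap f (𝟙 _) ≫ coMap (𝟙 D') (powFMap _ _ g.unop)
    rw [coMap_comp, coMap_comp, Category.comp_id, Category.id_comp, Category.comp_id,
      Category.id_comp]

lemma kellyMap_id (D : (Inj b)ᵒᵖ ⥤ V) : C.kellyMap (𝟙 D) = 𝟙 _ := by
  ext n
  exact coMap_id _ _

lemma kellyMap_comp {D D' D'' : (Inj b)ᵒᵖ ⥤ V} (f : D ⟶ D') (g : D' ⟶ D'') :
    C.kellyMap (f ≫ g) = C.kellyMap f ≫ C.kellyMap g := by
  ext n
  exact ((coMap_comp f g _ _).trans (congrArg (coMap _) (Category.id_comp _))).symm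

end BasedOperad

variable (b) in
/-- The right modules over a based operad `C`, in the category of sequences with the Kelly product:
over `Λ` for `b = true` and over `Σ` for `b = false`. -/
structure RMod (C : BasedOperad V) where
  /-- the underlying sequence -/
  D : (Inj b)ᵒᵖ ⥤ V
  /-- the action `D ⊙ C ⟶ D` -/
  act : C.kellyRight D ⟶ D
  /-- The action of the unit of `C` is the identity. -/
  unit (n : Inj b) : (ρ_ _).inv ≫ D.obj (op n) ◁ C.ptAll (𝟙 n.fin) ≫ C.kellyι D (𝟙 n.fin) ≫
    act.app (op n) = 𝟙 _
  /-- The two morphisms `(D ⊙ C) ⊙ C ≅ D ⊙ (C ⊙ C) ⟶ D` agree: on the summand of two maps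
  `ψ : n ⟶ p` and `φ : p ⟶ k`, the first is given by acting twice, and the second by applying
  the structure maps `C(φ⁻¹ j) ⊗ ⨂_{φ i = j} C(ψ⁻¹ i) ⟶ C((ψ ≫ φ)⁻¹ j)` of the operad for
  every `j` and then acting. -/
  assoc {n p k : Inj b} (ψ : n.fin ⟶ p.fin) (φ : p.fin ⟶ k.fin) :
    C.kellyι D φ ▷ C.comp ψ ≫ C.kellyι (C.kellyRight D) ψ ≫ (C.kellyMap act ≫ act).app (op n) =
      (α_ _ _ _).hom ≫ D.obj (op k) ◁ ((β_ _ _).hom ≫ shuffle noDrop φ _ _ ≫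
        tMap fun j => C.γFiber ψ φ j) ≫ C.kellyι D (ψ ≫ φ) ≫ act.app (op n)

namespace RMod

variable {C : BasedOperad V}

/-- The morphisms of right modules. -/
@[ext]
structure Hom (M N : RMod b C) where
  /-- the underlying morphism of sequences -/
  hom : M.D ⟶ N.D
  act : M.act ≫ hom = C.kellyMap hom ≫ N.act

instance : Category (RMod b C) where
  Hom := Hom
  id M := ⟨𝟙 _, by rw [BasedOperad.kellyMap_id, Category.comp_id, Category.id_comp]⟩
  comp f g := ⟨f.hom ≫ g.hom, by
    rw [BasedOperad.kellyMap_comp, Category.assoc, ← g.act, reassoc_of% f.act]⟩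
  id_comp f := Hom.ext (Category.id_comp _)
  comp_id f := Hom.ext (Category.comp_id _)
  assoc f g h := Hom.ext (Category.assoc _ _ _)

variable (b C) in
/-- The underlying sequence of a module. -/
def forget : RMod b C ⥤ (Inj b)ᵒᵖ ⥤ V where
  obj M := M.D
  map f := f.hom

end RMod

end Modules

section Forget

variable {V : Type u} [Category.{v} V] [MonoidalCategory V] [SymmetricCategory V]
  [MonoidalClosed V]

open scoped MonoidalClosed

lemma curry'_comp_pre {X Y Z : V} (f : X ⟶ Y) (g : Y ⟶ Z) :
    MonoidalClosed.curry' (f ≫ g) = MonoidalClosed.curry' g ≫ (MonoidalClosed.pre f).app Z := by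
  rw [MonoidalClosed.curry'_comp, tensorHom_def'_assoc, MonoidalClosed.curry'_whiskerRight_comp,
    ← leftUnitor_inv_naturality_assoc, Iso.inv_hom_id_assoc]

namespace Presheaf

variable {E : Type} [EnrichedCategory V E] {I : Type} [Category.{0} I]

/-- The restriction of an enriched presheaf along a functor to the underlying category. -/
def restr (J : I ⥤ ForgetEnrichment V E) : Presheaf V E ⥤ Iᵒᵖ ⥤ V where
  obj F := J.op ⋙ forgetEnrichmentOppositeEquivalence.inverse V E ⋙ F.fct.forget ⋙
    ForgetEnrichment.equivFunctor V V
  map {F G} f :=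
    { app := fun n => f.app (op (J.obj n.unop))
      naturality := fun n m g => by
        let x : 𝟙_ V ⟶ EnrichedCategory.Hom (V := V) (C := Eᵒᵖ) (op (J.obj n.unop))
          (op (J.obj m.unop)) := J.map g.unop
        change MonoidalClosed.uncurry' (x ≫ F.fct.map _ _) ≫ f.app _ =
          f.app _ ≫ MonoidalClosed.uncurry' (x ≫ G.fct.map _ _)
        have h := congrArg (x ≫ ·) (f.naturality (op (J.obj n.unop)) (op (J.obj m.unop)))
        refine MonoidalClosed.curry'_injective ?_
        rw [← MonoidalClosed.curry'_ihom_map, MonoidalClosed.curry'_uncurry', curry'_comp_pre,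
          MonoidalClosed.curry'_uncurry', Category.assoc, Category.assoc]
        exact h }
  map_id _ := rfl
  map_comp _ _ := rfl

end Presheaf

end Forget

section Names

variable {V : Type u} [Category.{v} V]

/-- The permutative envelope `C̄` of a based operad, with the objects `{0, 1, …, n}` and with
`C̄(n, m) = C^{⊠ m}(n) = ∐_φ ⨂_j C(φ⁻¹ j)`, where `φ` runs through the based maps
`{0, …, n} → {0, …, m}` with `φ⁻¹(0) = {0}`. -/
abbrev BasedOperad.Envelope [MonoidalCategory V] [SymmetricCategory V] [MonoidalClosed V]
    [HasColimitsOfSize.{0, 0} V] (C : BasedOperad V) : Type :=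
  C.Env (b := false) noDrop

/-- The category of operators `Ĉ` of a based operad in a cartesian monoidal category, with the
objects `{0, 1, …, n}` and with `Ĉ(n, m) = ∐_φ ⨂_j C(φ⁻¹ j)`, where `φ` runs through all the based
maps `{0, …, n} → {0, …, m}`. -/
abbrev BasedOperad.Operators [CartesianMonoidalCategory V] [SymmetricCategory V] [MonoidalClosed V]
    [HasColimitsOfSize.{0, 0} V] (C : BasedOperad V) : Type :=
  C.Env (b := true) fun _ => CartesianMonoidalCategory.isTerminalTensorUnit

end Names

end

end OperadModules

open OperadModules

/-!
All the categories in question are compared with one auxiliary category. Let `E` be the permutative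
envelope or the category of operators of a based operad `C`, and `J` the functor from `Σ` or `Λ` to
the underlying category of `E`. A `HomAction` along `J` is a functor `D` on `Σᵒᵖ` or `Λᵒᵖ` with
morphisms `D k ⊗ E(n, k) ⟶ D n` that are associative and such that acting with the element `J g` is
`D g`. The other categories are obtained from this one by universal properties:

* An enriched presheaf is given by the transposes `F k ⟶ [E(n, k), F n]` of such an action. The
  functor `D` is then determined by the action, because `J` is the identity on objects
  (`Presheaf.toHomAction`).
* The action morphisms are dinatural in `k`, hence are the same as a morphism
  `∫^k D k ⊗ E(n, k) ⟶ D n`, and associativity may be tested on the summands of the iterated coend;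
  this is an algebra over the monad of `E` (`HomAction.toAlgebra`).
* For the permutative envelope, the power `C^{⊠ k}(n)` is `E(n, k)` by definition. Its two
  functorialities, which are given by inserting base points and identities in the tensor factors,
  are composition with the elements `J g` in `E`, by the unit laws of the operad
  (`BasedOperad.powR_lamSeq`, `BasedOperad.powL_lamSeq`). Hence the Kelly product `D ⊙ C` is the
  coend above, and an action is the same as a right module (`HomAction.toRMod`).

Each of the three comparison functors keeps the underlying functor `D`, is fully faithful, and is
bijective on objects, so that it is an isomorphism of categories. Equality of two objects is the
main point: it is reduced to the equality of the structure morphisms by the uniqueness part of the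
respective universal property.
-/

namespace OperadModules

noncomputable section

/-! ### Actions of the morphism objects of an enriched category -/

section HomAction

variable {V : Type u} [Category.{v} V] [MonoidalCategory V] {A : Type} [Category.{v} A]
  [EnrichedOrdinaryCategory V A] {Ξ : Type} [Category.{0} Ξ]

variable (V) in
/-- A functor `D : Ξᵒᵖ ⥤ V` with an associative action of the morphism objects `A(J k, J n)` of
an enriched category, which extends the functoriality of `D`. The unit law is the case `g = 𝟙` of
`act_hom`. -/
@[ext]
structure HomAction (J : Ξᵒᵖ ⥤ A) where
  /-- the underlying functor -/
  D : Ξᵒᵖ ⥤ V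
  /-- the action -/
  act (k n : Ξ) : D.obj (op k) ⊗ (J.obj (op k) ⟶[V] J.obj (op n)) ⟶ D.obj (op n)
  act_act (k p n : Ξ) : act k p ▷ (J.obj (op p) ⟶[V] J.obj (op n)) ≫ act p n =
    (α_ _ _ _).hom ≫ D.obj (op k) ◁ eComp V (J.obj (op k)) (J.obj (op p)) (J.obj (op n)) ≫
      act k n
  act_hom {k n : Ξ} (g : n ⟶ k) :
    (ρ_ _).inv ≫ D.obj (op k) ◁ eHomEquiv V (J.map g.op) ≫ act k n = D.map g.op

namespace HomAction

variable {J : Ξᵒᵖ ⥤ A}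

lemma map_act (M : HomAction V J) {k m : Ξ} (g : k ⟶ m) (n : Ξ) :
    M.D.map g.op ▷ (J.obj (op k) ⟶[V] J.obj (op n)) ≫ M.act k n =
      M.D.obj (op m) ◁ eHomWhiskerRight V (J.map g.op) (J.obj (op n)) ≫ M.act m n := by
  rw [← M.act_hom g]
  simp only [comp_whiskerRight, Category.assoc, M.act_act, eHomWhiskerRight,
    MonoidalCategory.whiskerLeft_comp]
  rw [associator_naturality_middle_assoc, ← triangle_assoc_comp_left_inv_assoc,
    Iso.inv_hom_id_assoc]

lemma act_map (M : HomAction V J) (k : Ξ) {n n' : Ξ} (g : n' ⟶ n) :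
    M.act k n ≫ M.D.map g.op =
      M.D.obj (op k) ◁ eHomWhiskerLeft V (J.obj (op k)) (J.map g.op) ≫ M.act k n' := by
  rw [← M.act_hom g, rightUnitor_inv_naturality_assoc, ← whisker_exchange_assoc, M.act_act]
  simp only [eHomWhiskerLeft, MonoidalCategory.whiskerLeft_comp, Category.assoc]
  rw [associator_naturality_right_assoc]
  simp

lemma act_id (M : HomAction V J) (n : Ξ) :
    (ρ_ _).inv ≫ M.D.obj (op n) ◁ eId V (J.obj (op n)) ≫ M.act n n = 𝟙 _ := by
  have h := M.act_hom (𝟙 n)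
  rwa [op_id, J.map_id, eHomEquiv_id, M.D.map_id] at h

/-- An associative and unital action that is natural in the second variable extends the
functoriality of `D`. -/
lemma act_hom_of_act_map {D : Ξᵒᵖ ⥤ V}
    (act : ∀ k n : Ξ, D.obj (op k) ⊗ (J.obj (op k) ⟶[V] J.obj (op n)) ⟶ D.obj (op n))
    (h : ∀ n, (ρ_ _).inv ≫ D.obj (op n) ◁ eId V (J.obj (op n)) ≫ act n n = 𝟙 _)
    (h' : ∀ k {n n' : Ξ} (g : n' ⟶ n), act k n ≫ D.map g.op =
      D.obj (op k) ◁ eHomWhiskerLeft V (J.obj (op k)) (J.map g.op) ≫ act k n')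
    {k n : Ξ} (g : n ⟶ k) :
    (ρ_ _).inv ≫ D.obj (op k) ◁ eHomEquiv V (J.map g.op) ≫ act k n = D.map g.op := by
  have h₁ : eId V (J.obj (op k)) ≫ eHomWhiskerLeft V (J.obj (op k)) (J.map g.op) =
      eHomEquiv V (J.map g.op) := by
    rw [eHomWhiskerLeft, rightUnitor_inv_naturality_assoc, ← whisker_exchange_assoc,
      ← unitors_inv_equal, ← leftUnitor_inv_naturality_assoc, e_id_comp, Category.comp_id]
  -- The action of `J g` is the action of the identity, followed by `D.map g`.
  rw [← h₁, MonoidalCategory.whiskerLeft_comp_assoc, ← h', ← Category.assoc, ← Category.assoc,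
    Category.assoc (ρ_ _).inv, h, Category.id_comp]

/-- The values of `D` on morphisms are instances of the action, by `act_hom`.
Hence an action is determined by its values on objects and its action morphisms. -/
lemma ext_act {M N : HomAction V J} (h : ∀ k, M.D.obj k = N.D.obj k)
    (h' : ∀ k n, M.act k n ≍ N.act k n) : M = N := by
  have hM := fun k n g => M.act_hom (k := k) (n := n) g
  have hN := fun k n g => N.act_hom (k := k) (n := n) g
  obtain ⟨⟨o, m, _, _⟩, a, _, _⟩ := M
  obtain ⟨⟨o', m', _, _⟩, a', _, _⟩ := N
  obtain rfl : o = o' := funext h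
  obtain rfl : a = a' := funext fun k => funext fun n => eq_of_heq (h' k n)
  obtain rfl : @m = @m' := funext fun k => funext fun n => funext fun g =>
    (hM k.unop n.unop g.unop).symm.trans (hN k.unop n.unop g.unop)
  rfl

/-- The morphisms of actions. -/
@[ext]
structure Hom (M N : HomAction V J) where
  /-- the underlying natural transformation -/
  hom : M.D ⟶ N.D
  act (k n : Ξ) : M.act k n ≫ hom.app (op n) = hom.app (op k) ▷ _ ≫ N.act k n

instance : Category (HomAction V J) where
  Hom := Hom
  id M := ⟨𝟙 _, fun k n => by simp⟩
  comp f g := ⟨f.hom ≫ g.hom, fun k n => by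
    rw [NatTrans.comp_app, NatTrans.comp_app, comp_whiskerRight, Category.assoc, ← g.act,
      ← Category.assoc, f.act, Category.assoc]⟩
  id_comp f := Hom.ext (Category.id_comp _)
  comp_id f := Hom.ext (Category.comp_id _)
  assoc f g h := Hom.ext (Category.assoc _ _ _)

variable [HasColimitsOfSize.{0, 0} V] [SymmetricCategory V] [MonoidalClosed V]

/-- The components of the structure map of the algebra given by an action. -/
def desc (M : HomAction V J) (n : Ξ) : coT M.D (homR J (J.obj (op n))) ⟶ M.D.obj (op n) :=
  coDesc (fun k => M.act k n) fun _ _ g => M.map_act g n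

lemma coι_desc (M : HomAction V J) (k n : Ξ) :
    coι M.D (homR J (J.obj (op n))) k ≫ M.desc n = M.act k n := coι_coDesc _ _ _

lemma desc_map (M : HomAction V J) {n n' : Ξ} (g : n' ⟶ n) :
    coMap (𝟙 M.D) (homRMap J (J.map g.op)) ≫ M.desc n' = M.desc n ≫ M.D.map g.op := by
  refine coT_ext fun k => ?_
  rw [coι_coMap_assoc, coι_desc, ← Category.assoc, coι_desc, act_map, NatTrans.id_app,
    id_tensorHom]

/-- A natural transformation is a morphism of algebras if and only if it is compatible with the
action morphisms. -/
lemma desc_hom {M N : HomAction V J} (f : M.D ⟶ N.D) (n : Ξ) :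
    coMap f (𝟙 (homR J (J.obj (op n)))) ≫ N.desc n = M.desc n ≫ f.app (op n) ↔
      ∀ k, M.act k n ≫ f.app (op n) = f.app (op k) ▷ _ ≫ N.act k n := by
  have h₁ (k : Ξ) : coι M.D (homR J (J.obj (op n))) k ≫
      coMap f (𝟙 (homR J (J.obj (op n)))) ≫ N.desc n = f.app (op k) ▷ _ ≫ N.act k n := by
    rw [coι_coMap_assoc, coι_desc, NatTrans.id_app, tensorHom_id]
  have h₂ (k : Ξ) : coι M.D (homR J (J.obj (op n))) k ≫ M.desc n ≫ f.app (op n) =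
      M.act k n ≫ f.app (op n) := by
    rw [← Category.assoc, coι_desc]
  refine ⟨fun h k => ?_, fun h => coT_ext fun k => ?_⟩
  · rw [← h₁, ← h₂, h]
  · rw [h₁, h₂, h]

/-- The structure maps of the coend `∫^k Y k ⊗ A(J k, J p)`, regarded as the value at `p` of the
functor underlying the monad. -/
def monι (Y : Ξᵒᵖ ⥤ V) (k p : Ξ) : Y.obj (op k) ⊗ (J.obj (op k) ⟶[V] J.obj (op p)) ⟶
    ((monT V J).obj Y).obj (op p) := coι Y (homR J (J.obj (op p))) k

lemma monι_ext_tensor {Y : Ξᵒᵖ ⥤ V} {p : Ξ} {B Z : V}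
    {f g : ((monT V J).obj Y).obj (op p) ⊗ B ⟶ Z}
    (h : ∀ k, monι Y k p ▷ B ≫ f = monι Y k p ▷ B ≫ g) : f = g := coT_ext_tensor h

/-- Acting twice, on the summands of the iterated coend. -/
lemma monι_coMap (Y : Ξᵒᵖ ⥤ V) (f : (monT V J).obj Y ⟶ Y) (k p n : Ξ) {Z : V}
    (g : ((monT V J).obj Y).obj (op n) ⟶ Z) :
    monι Y k p ▷ _ ≫ coι ((monT V J).obj Y) (homR J (J.obj (op n))) p ≫
      coMap f (𝟙 (homR J (J.obj (op n)))) ≫ g =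
        (monι Y k p ≫ f.app (op p)) ▷ _ ≫ monι Y p n ≫ g := by
  refine (congrArg (_ ≫ ·) (coι_coMap_assoc f (𝟙 (homR J (J.obj (op n)))) p g)).trans ?_
  rw [NatTrans.id_app, tensorHom_id, comp_whiskerRight, Category.assoc]
  rfl

/-- The multiplication of the monad on the summands of the iterated coend is composition. -/
lemma monι_monMul (Y : Ξᵒᵖ ⥤ V) (k p n : Ξ) {Z : V} (g : ((monT V J).obj Y).obj (op n) ⟶ Z) :
    monι Y k p ▷ _ ≫ coι ((monT V J).obj Y) (homR J (J.obj (op n))) p ≫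
      monMul J Y (J.obj (op n)) ≫ g =
        (α_ _ _ _).hom ≫ Y.obj (op k) ◁ eComp V (J.obj (op k)) (J.obj (op p)) (J.obj (op n)) ≫
          monι Y k n ≫ g := by
  refine (congrArg (_ ≫ ·) ((Category.assoc _ _ _).symm.trans
    (congrArg (· ≫ g) (coι_monMul J Y (J.obj (op n)) p)))).trans ?_
  exact coι_coAct_assoc J Y (J.obj (op p)) (J.obj (op n)) k g

/-- The associativity of an algebra, tested on the summands of the iterated coend. -/
lemma assoc_iff (Y : Ξᵒᵖ ⥤ V) (f : (monT V J).obj Y ⟶ Y) (n : Ξ) :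
    monMul J Y (J.obj (op n)) ≫ f.app (op n) =
        coMap f (𝟙 (homR J (J.obj (op n)))) ≫ f.app (op n) ↔
      ∀ k p, (monι Y k p ≫ f.app (op p)) ▷ (J.obj (op p) ⟶[V] J.obj (op n)) ≫
          monι Y p n ≫ f.app (op n) =
        (α_ _ _ _).hom ≫ Y.obj (op k) ◁ eComp V (J.obj (op k)) (J.obj (op p)) (J.obj (op n)) ≫
          monι Y k n ≫ f.app (op n) := by
  refine ⟨fun h k p => ?_, fun h => ?_⟩
  · rw [← monι_coMap, ← monι_monMul]
    exact congrArg (fun f => _ ≫ _ ≫ f) h.symm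
  · exact coT_ext fun p => monι_ext_tensor fun k =>
      (monι_monMul Y k p n _).trans ((h k p).symm.trans (monι_coMap Y f k p n _).symm)

/-- The algebra over the monad `Y ↦ ∫^m Y m ⊗ A(J m, J -)` given by an action. -/
def algebra (M : HomAction V J) : (mon V J).Algebra where
  A := M.D
  a :=
    { app := fun n => M.desc n.unop
      naturality := fun _ _ g => M.desc_map g.unop }
  unit := by
    ext n
    change monUnit J M.D n ≫ M.desc n.unop = 𝟙 _
    rw [monUnit, Category.assoc, Category.assoc]
    exact (congrArg (fun f => _ ≫ _ ◁ _ ≫ f) (M.coι_desc n.unop n.unop)).trans (M.act_id n.unop)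
  assoc := by
    ext n
    refine (assoc_iff M.D { app := fun n => M.desc n.unop, naturality := _ } n.unop).2 fun k p => ?_
    have h := M.act_act k p n.unop
    simp only [← coι_desc] at h
    exact h

variable (V J) in
/-- The comparison of actions with algebras. -/
def toAlgebra : HomAction V J ⥤ (mon V J).Algebra where
  obj M := M.algebra
  map f :=
    { f := f.hom
      h := by
        ext n
        exact (desc_hom f.hom n.unop).2 fun k => f.act k n.unop }

/-- The action on an algebra. -/
def ofAlgebra (X : (mon V J).Algebra) : HomAction V J where
  D := X.A
  act k n := coι X.A (homR J (J.obj (op n))) k ≫ X.a.app (op n)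
  act_act k p n := (assoc_iff X.A X.a n).1 (congrArg (fun f => f.app (op n)) X.assoc) k p
  act_hom := by
    refine act_hom_of_act_map (J := J) (D := X.A)
      (fun k n => coι X.A (homR J (J.obj (op n))) k ≫ X.a.app (op n)) (fun n => ?_)
      fun k {n n'} g => ?_
    · have h : monUnit J X.A (op n) ≫ X.a.app (op n) = 𝟙 _ :=
        congrArg (fun f => f.app (op n)) X.unit
      exact ((congrArg (_ ≫ ·) (Category.assoc _ _ _).symm).trans
        (Category.assoc _ _ _).symm).trans h
    · have h : coMap (𝟙 X.A) (homRMap J (J.map g.op)) ≫ X.a.app (op n') =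
        X.a.app (op n) ≫ X.A.map g.op := X.a.naturality g.op
      refine (Category.assoc _ _ _).trans ((congrArg (_ ≫ ·) h.symm).trans ?_)
      refine (coι_coMap_assoc (𝟙 X.A) (homRMap J (J.map g.op)) k (X.a.app (op n'))).trans ?_
      exact congrArg (· ≫ coι X.A (homR J (J.obj (op n'))) k ≫ X.a.app (op n'))
        (id_tensorHom _ _)

lemma ofAlgebra_algebra (M : HomAction V J) : ofAlgebra M.algebra = M :=
  HomAction.ext rfl (heq_of_eq (funext fun k => funext fun n => M.coι_desc k n))

lemma algebra_ofAlgebra (X : (mon V J).Algebra) : (ofAlgebra X).algebra = X := by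
  have h : (ofAlgebra X).algebra.a = X.a := by
    ext n
    exact coT_ext fun k => (ofAlgebra X).coι_desc k n.unop
  obtain ⟨Y, a, _, _⟩ := X
  dsimp only [algebra] at h ⊢
  congr 1

instance : (toAlgebra V J).IsIso where
  faithful := ⟨fun h => Hom.ext (congrArg Monad.Algebra.Hom.f h)⟩
  full := ⟨fun f => ⟨⟨f.f, fun k n =>
    (desc_hom f.f n).1 (congrArg (fun f => f.app (op n)) f.h) k⟩, rfl⟩⟩
  bijective_obj := Function.bijective_iff_has_inverse.2
    ⟨ofAlgebra, ofAlgebra_algebra, algebra_ofAlgebra⟩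

end HomAction

end HomAction

/-! ### Enriched presheaves as actions -/

section PresheafAction

variable {V : Type u} [Category.{v} V] [MonoidalCategory V] [MonoidalClosed V]

open scoped MonoidalClosed

/-- Compatibility with composition, for morphisms into internal homs, is associativity of the
transposed actions. -/
lemma comp_eq_iff_uncurry {A B H X Y Z : V} (f : A ⟶ (ihom X).obj Y) (g : B ⟶ (ihom Y).obj Z)
    (h : H ⟶ (ihom X).obj Z) (m : A ⊗ B ⟶ H) :
    m ≫ h = (f ⊗ₘ g) ≫ MonoidalClosed.comp X Y Z ↔
      MonoidalClosed.uncurry f ▷ B ≫ MonoidalClosed.uncurry g =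
        (α_ _ _ _).hom ≫ X ◁ m ≫ MonoidalClosed.uncurry h := by
  rw [← (MonoidalClosed.uncurry_injective (A := X)).eq_iff, MonoidalClosed.uncurry_natural_left,
    MonoidalClosed.uncurry_natural_left, MonoidalClosed.comp_eq, MonoidalClosed.uncurry_curry,
    MonoidalClosed.compTranspose_eq, ← cancel_epi (α_ X A B).hom, eq_comm]
  refine Eq.congr_left ?_
  rw [MonoidalClosed.uncurry_eq, MonoidalClosed.uncurry_eq,
    MonoidalCategory.tensorHom_def]
  simp only [comp_whiskerRight, MonoidalCategory.whiskerLeft_comp, Category.assoc,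
    associator_inv_naturality_right_assoc, associator_inv_naturality_middle_assoc,
    Iso.hom_inv_id_assoc, whisker_exchange_assoc, Functor.id_obj]

lemma comp_curry_eq_comp {A B H X Y Z : V} {f : X ⊗ A ⟶ Y} {g : Y ⊗ B ⟶ Z} {h : X ⊗ H ⟶ Z}
    {m : A ⊗ B ⟶ H} (e : f ▷ B ≫ g = (α_ _ _ _).hom ≫ X ◁ m ≫ h) :
    m ≫ MonoidalClosed.curry h = (MonoidalClosed.curry f ⊗ₘ MonoidalClosed.curry g) ≫
      MonoidalClosed.comp X Y Z := by
  rw [comp_eq_iff_uncurry]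
  simpa only [MonoidalClosed.uncurry_curry] using e

lemma comp_curry_eq_id {H X : V} {h : X ⊗ H ⟶ X} {i : 𝟙_ V ⟶ H}
    (e : (ρ_ X).inv ≫ X ◁ i ≫ h = 𝟙 X) : i ≫ MonoidalClosed.curry h = MonoidalClosed.id X := by
  rw [← MonoidalClosed.curry_natural_left, MonoidalClosed.id_eq]
  rw [Iso.inv_comp_eq, Category.comp_id] at e
  rw [e]

/-- Enriched naturality is compatibility with the transposed actions. -/
lemma ihom_map_eq_pre_iff_uncurry {H X X' Y Y' : V} (h : H ⟶ (ihom X).obj Y)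
    (h' : H ⟶ (ihom X').obj Y') (f : X ⟶ X') (g : Y ⟶ Y') :
    h ≫ (ihom X).map g = h' ≫ (MonoidalClosed.pre f).app Y' ↔
      MonoidalClosed.uncurry h ≫ g = f ▷ H ≫ MonoidalClosed.uncurry h' := by
  rw [← (MonoidalClosed.uncurry_injective (A := X)).eq_iff, MonoidalClosed.uncurry_natural_right,
    MonoidalClosed.uncurry_pre_app]

variable [SymmetricCategory V]

namespace Presheaf

variable {E : Type} [EnrichedCategory V E] {I : Type} [Category.{0} I]

/-- The uncurried action of the morphism objects on an enriched presheaf. -/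
def act (F : Presheaf V E) (X Y : E) :
    F.fct.obj (op X) ⊗ EnrichedCategory.Hom (V := V) Y X ⟶ F.fct.obj (op Y) :=
  MonoidalClosed.uncurry (F.fct.map (op X) (op Y))

lemma act_act (F : Presheaf V E) (X Y Z : E) :
    F.act X Y ▷ EnrichedCategory.Hom (V := V) Z Y ≫ F.act Y Z = (α_ _ _ _).hom ≫
      F.fct.obj (op X) ◁ eComp V (C := Eᵒᵖ) (op X) (op Y) (op Z) ≫ F.act X Z :=
  (comp_eq_iff_uncurry _ _ _ _).1 (F.fct.map_comp (op X) (op Y) (op Z))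

lemma restr_map (F : Presheaf V E) (J : I ⥤ ForgetEnrichment V E) {k n : I} (g : n ⟶ k) :
    (ρ_ _).inv ≫ F.fct.obj (op (J.obj k)) ◁ (ForgetEnrichment.homTo V (J.map g)) ≫
      F.act (J.obj k) (J.obj n) = ((restr J).obj F).map g.op := by
  change _ = MonoidalClosed.uncurry' (ForgetEnrichment.homTo V (J.map g) ≫ F.fct.map _ _)
  rw [MonoidalClosed.uncurry', MonoidalClosed.uncurry_natural_left]
  rfl

variable (V) in
/-- The comparison of enriched presheaves with actions. -/
def toHomAction (J : I ⥤ ForgetEnrichment V E) : Presheaf V E ⥤ HomAction V J.op where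
  obj F :=
    { D := (restr J).obj F
      act := fun k n => F.act (J.obj k) (J.obj n)
      act_act := fun k p n => F.act_act (J.obj k) (J.obj p) (J.obj n)
      act_hom := fun g => F.restr_map J g }
  map {F G} f :=
    { hom := (restr J).map f
      act := fun k n => (ihom_map_eq_pre_iff_uncurry _ _ _ _).1
        (f.naturality (op (J.obj k)) (op (J.obj n))) }

end Presheaf

end PresheafAction

section Incl

variable {V : Type u} [Category.{v} V] [MonoidalCategory V] [SymmetricCategory V]
  [MonoidalClosed V] [HasColimitsOfSize.{0, 0} V] {b b' : Bool}

open scoped MonoidalClosed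

namespace BasedOperad

variable (C : BasedOperad V) (t : b = true → IsTerminal (𝟙_ V))

/-- The enriched presheaf given by an action. -/
def ofHomAction (M : HomAction V (C.incl b' t).op) : Presheaf V (C.Env t) where
  fct :=
    { obj := fun X => M.D.obj (op ⟨FinBased.n X.unop⟩)
      map := fun X Y => MonoidalClosed.curry (M.act ⟨FinBased.n X.unop⟩ ⟨FinBased.n Y.unop⟩)
      map_id := fun X => comp_curry_eq_id (M.act_id ⟨FinBased.n X.unop⟩)
      map_comp := fun X Y Z => comp_curry_eq_comp
        (M.act_act ⟨FinBased.n X.unop⟩ ⟨FinBased.n Y.unop⟩ ⟨FinBased.n Z.unop⟩) }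

lemma ofHomAction_toHomAction (F : Presheaf V (C.Env t)) :
    C.ofHomAction t ((Presheaf.toHomAction V (C.incl b' t)).obj F) = F := by
  obtain ⟨F⟩ := F
  refine congrArg Presheaf.mk ?_
  have h : ∀ X Y, MonoidalClosed.curry (MonoidalClosed.uncurry (F.map X Y)) = F.map X Y :=
    fun X Y => MonoidalClosed.curry_uncurry _
  obtain ⟨obj, map, _, _⟩ := F
  change EnrichedFunctor.mk obj
    (fun X Y => MonoidalClosed.curry (MonoidalClosed.uncurry (map X Y))) _ _ = _
  congr 1
  exact funext fun X => funext fun Y => h X Y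

lemma toHomAction_ofHomAction (M : HomAction V (C.incl b' t).op) :
    (Presheaf.toHomAction V (C.incl b' t)).obj (C.ofHomAction t M) = M :=
  HomAction.ext_act (fun _ => rfl) fun _ _ => heq_of_eq (MonoidalClosed.uncurry_curry _)

instance : (Presheaf.toHomAction V (C.incl b' t)).IsIso where
  faithful := ⟨fun h => Presheaf.Hom.ext (funext fun X =>
    congrArg (fun f => f.hom.app (op ⟨FinBased.n X.unop⟩)) h)⟩
  full := ⟨fun f => ⟨⟨fun X => f.hom.app (op ⟨FinBased.n X.unop⟩), fun X Y =>
    (ihom_map_eq_pre_iff_uncurry _ _ _ _).2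
      (f.act ⟨FinBased.n X.unop⟩ ⟨FinBased.n Y.unop⟩)⟩, rfl⟩⟩
  bijective_obj := Function.bijective_iff_has_inverse.2
    ⟨C.ofHomAction t, C.ofHomAction_toHomAction t, C.toHomAction_ofHomAction t⟩

end BasedOperad

end Incl

/-! ### Units and base points in powers of a based operad -/

section PowerOfOperad

variable {V : Type u} [Category.{v} V] [MonoidalCategory V] [SymmetricCategory V]

lemma leftUnitor_inv_unitLeft {T : Type} [Unique T] (Y : T → V) :
    (λ_ _).inv ≫ unitLeft Y = uniqAll default Y := by
  refine Str.eq (t := noDrop) (X := Y) (e := .all fun t => .leaf t) (e' := .leaf default)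
    (uniqAll_ok default).1 (.comp (e' := .tens .one (.all fun t => .leaf t)) .luInv ?_) ?_
  · exact Str.bind' (X := Y) .leaf (unitLeft_ok T) _ HEq.rfl
  · exact Str.bind' (X := Y) .leaf (uniqAll_ok default) _ HEq.rfl

lemma leftUnitor_inv_unitRight (T : Type) [IsEmpty T] :
    (λ_ _).inv ≫ unitRight (𝟙_ V) T = emptyAll fun _ : T => 𝟙_ V := by
  refine Str.eq (t := noDrop) (X := fun _ : Empty => 𝟙_ V) (e := .all fun _ : T => .one)
    (e' := .one) (by simp [Ex.labels, nodup_flatMap_enum])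
    (.comp (e' := .tens .one (.all fun _ => .one)) .luInv ?_) ?_
  · exact Str.bind' (fun _ => .one) (unitRight_ok T) _ HEq.rfl
  · exact Str.bind' (fun _ => .one) (emptyAll_ok T) _ HEq.rfl

/-- Inserting units before the shuffle is inserting them next to every factor, by coherence. -/
lemma oneAll_shuffle {n k : FinBased false} (φ : n ⟶ k) (B : Fin k.n → V) :
    (λ_ _).inv ≫ oneAll V (Fin n.n) ▷ tAll B ≫ shuffle noDrop φ (fun _ => 𝟙_ V) B =
      tMap fun j => unitRightInv (B j) (Fiber φ j) := by
  refine Str.eq (t := noDrop) (X := B) (e := .all fun j => .leaf j)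
    (e' := .all fun j => .tens (.leaf j) (.all fun _ : Fiber φ j => .one)) (by simp)
    (.comp (e' := .tens .one (.all fun j => .leaf j)) .luInv (.comp
      (e' := .tens (.all fun _ : Fin n.n => .one) (.all fun j => .leaf j)) (.whiskerRight ?_)
      ?_)) (.map fun j => ?_)
  · exact Str.bind' (J := Fin k.n) (K := Empty) (fun _ => .one) (oneAll_ok (Fin n.n)) _ HEq.rfl
  · exact Str.bind (Sum.elim (fun _ => .one) .leaf) (shuffle_ok φ) _
      (can_heq noDrop (by rintro (_ | _) <;> rfl) _)
  · exact Str.bind' (fun _ => .leaf j) (unitRightInv_ok (Fiber φ j)) _ HEq.rfl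

/-- Inserting units after the distribution of the factors to the fibers, by coherence. -/
lemma shuffle_oneAll {k l : FinBased false} (ψ : k ⟶ l) (A : Fin k.n → V) :
    (ρ_ _).inv ≫ tAll A ◁ oneAll V (Fin l.n) ≫ shuffle noDrop ψ A (fun _ => 𝟙_ V) =
      distribute ψ A ≫ tMap fun j => (λ_ (tAll fun i : Fiber ψ j => A i.1)).inv := by
  refine Str.eq (t := noDrop) (X := A) (e := .all fun j => .leaf j)
    (e' := .all fun j => .tens .one (.all fun i : Fiber ψ j => .leaf i.1)) (by simp)
    (.comp (e' := .tens (.all fun j => .leaf j) .one) .ruInv (.comp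
      (e' := .tens (.all fun j => .leaf j) (.all fun _ : Fin l.n => .one)) (.whiskerLeft ?_)
      ?_)) (.comp (e' := .all fun j => .all fun i : Fiber ψ j => .leaf i.1) ?_
        (.map fun j => .luInv))
  · exact Str.bind' (J := Fin k.n) (K := Empty) (fun _ => .one) (oneAll_ok (Fin l.n)) _ HEq.rfl
  · exact Str.bind (Sum.elim .leaf (fun _ => .one)) (shuffle_ok ψ) _
      (can_heq noDrop (by rintro (_ | _) <;> rfl) _)
  · exact Str.bind' .leaf (distribute_ok ψ) _ HEq.rfl

namespace BasedOperad

variable (C : BasedOperad V) {b : Bool}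

/-- The numberings of `S` and `T` that enter the left-hand side cancel. -/
lemma res_lamSeq {S T : Type} [Finite S] [Finite T] (f : S → T) (hf : IsInj b f) :
    res (C.lamSeq b) f hf = C.pull f hf.1 := by
  have h₁ : C.seq.map (Inj.toFin ⟨Nat.card T⟩).op =
      C.pull (Finite.equivFin T).symm (Finite.equivFin T).symm.injective := by
    rw [C.pull_equiv, tr, res]
    refine congrArg C.seq.map (Quiver.Hom.unop_inj (Subtype.ext (funext fun x => ?_)))
    exact (Equiv.apply_symm_apply (Finite.equivFin T) _).symm
  have h₂ : C.seq.map (Inj.ofFin ⟨Nat.card S⟩).op =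
      C.pull (Finite.equivFin S) (Finite.equivFin S).injective := by
    rw [C.pull_equiv, tr, res]
    refine congrArg C.seq.map (Quiver.Hom.unop_inj (Subtype.ext (funext fun x => ?_)))
    exact congrArg (Finite.equivFin (Fin (Nat.card S)))
      (Equiv.apply_symm_apply (Finite.equivFin S) _).symm
  refine (congrArg₂ (fun f g => f ≫ _ ≫ g) h₁ h₂).trans ?_
  refine (congrArg (_ ≫ ·) (C.pull_comp _ _ _ _)).trans ((C.pull_comp _ _ _ _).trans ?_)
  congr 1
  funext x
  change (Finite.equivFin T).symm (Finite.equivFin T (f ((Finite.equivFin S).symm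
    (Finite.equivFin S x)))) = f x
  rw [Equiv.symm_apply_apply, Equiv.symm_apply_apply]

lemma tr_lamSeq {S T : Type} [Finite S] [Finite T] (e : S ≃ T) :
    tr (C.lamSeq b) e = tr C.seq e :=
  (C.res_lamSeq _ _).trans (C.pull_equiv e.symm)

/-- The unit (for a nonempty `T`) or the base point (for an empty `T`) of `C`, inserted by `fill`,
may be inserted by the structure map of the operad. -/
lemma fill_lamSeq {T : Type} [Finite T] [Subsingleton T] (hT : b = false → Nonempty T)
    (S : T → Type) [∀ t, Finite (S t)] :
    fill (C.lamSeq b) (fun _ => C.base) hT S = (λ_ _).inv ≫ (C.pt T ⊗ₘ 𝟙 _) ≫ C.γ S := by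
  rcases isEmpty_or_nonempty T with h | ⟨⟨t⟩⟩
  -- All the factors indexed by the empty set `T` may be replaced by units, and the structure map
  -- applied to base points is then the right unit law.
  · have hb : b = true := Bool.eq_true_of_not_eq_false fun hb => (hT hb).elim h.elim
    have : ∀ t, Unique (S t) := fun t => h.elim t
    let a : ∀ t, ev C.seq (S t) ⟶ 𝟙_ V := fun t => h.elim t
    have h₁ : 𝟙 (tAll fun t => ev C.seq (S t)) = tMap a ≫ tMap fun t => C.pt (S t) := by
      rw [tMap_comp, ← tMap_id]
      exact congrArg tMap (funext fun t => h.elim t)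
    have h₂ : C.pt T ⊗ₘ 𝟙 (tAll fun t => ev C.seq (S t)) =
        (𝟙 _ ⊗ₘ tMap a) ≫ (C.pt T ⊗ₘ 𝟙 _) ≫ (𝟙 _ ⊗ₘ tMap fun t => C.pt (S t)) := by
      rw [tensorHom_comp_tensorHom, tensorHom_comp_tensorHom, h₁]
      simp only [Category.comp_id, Category.id_comp]
    have h₃ : C.γ S = (C.γ S ≫ tr C.seq (Equiv.sigmaUnique T S)) ≫
        tr C.seq (Equiv.sigmaUnique T S).symm := by
      rw [Category.assoc, tr_comp, tr_refl, Category.comp_id]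
      simp
    refine (fill_empty _ _ _ hb S).trans (Eq.symm ?_)
    rw [h₂, h₃, Category.assoc, Category.assoc, Category.assoc,
      reassoc_of% C.γ_pt_right S, unitRight_natural_assoc, id_tensorHom,
      ← leftUnitor_inv_naturality_assoc, reassoc_of% leftUnitor_inv_unitRight,
      reassoc_of% emptyAll_natural a, pt, dif_neg (not_nonempty_iff.2 h), Category.assoc, tr_comp]
    exact congrArg (fun f => _ ≫ _ ≫ f) ((tr_empty _ _ _).trans (C.tr_lamSeq _).symm)
  · let _ : Unique T := uniqueOfSubsingleton t
    have h₁ : C.γ S = (C.γ S ≫ tr C.seq (Equiv.uniqueSigma S)) ≫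
        tr C.seq (Equiv.uniqueSigma S).symm := by
      rw [Category.assoc, tr_comp, tr_refl, Category.comp_id]
      simp
    refine (fill_of _ _ (default : T) hT S).trans (Eq.symm ?_)
    rw [h₁, Category.assoc, reassoc_of% C.γ_pt_left S, reassoc_of% leftUnitor_inv_unitLeft]
    refine congrArg (_ ≫ ·) (Eq.trans ?_ (C.tr_lamSeq _).symm)
    exact congrArg (tr C.seq) (Equiv.ext fun s => rfl)

/-- The contravariant functoriality of the powers is composition with units and base points. -/
lemma powR_lamSeq {m n k : FinBased false} {ω : m ⟶ n} (h : IsLam b ω) (φ : n ⟶ k)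
    [∀ j, Subsingleton (Fiber ω j)] :
    powR (C.lamSeq b) h φ = (λ_ _).inv ≫ C.ptAll ω ▷ C.comp φ ≫ C.compMap noDrop ω φ := by
  have h₁ : C.ptAll ω ▷ C.comp φ = oneAll V _ ▷ C.comp φ ≫
      ((tMap fun j => C.pt (Fiber ω j)) ⊗ₘ tMap fun j => 𝟙 (ev C.seq (Fiber φ j))) := by
    rw [tMap_id, ← tensorHom_id, ← tensorHom_id, tensorHom_comp_tensorHom, Category.comp_id]
    rfl
  rw [h₁, compMap, Category.assoc, reassoc_of% shuffle_natural noDrop φ,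
    reassoc_of% oneAll_shuffle φ, tMap_comp, tMap_comp]
  refine congrArg tMap (funext fun j => ?_)
  refine (C.res_lamSeq _ _).trans ?_
  rw [← C.cut_tr_eq_pull (fiberMap ω φ j) _ (fun i : Fiber φ j => Fiber ω i.1) (fiberComp ω φ j)
    fun p => by rw [fiberMap, Equiv.symm_apply_apply], cut, γFiber]
  simp only [Category.assoc]
  rfl

/-- The covariant functoriality of the powers is composition with units and base points. -/
lemma powL_lamSeq {n k l : FinBased false} (φ : n ⟶ k) {ψ : k ⟶ l} (h : IsLam b ψ)
    [∀ j, Subsingleton (Fiber ψ j)] :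
    powL (C.lamSeq b) (fun _ => C.base) φ h =
      (ρ_ _).inv ≫ C.comp φ ◁ C.ptAll ψ ≫ C.compMap noDrop φ ψ := by
  have h₁ : C.comp φ ◁ C.ptAll ψ = C.comp φ ◁ oneAll V _ ≫
      ((tMap fun j => 𝟙 (ev C.seq (Fiber φ j))) ⊗ₘ tMap fun j => C.pt (Fiber ψ j)) := by
    rw [tMap_id, ← id_tensorHom, ← id_tensorHom, tensorHom_comp_tensorHom, Category.comp_id]
    rfl
  rw [h₁, compMap, Category.assoc, reassoc_of% shuffle_natural noDrop ψ,
    reassoc_of% shuffle_oneAll ψ, tMap_comp, tMap_comp]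
  refine congrArg (_ ≫ ·) (congrArg tMap (funext fun j => ?_))
  refine (congrArg₂ (· ≫ ·) (C.fill_lamSeq (h.ne j) fun i : Fiber ψ j => Fiber φ i.1)
    (C.tr_lamSeq (fiberComp φ ψ j))).trans ?_
  rw [γFiber, tMap_id]
  exact (Category.assoc _ _ _).trans (congrArg (_ ≫ ·) (Category.assoc _ _ _))

end BasedOperad

end PowerOfOperad

/-! ### The Kelly product and the permutative envelope -/

section Whiskering

variable {V : Type u} [Category.{v} V] [MonoidalCategory V] [SymmetricCategory V]

/-- Associativity of an action of the morphism objects of a graded family, tested on the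
summands. -/
lemma Graded.act_act_iff [MonoidalClosed V] [HasColimitsOfSize.{0, 0} V] {B : Type}
    [Category.{0} B] (G : Graded V B) {n p k : B} {X Y Z : V}
    (f : X ⊗ G.Hom p k ⟶ Y) (g : Y ⊗ G.Hom n p ⟶ Z) (h : X ⊗ G.Hom n k ⟶ Z) :
    f ▷ G.Hom n p ≫ g = (α_ _ _ _).hom ≫ X ◁ ((β_ _ _).hom ≫ G.comp n p k) ≫ h ↔
      ∀ (ψ : n ⟶ p) (φ : p ⟶ k), (X ◁ G.ι φ ≫ f) ▷ G.W ψ ≫ Y ◁ G.ι ψ ≫ g =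
        (α_ _ _ _).hom ≫ X ◁ ((β_ _ _).hom ≫ G.c ψ φ) ≫ X ◁ G.ι (ψ ≫ φ) ≫ h := by
  have h₁ (ψ : n ⟶ p) (φ : p ⟶ k) : X ◁ (G.ι φ ⊗ₘ G.ι ψ) ≫ (α_ _ _ _).inv ≫
      f ▷ G.Hom n p ≫ g =
        (α_ _ _ _).inv ≫ (X ◁ G.ι φ ≫ f) ▷ G.W ψ ≫ Y ◁ G.ι ψ ≫ g := by
    rw [← id_tensorHom, associator_inv_naturality_assoc, MonoidalCategory.tensorHom_def,
      Category.assoc, id_tensorHom, whisker_exchange_assoc, comp_whiskerRight_assoc]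
  have h₂ (ψ : n ⟶ p) (φ : p ⟶ k) : X ◁ (G.ι φ ⊗ₘ G.ι ψ) ≫
      X ◁ ((β_ _ _).hom ≫ G.comp n p k) ≫ h =
        X ◁ ((β_ _ _).hom ≫ G.c ψ φ) ≫ X ◁ G.ι (ψ ≫ φ) ≫ h := by
    rw [← MonoidalCategory.whiskerLeft_comp_assoc, BraidedCategory.braiding_naturality_assoc,
      G.ι_comp, ← MonoidalCategory.whiskerLeft_comp_assoc, Category.assoc]
  rw [← Iso.inv_comp_eq]
  refine ⟨fun h ψ φ => ?_, fun h => ?_⟩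
  · rw [← h₂, ← h, ← Iso.inv_comp_eq, h₁]
  -- Tensoring with `X` preserves the coproducts, since `V` is closed.
  · refine MonoidalClosed.curry_injective (ext₂ fun φ ψ => ?_)
    refine (MonoidalClosed.curry_natural_left _ _).symm.trans
      (Eq.trans (congrArg MonoidalClosed.curry ?_) (MonoidalClosed.curry_natural_left _ _))
    refine (h₁ ψ φ).trans (Eq.trans ?_ (h₂ ψ φ).symm)
    rw [Iso.inv_comp_eq]
    exact h ψ φ

/-- Composition with an element of a summand, on the right. -/
lemma Graded.ι_comp_right [MonoidalClosed V] [HasColimitsOfSize.{0, 0} V] {B : Type}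
    [Category.{0} B] (G : Graded V B) {n m k : B} (φ : n ⟶ m) {ψ : m ⟶ k} (x : 𝟙_ V ⟶ G.W ψ) :
    G.ι φ ≫ (λ_ _).inv ≫ (x ≫ G.ι ψ) ▷ G.Hom n m ≫ (β_ _ _).hom ≫ G.comp n m k =
      ((ρ_ _).inv ≫ G.W φ ◁ x ≫ G.c φ ψ) ≫ G.ι (φ ≫ ψ) := by
  rw [BraidedCategory.braiding_naturality_left_assoc, leftUnitor_inv_braiding_assoc,
    rightUnitor_inv_naturality_assoc, ← whisker_exchange_assoc,
    MonoidalCategory.whiskerLeft_comp_assoc, ← tensorHom_def'_assoc, G.ι_comp,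
    Category.assoc, Category.assoc]

/-- Composition with an element of a summand, on the left. -/
lemma Graded.ι_comp_left [MonoidalClosed V] [HasColimitsOfSize.{0, 0} V] {B : Type}
    [Category.{0} B] (G : Graded V B) {n m k : B} {φ : n ⟶ m} (x : 𝟙_ V ⟶ G.W φ) (ψ : m ⟶ k) :
    G.ι ψ ≫ (ρ_ _).inv ≫ G.Hom m k ◁ (x ≫ G.ι φ) ≫ (β_ _ _).hom ≫ G.comp n m k =
      ((λ_ _).inv ≫ x ▷ G.W ψ ≫ G.c φ ψ) ≫ G.ι (φ ≫ ψ) := by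
  rw [BraidedCategory.braiding_naturality_right_assoc, rightUnitor_inv_braiding_assoc,
    leftUnitor_inv_naturality_assoc, whisker_exchange_assoc,
    comp_whiskerRight_assoc, ← MonoidalCategory.tensorHom_def_assoc, G.ι_comp,
    Category.assoc, Category.assoc]

variable [MonoidalClosed V] [HasColimitsOfSize.{0, 0} V] {b b' : Bool}

namespace BasedOperad

variable (C : BasedOperad V)

/-- The covariant functoriality of the powers, as the functoriality of the morphism objects of the
permutative envelope. -/
lemma powPush_lamSeq {k m : Inj b'} (g : k ⟶ m) (n : Inj b') :
    powPush (C.lamSeq b') (fun _ => C.base) n.fin (IsLam.based g) =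
      eHomWhiskerRight V ((C.incl b' noDrop).op.map g.op) ((C.incl b' noDrop).op.obj (op n)) :=
  pow_ext _ fun φ => (powι_powDesc _ _ φ).trans <|
    (congrArg (· ≫ _) (C.powL_lamSeq φ (IsLam.based g))).trans
      ((C.graded noDrop).ι_comp_right φ (ψ := Inj.based g) (C.ptAll (Inj.based g))).symm

/-- The contravariant functoriality of the powers, as the functoriality of the morphism objects of
the permutative envelope. -/
lemma powRes_lamSeq {n' n : Inj b'} (g : n' ⟶ n) (k : Inj b') :
    powRes (C.lamSeq b') (IsLam.based g) k.fin =
      eHomWhiskerLeft V ((C.incl b' noDrop).op.obj (op k)) ((C.incl b' noDrop).op.map g.op) :=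
  pow_ext _ fun φ => (powι_powDesc _ _ φ).trans <|
    (congrArg (· ≫ _) (C.powR_lamSeq (IsLam.based g) φ)).trans
      ((C.graded noDrop).ι_comp_left (φ := Inj.based g) (C.ptAll (Inj.based g)) φ).symm

/-- The structure maps of the coend `D ⊙ C`. -/
def kellyCoι (D : (Inj b')ᵒᵖ ⥤ V) (k n : Inj b') :
    D.obj (op k) ⊗ (((C.incl b' noDrop).op.obj (op k)) ⟶[V] ((C.incl b' noDrop).op.obj (op n))) ⟶
      (C.kellyRight D).obj (op n) :=
  coι D (powF (C.lamSeq b') (fun _ => C.base) n) k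

lemma kelly_ext {D : (Inj b')ᵒᵖ ⥤ V} {n : Inj b'} {Z : V} {f g : (C.kellyRight D).obj (op n) ⟶ Z}
    (h : ∀ k, C.kellyCoι D k n ≫ f = C.kellyCoι D k n ≫ g) : f = g := coT_ext h

lemma kellyCoι_map (D : (Inj b')ᵒᵖ ⥤ V) (k : Inj b') {n' n : Inj b'} (g : n' ⟶ n) :
    C.kellyCoι D k n ≫ (C.kellyRight D).map g.op =
      D.obj (op k) ◁ eHomWhiskerLeft V ((C.incl b' noDrop).op.obj (op k))
        ((C.incl b' noDrop).op.map g.op) ≫ C.kellyCoι D k n' := by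
  refine (coι_coMap (𝟙 D) (powFMap (C.lamSeq b') (fun _ => C.base) g) k).trans ?_
  refine congrArg (· ≫ C.kellyCoι D k n') ?_
  exact (id_tensorHom _ _).trans (congrArg (_ ◁ ·) (C.powRes_lamSeq g k))

lemma kellyCoι_kellyMap {D D' : (Inj b')ᵒᵖ ⥤ V} (f : D ⟶ D') (k n : Inj b') :
    C.kellyCoι D k n ≫ (C.kellyMap f).app (op n) = f.app (op k) ▷ _ ≫ C.kellyCoι D' k n := by
  refine (coι_coMap f (𝟙 _) k).trans ?_
  exact congrArg (· ≫ C.kellyCoι D' k n) (tensorHom_id _ _)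

end BasedOperad

namespace HomAction

variable {C : BasedOperad V} (M : HomAction V (C.incl b' noDrop).op)

/-- The components of the module structure given by an action. -/
def kellyDesc (n : Inj b') : (C.kellyRight M.D).obj (op n) ⟶ M.D.obj (op n) :=
  coDesc (fun k => M.act k n) fun _ m g => (M.map_act g n).trans
    (congrArg (fun f => _ ◁ f ≫ M.act m n) (C.powPush_lamSeq g n).symm)

lemma kellyCoι_kellyDesc (k n : Inj b') : C.kellyCoι M.D k n ≫ M.kellyDesc n = M.act k n :=
  coι_coDesc _ _ _

/-- The module structure given by an action. -/
def kellyAct : C.kellyRight M.D ⟶ M.D where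
  app n := M.kellyDesc n.unop
  naturality n n' g := C.kelly_ext fun k => by
    rw [← Category.assoc, ← Category.assoc, kellyCoι_kellyDesc]
    refine (congrArg (· ≫ M.kellyDesc n'.unop) (C.kellyCoι_map M.D k g.unop)).trans ?_
    refine Eq.trans ?_ (M.act_map k g.unop).symm
    rw [Category.assoc, kellyCoι_kellyDesc]

end HomAction

end Whiskering

/-! ### Right modules as actions -/

section RightModules

variable {V : Type u} [Category.{v} V] [MonoidalCategory V] [SymmetricCategory V]
  [MonoidalClosed V] [HasColimitsOfSize.{0, 0} V] {b : Bool} {C : BasedOperad V}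

lemma BasedOperad.kellyι_kellyMap {D D' : (Inj b)ᵒᵖ ⥤ V} (f : D ⟶ D') {n k : Inj b}
    (ψ : n.fin ⟶ k.fin) {Z : V} (g : (C.kellyRight D').obj (op n) ⟶ Z) :
    C.kellyι D ψ ≫ (C.kellyMap f).app (op n) ≫ g = f.app (op k) ▷ C.comp ψ ≫ C.kellyι D' ψ ≫ g := by
  refine (Category.assoc _ _ _).trans ((congrArg (_ ≫ ·) ((Category.assoc _ _ _).symm.trans
    (congrArg (· ≫ g) (C.kellyCoι_kellyMap f k n)))).trans ?_)
  refine (congrArg (_ ≫ ·) (Category.assoc _ _ _)).trans ?_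
  refine (whisker_exchange_assoc _ _ _).trans ?_
  exact congrArg (_ ≫ ·) (Category.assoc _ _ _).symm

namespace RMod

/-- The unit law of a module, in terms of the morphism objects of the permutative envelope. -/
lemma unit_iff {D : (Inj b)ᵒᵖ ⥤ V} (f : C.kellyRight D ⟶ D) (n : Inj b) :
    (ρ_ _).inv ≫ D.obj (op n) ◁ C.ptAll (𝟙 n.fin) ≫ C.kellyι D (𝟙 n.fin) ≫ f.app (op n) = 𝟙 _ ↔
      (ρ_ _).inv ≫ D.obj (op n) ◁ eId V ((C.incl b noDrop).op.obj (op n)) ≫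
        C.kellyCoι D n n ≫ f.app (op n) = 𝟙 _ := by
  refine Eq.congr_left (congrArg (_ ≫ ·) ?_)
  refine (congrArg (_ ≫ ·) (Category.assoc _ _ _)).trans ?_
  exact (MonoidalCategory.whiskerLeft_comp_assoc _ _ _ _).symm

/-- The associativity of a module, in terms of the morphism objects of the permutative envelope. -/
lemma assoc_iff {D : (Inj b)ᵒᵖ ⥤ V} (f : C.kellyRight D ⟶ D) (k p n : Inj b) :
    (C.kellyCoι D k p ≫ f.app (op p)) ▷ _ ≫ C.kellyCoι D p n ≫ f.app (op n) =
        (α_ _ _ _).hom ≫ D.obj (op k) ◁ eComp V ((C.incl b noDrop).op.obj (op k))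
          ((C.incl b noDrop).op.obj (op p)) ((C.incl b noDrop).op.obj (op n)) ≫
            C.kellyCoι D k n ≫ f.app (op n) ↔
      ∀ (ψ : n.fin ⟶ p.fin) (φ : p.fin ⟶ k.fin),
        C.kellyι D φ ▷ C.comp ψ ≫ C.kellyι (C.kellyRight D) ψ ≫
          (C.kellyMap f ≫ f).app (op n) =
        (α_ _ _ _).hom ≫ D.obj (op k) ◁ ((β_ _ _).hom ≫ shuffle noDrop φ _ _ ≫
          tMap fun j => C.γFiber ψ φ j) ≫ C.kellyι D (ψ ≫ φ) ≫ f.app (op n) := by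
  refine ((C.graded noDrop).act_act_iff _ _ _).trans
    (forall_congr' fun (ψ : n.fin ⟶ p.fin) => forall_congr' fun (φ : p.fin ⟶ k.fin) => ?_)
  have h₁ : C.kellyι D φ ▷ C.comp ψ ≫ C.kellyι (C.kellyRight D) ψ ≫
      (C.kellyMap f ≫ f).app (op n) =
        (C.kellyι D φ ≫ f.app (op p)) ▷ C.comp ψ ≫ C.kellyι D ψ ≫ f.app (op n) := by
    rw [comp_whiskerRight_assoc]
    exact congrArg (_ ≫ ·) (BasedOperad.kellyι_kellyMap f ψ _)
  have h₂ {n k : Inj b} (φ : n.fin ⟶ k.fin) : C.kellyι D φ ≫ f.app (op n) =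
      D.obj (op k) ◁ (C.graded noDrop).ι φ ≫ C.kellyCoι D k n ≫ f.app (op n) :=
    Category.assoc _ _ _
  exact Eq.congr
    (h₁.trans (congrArg₂ (fun x y => x ▷ C.comp ψ ≫ y) (h₂ φ) (h₂ ψ))).symm
    (congrArg (fun x => _ ≫ _ ◁ _ ≫ x) (h₂ (ψ ≫ φ)).symm)

end RMod

namespace HomAction

/-- The right module given by an action. -/
def rmod (M : HomAction V (C.incl b noDrop).op) : RMod b C where
  D := M.D
  act := M.kellyAct
  unit n := (RMod.unit_iff M.kellyAct n).2 <|
    (congrArg (fun f => _ ≫ _ ◁ _ ≫ f) (M.kellyCoι_kellyDesc n n)).trans (M.act_id n)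
  assoc {n p k} := (RMod.assoc_iff M.kellyAct k p n).1 <| by
    have h := M.act_act k p n
    simp only [← kellyCoι_kellyDesc] at h
    exact h

/-- A natural transformation is a morphism of modules if and only if it is compatible with the
action morphisms. -/
lemma kellyAct_hom {M N : HomAction V (C.incl b noDrop).op} (f : M.D ⟶ N.D) :
    M.kellyAct ≫ f = C.kellyMap f ≫ N.kellyAct ↔
      ∀ k n, M.act k n ≫ f.app (op n) = f.app (op k) ▷ _ ≫ N.act k n := by
  have h₁ (k n : Inj b) : C.kellyCoι M.D k n ≫ M.kellyDesc n ≫ f.app (op n) =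
      M.act k n ≫ f.app (op n) := by
    rw [← Category.assoc, kellyCoι_kellyDesc]
  have h₂ (k n : Inj b) : C.kellyCoι M.D k n ≫ (C.kellyMap f).app (op n) ≫ N.kellyDesc n =
      f.app (op k) ▷ _ ≫ N.act k n := by
    rw [← Category.assoc, C.kellyCoι_kellyMap, Category.assoc, kellyCoι_kellyDesc]
  refine ⟨fun h k n => ?_, fun h => NatTrans.ext (funext fun n => C.kelly_ext fun k => ?_)⟩
  · rw [← h₁, ← h₂]
    exact congrArg (fun f => _ ≫ f.app (op n)) h
  · exact (h₁ k n.unop).trans ((h k n.unop).trans (h₂ k n.unop).symm)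

variable (b C) in
/-- The comparison of actions with right modules. -/
def toRMod : HomAction V (C.incl b noDrop).op ⥤ RMod b C where
  obj M := M.rmod
  map f := ⟨f.hom, (kellyAct_hom f.hom).2 f.act⟩

/-- The action on a right module. -/
def ofRMod (X : RMod b C) : HomAction V (C.incl b noDrop).op where
  D := X.D
  act k n := C.kellyCoι X.D k n ≫ X.act.app (op n)
  act_act k p n := (RMod.assoc_iff X.act k p n).2 X.assoc
  act_hom := by
    refine act_hom_of_act_map (J := (C.incl b noDrop).op) (D := X.D)
      (fun k n => C.kellyCoι X.D k n ≫ X.act.app (op n))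
      (fun n => (RMod.unit_iff X.act n).1 (X.unit n)) fun k {n n'} g => ?_
    rw [Category.assoc, ← X.act.naturality, ← Category.assoc, C.kellyCoι_map, Category.assoc]

lemma ofRMod_rmod (M : HomAction V (C.incl b noDrop).op) : ofRMod M.rmod = M :=
  HomAction.ext rfl (heq_of_eq (funext fun k => funext fun n => M.kellyCoι_kellyDesc k n))

lemma rmod_ofRMod (X : RMod b C) : (ofRMod X).rmod = X := by
  have h : (ofRMod X).rmod.act = X.act := by
    ext n
    exact C.kelly_ext fun k => (ofRMod X).kellyCoι_kellyDesc k n.unop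
  obtain ⟨D, a, _, _⟩ := X
  dsimp only [rmod] at h ⊢
  congr 1

instance : (toRMod b C).IsIso where
  faithful := ⟨fun h => Hom.ext (congrArg RMod.Hom.hom h)⟩
  full := ⟨fun f => ⟨⟨f.hom, (kellyAct_hom f.hom).1 f.act⟩, rfl⟩⟩
  bijective_obj := Function.bijective_iff_has_inverse.2 ⟨ofRMod, ofRMod_rmod, rmod_ofRMod⟩

end HomAction

end RightModules

/-! ### The isomorphisms of categories -/

section Comparison

variable {V : Type u} [Category.{v} V] [MonoidalCategory V] [SymmetricCategory V]
  [MonoidalClosed V] [HasColimitsOfSize.{0, 0} V] {b : Bool} (C : BasedOperad V)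

lemma BasedOperad.exists_isoCat_algebra (b' : Bool) (t : b = true → IsTerminal (𝟙_ V)) :
    ∃ e : IsoCat (Presheaf V (C.Env t)) (C.monad b' t).Algebra,
      e.functor ⋙ Monad.forget _ = Presheaf.restr (C.incl b' t) :=
  ⟨(Presheaf.toHomAction V (C.incl b' t)).asIsomorphism.trans
    (HomAction.toAlgebra V (C.incl b' t).op).asIsomorphism, rfl⟩

lemma BasedOperad.exists_isoCat_rmod (b' : Bool) :
    ∃ e : IsoCat (Presheaf V C.Envelope) (RMod b' C),
      e.functor ⋙ RMod.forget b' C = Presheaf.restr (C.incl b' noDrop) :=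
  ⟨(Presheaf.toHomAction V (C.incl b' noDrop)).asIsomorphism.trans
    (HomAction.toRMod b' C).asIsomorphism, rfl⟩

end Comparison

end

end OperadModules

theorem mainTheorem6 :
    (∀ (V : Type u) [Category.{v} V] [MonoidalCategory V] [SymmetricCategory V] [MonoidalClosed V]
      [HasLimits V] [HasColimits V] (C : BasedOperad V),
      (∃ e : IsoCat (Presheaf V C.Envelope) (C.monad false noDrop).Algebra,
        e.functor ⋙ Monad.forget _ = Presheaf.restr (C.incl false noDrop)) ∧
      (∃ e : IsoCat (Presheaf V C.Envelope) (C.monad true noDrop).Algebra,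
        e.functor ⋙ Monad.forget _ = Presheaf.restr (C.incl true noDrop)) ∧
      (∃ e : IsoCat (Presheaf V C.Envelope) (RMod false C),
        e.functor ⋙ RMod.forget false C = Presheaf.restr (C.incl false noDrop)) ∧
      (∃ e : IsoCat (Presheaf V C.Envelope) (RMod true C),
        e.functor ⋙ RMod.forget true C = Presheaf.restr (C.incl true noDrop))) ∧
    (∀ (V : Type u) [Category.{v} V] [CartesianMonoidalCategory V] [SymmetricCategory V]
      [MonoidalClosed V] [HasLimits V] [HasColimits V] (C : BasedOperad V),
      (∃ e : IsoCat (Presheaf V C.Operators) (C.monad (b := true) false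
          fun _ => CartesianMonoidalCategory.isTerminalTensorUnit).Algebra,
        e.functor ⋙ Monad.forget _ = Presheaf.restr (C.incl false _)) ∧
      (∃ e : IsoCat (Presheaf V C.Operators) (C.monad (b := true) true
          fun _ => CartesianMonoidalCategory.isTerminalTensorUnit).Algebra,
        e.functor ⋙ Monad.forget _ = Presheaf.restr (C.incl true _))) := by
  refine ⟨fun V _ _ _ _ _ _ C => ⟨?_, ?_, ?_, ?_⟩, fun V _ _ _ _ _ _ C => ⟨?_, ?_⟩⟩
  · exact C.exists_isoCat_algebra false noDrop
  · exact C.exists_isoCat_algebra true noDrop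
  · exact C.exists_isoCat_rmod false
  · exact C.exists_isoCat_rmod true
  · exact C.exists_isoCat_algebra false _
  · exact C.exists_isoCat_algebra true _
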